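/- Let $J$ be a real, invertible, skew-symmetric $2\times2$ matrix, let $\omega>0$, and let $q,w$ be $2\times 2$ matrices whose entries are real, $\omega$-periodic distributions of order $0$ on $\mathbb R$ (equivalently, real signed Radon measures), with $q$ symmetric and $w$ non-negative. For a matrix $r$ of such distributions let $\Delta_r(x)$ denote the matrix of the point masses $r(\{x\})$. For $x\in\mathbb R$ and $\lambda\in\mathbb C$ put $$B_\pm(x,\lambda)=J\pm\tfrac12\big(\Delta_q(x)-\lambda\Delta_w(x)\big),$$ and assume that $B_\pm(x,\lambda)$ are invertible for all $x,\lambda\in\mathbb R$. Let $\Lambda$ be the set of all $\lambda\in\mathbb C$ such that $B_+(x,\lambda)$ or $B_-(x,\lambda)$ is not invertible for some $x\in\mathbb R$. Solutions of the equations below are $\mathbb C^2$-valued functions $u$ on $\mathbb R$ of locally bounded variation that are balanced, i.e. $u(x)=\frac12(u^+(x)+u^-(x))$ for all $x$, where $u^\pm$ are the right- and left-hand limits; the equations are understood in the sense of distributions. Let $\mathcal L^2(w)$ be the space of $\mathbb C^2$-valued functions $f$ that are measurable with respect to $\operatorname{tr}w$ and satisfy $\|f\|^2=\int f^*wf<\infty$,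 and let $L^2(w)$ be its quotient by the kernel of $\|\cdot\|$. Let $$T_{\max}=\{([u],[f])\in L^2(w)\times L^2(w): u,f\in\mathcal L^2(w),\ u \text{ balanced of locally bounded variation},\ Ju'+qu=wf\},$$ $$\mathcal L_0=\{u \text{ balanced of locally bounded variation}: Ju'+qu=0 \text{ and } wu=0\}.$$ For $\lambda\in\mathbb C\setminus\Lambda$ let $U(\cdot,\lambda)$ be a fundamental matrix of solutions of $Ju'+qu=\lambda wu$ (its columns form a basis of the two-dimensional space of solutions), let $M(\lambda)$ be the monodromy matrix determined by $U(x+\omega,\lambda)=U(x,\lambda)M(\lambda)$ for all $x\in\mathbb R$, and let $D(\lambda)=\operatorname{tr}M(\lambda)$ be the Floquet discriminant, which does not depend on the choice of $U$. Then $D$ is constant on $\mathbb C\setminus\Lambda$ if and only if $T_{\max}=\{0\}\times L^2(w)$. Moreover, if $\dim\mathcal L_0=1$, then $D(\lambda)\notin(-2,2)$ for every $\lambda\in\mathbb C\setminus\Lambda$. -/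

import Mathlib

open MeasureTheory Set Filter Topology
open scoped ENNReal Matrix

noncomputable section

namespace Floquet

/-! Real distributions of order zero -/

/-- A real distribution of order `0` on the real line, i.e. a real (signed) Radon measure, given by
its Jordan decomposition: two mutually singular positive Borel measures that are finite on bounded
sets. It acts on a test function `φ` by `∫ φ dpos - ∫ φ dneg`, see `OrderZero.integral`. As the
Jordan decomposition is unique, equality of two such objects is equality as distributions. -/
structure OrderZero where
  pos : Measure ℝ
  neg : Measure ℝ
  pos_locallyFinite : IsLocallyFiniteMeasure pos
  neg_locallyFinite : IsLocallyFiniteMeasure neg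
  mutuallySingular : pos ⟂ₘ neg

attribute [instance] OrderZero.pos_locallyFinite OrderZero.neg_locallyFinite

/-- The integral `∫ g dr` (for `g` integrable on both parts of `r`). -/
def OrderZero.integral (r : OrderZero) (g : ℝ → ℂ) : ℂ :=
  (∫ x, g x ∂r.pos) - ∫ x, g x ∂r.neg

/-- The value `r(E)` of the local measure `r` on a bounded Borel set `E`. -/
def OrderZero.value (r : OrderZero) (E : Set ℝ) : ℝ :=
  r.pos.real E - r.neg.real E

/-- `ω` is a period of `r`: translation by `ω` leaves the local measure `r` unchanged. -/
def OrderZero.IsPeriod (r : OrderZero) (ω : ℝ) : Prop :=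
  ∀ E : Set ℝ, MeasurableSet E → Bornology.IsBounded E →
    r.value ((fun x => x + ω) ⁻¹' E) = r.value E

/-- The matrix `Δ_r(x) = R⁺(x) - R⁻(x)` of jumps of an antiderivative `R` of `r`, that is, the
matrix of the masses of the one-point set `{x}`. -/
def jump (r : Matrix (Fin 2) (Fin 2) OrderZero) (x : ℝ) : Matrix (Fin 2) (Fin 2) ℝ :=
  Matrix.of fun i j => (r i j).value {x}

/-- Smooth compactly supported functions from the real line to the complex numbers. -/
def IsTest (φ : ℝ → ℂ) : Prop := ContDiff ℝ ((⊤ : ℕ∞) : WithTop ℕ∞) φ ∧ HasCompactSupport φ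

/-! Non-negative matrix weights and the space `L²(w)` -/

/-- A non-negative `2 × 2` matrix `w` whose entries are real distributions of order `0`: on every
bounded Borel set the matrix of values is symmetric and positive semidefinite. -/
structure Weight where
  entry : Matrix (Fin 2) (Fin 2) OrderZero
  nonneg : ∀ E : Set ℝ, MeasurableSet E → Bornology.IsBounded E →
    (Matrix.of fun i j => (entry i j).value E).PosSemidef

/-- The positive scalar measure `tr w` (the diagonal entries of `w` are positive, so they equal
their positive parts). -/
def Weight.tr (w : Weight) : Measure ℝ := (w.entry 0 0).pos + (w.entry 1 1).pos

instance (w : Weight) : IsLocallyFiniteMeasure w.tr := by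
  refine ⟨fun x => ?_⟩
  obtain ⟨s, hs, hs'⟩ := (w.entry 0 0).pos.finiteAt_nhds x
  obtain ⟨t, ht, ht'⟩ := (w.entry 1 1).pos.finiteAt_nhds x
  refine ⟨s ∩ t, inter_mem hs ht, ?_⟩
  rw [Weight.tr, Measure.add_apply]
  exact ENNReal.add_lt_top.2 ⟨(measure_mono inter_subset_left).trans_lt hs',
    (measure_mono inter_subset_right).trans_lt ht'⟩

/-- The matrix `W̃` of Radon–Nikodym derivatives of the entries of `w` with respect to `tr w`. -/
def Weight.density (w : Weight) (x : ℝ) : Matrix (Fin 2) (Fin 2) ℝ :=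
  Matrix.of fun i j =>
    ((w.entry i j).pos.rnDeriv w.tr x).toReal - ((w.entry i j).neg.rnDeriv w.tr x).toReal

/-- The function `f* W̃ f`, the density of `f* w f` with respect to `tr w`. -/
def Weight.quad (w : Weight) (f : ℝ → Fin 2 → ℂ) (x : ℝ) : ℝ :=
  (∑ i, ∑ j, star (f x i) * (w.density x i j : ℂ) * f x j).re

/-- The squared norm `‖f‖² = ∫ f* w f`, with values in `[0, ∞]`. -/
def Weight.normSq (w : Weight) (f : ℝ → Fin 2 → ℂ) : ℝ≥0∞ :=
  ∫⁻ x, ENNReal.ofReal (w.quad f x) ∂w.tr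

/-- The distribution `w f`, i.e. `W̃ f` times `tr w`: its `i`-th component applied to `φ`. -/
def Weight.apply (w : Weight) (f : ℝ → Fin 2 → ℂ) (φ : ℝ → ℂ) (i : Fin 2) : ℂ :=
  ∫ x, φ x * ∑ j, (w.density x i j : ℂ) * f x j ∂w.tr

/-! Helper facts needed to see that the collections below are vector spaces -/

lemma Weight.value_of_tr_null (w : Weight) {E : Set ℝ} (hE : MeasurableSet E)
    (hb : Bornology.IsBounded E) (h0 : w.tr E = 0) (i j : Fin 2) : (w.entry i j).value E = 0 := by
  have hP := w.nonneg E hE hb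
  have h1 : (w.entry 0 0).pos E = 0 ∧ (w.entry 1 1).pos E = 0 := by
    simpa [Weight.tr] using h0
  have hdiag : ∀ k : Fin 2, (w.entry k k).value E ≤ 0 := by
    intro k
    fin_cases k
    · simp [OrderZero.value, Measure.real, h1.1]
    · simp [OrderZero.value, Measure.real, h1.2]
  have key : ∀ a b : ℝ, 0 ≤ a * a * (w.entry 0 0).value E + a * b * (w.entry 0 1).value E
      + b * a * (w.entry 1 0).value E + b * b * (w.entry 1 1).value E := by
    intro a b
    have := hP.dotProduct_mulVec_nonneg ![a, b]
    simp [dotProduct, Matrix.mulVec, Fin.sum_univ_two] at this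
    linarith
  have hsym : (w.entry 1 0).value E = (w.entry 0 1).value E := by
    have := hP.1.apply 0 1
    simpa using this
  have k1 := key 1 0
  have k2 := key 0 1
  have k3 := key 1 1
  have k4 := key 1 (-1)
  have d0 := hdiag 0
  have d1 := hdiag 1
  rw [hsym] at k1 k2 k3 k4
  fin_cases i <;> fin_cases j <;> simp <;> linarith

lemma Weight.absolutelyContinuous (w : Weight) (i j : Fin 2) :
    (w.entry i j).pos ≪ w.tr ∧ (w.entry i j).neg ≪ w.tr := by
  obtain ⟨S, hS, hpS, hnS⟩ := (w.entry i j).mutuallySingular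
  have hbd : ∀ n : ℕ, Bornology.IsBounded (Icc (-(n : ℝ)) n) := fun n => Metric.isBounded_Icc _ _
  have hcov : ∀ E : Set ℝ, E = ⋃ n : ℕ, E ∩ Icc (-(n : ℝ)) n := by
    intro E
    ext x
    simp only [mem_iUnion, mem_inter_iff, mem_Icc]
    refine ⟨fun hx => ?_, fun ⟨_, hx⟩ => hx.1⟩
    obtain ⟨n, hn⟩ := exists_nat_ge |x|
    exact ⟨n, hx, abs_le.1 hn⟩
  constructor
  · refine Measure.AbsolutelyContinuous.mk fun E hE h0 => ?_
    rw [hcov E]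
    refine measure_iUnion_null fun n => ?_
    set F := E ∩ Icc (-(n : ℝ)) n with hF
    have hFm : MeasurableSet F := hE.inter measurableSet_Icc
    have hFb : Bornology.IsBounded F := (hbd n).subset inter_subset_right
    have hF0 : w.tr F = 0 := measure_mono_null inter_subset_left h0
    have h := w.value_of_tr_null (hFm.inter hS.compl) (hFb.subset inter_subset_left)
      (measure_mono_null inter_subset_left hF0) i j
    have hn : (w.entry i j).neg (F ∩ Sᶜ) = 0 := measure_mono_null inter_subset_right hnS
    have hp : (w.entry i j).pos (F ∩ S) = 0 := measure_mono_null inter_subset_right hpS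
    have hfin : (w.entry i j).pos (F ∩ Sᶜ) ≠ ∞ :=
      ((hFb.subset inter_subset_left).measure_lt_top).ne
    simp only [OrderZero.value, Measure.real, hn, ENNReal.toReal_zero, sub_zero,
      ENNReal.toReal_eq_zero_iff, hfin, or_false] at h
    rw [← inter_union_compl F S]
    exact measure_union_null hp h
  · refine Measure.AbsolutelyContinuous.mk fun E hE h0 => ?_
    rw [hcov E]
    refine measure_iUnion_null fun n => ?_
    set F := E ∩ Icc (-(n : ℝ)) n with hF
    have hFm : MeasurableSet F := hE.inter measurableSet_Icc
    have hFb : Bornology.IsBounded F := (hbd n).subset inter_subset_right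
    have hF0 : w.tr F = 0 := measure_mono_null inter_subset_left h0
    have h := w.value_of_tr_null (hFm.inter hS) (hFb.subset inter_subset_left)
      (measure_mono_null inter_subset_left hF0) i j
    have hn : (w.entry i j).neg (F ∩ Sᶜ) = 0 := measure_mono_null inter_subset_right hnS
    have hp : (w.entry i j).pos (F ∩ S) = 0 := measure_mono_null inter_subset_right hpS
    have hfin : (w.entry i j).neg (F ∩ S) ≠ ∞ :=
      ((hFb.subset inter_subset_left).measure_lt_top).ne
    simp only [OrderZero.value, Measure.real, hp, ENNReal.toReal_zero, zero_sub, neg_eq_zero,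
      ENNReal.toReal_eq_zero_iff, hfin, or_false] at h
    rw [← inter_union_compl F S]
    exact measure_union_null h hn

lemma Weight.measurable_density (w : Weight) (i j : Fin 2) :
    Measurable fun x => w.density x i j := by
  simp only [Weight.density, Matrix.of_apply]
  exact (Measure.measurable_rnDeriv _ _).ennreal_toReal.sub
    (Measure.measurable_rnDeriv _ _).ennreal_toReal

lemma integrableOn_rnDeriv (μ ν : Measure ℝ) {E : Set ℝ} (hE : μ E ≠ ∞) :
    IntegrableOn (fun x => (μ.rnDeriv ν x).toReal) E ν :=
  integrable_toReal_of_lintegral_ne_top (Measure.measurable_rnDeriv _ _).aemeasurable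
    (Measure.lintegral_rnDeriv_lt_top_of_measure_ne_top ν hE).ne

lemma Weight.integrableOn_density (w : Weight) (i j : Fin 2) {E : Set ℝ}
    (hE : Bornology.IsBounded E) : IntegrableOn (fun x => w.density x i j) E w.tr := by
  simp only [Weight.density, Matrix.of_apply]
  exact (integrableOn_rnDeriv _ _ hE.measure_lt_top.ne).sub
    (integrableOn_rnDeriv _ _ hE.measure_lt_top.ne)

lemma Weight.setIntegral_density (w : Weight) (i j : Fin 2) {E : Set ℝ}
    (hE : Bornology.IsBounded E) :
    ∫ x in E, w.density x i j ∂w.tr = (w.entry i j).value E := by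
  simp only [Weight.density, Matrix.of_apply]
  rw [integral_sub (integrableOn_rnDeriv _ _ hE.measure_lt_top.ne)
    (integrableOn_rnDeriv _ _ hE.measure_lt_top.ne),
    Measure.setIntegral_toReal_rnDeriv (w.absolutelyContinuous i j).1,
    Measure.setIntegral_toReal_rnDeriv (w.absolutelyContinuous i j).2, OrderZero.value]

lemma Weight.density_ae_nonneg (w : Weight) (a : Fin 2 → ℝ) :
    ∀ᵐ x ∂w.tr, 0 ≤ ∑ i, ∑ j, a i * w.density x i j * a j := by
  have hint : ∀ E : Set ℝ, Bornology.IsBounded E → ∀ i j,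
      IntegrableOn (fun x => a i * w.density x i j * a j) E w.tr :=
    fun E hE i j => ((w.integrableOn_density i j hE).const_mul _).mul_const _
  have step : ∀ n : ℕ, ∀ᵐ x ∂w.tr.restrict (Icc (-(n : ℝ)) n),
      0 ≤ ∑ i, ∑ j, a i * w.density x i j * a j := by
    intro n
    have hb : Bornology.IsBounded (Icc (-(n : ℝ)) n) := Metric.isBounded_Icc _ _
    refine ae_nonneg_of_forall_setIntegral_nonneg
      (integrable_finsetSum _ fun i _ => integrable_finsetSum _ fun j _ => hint _ hb i j) ?_
    intro s hs _
    have hsb : Bornology.IsBounded (s ∩ Icc (-(n : ℝ)) n) := hb.subset inter_subset_right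
    rw [Measure.restrict_restrict hs,
      integral_finsetSum _ fun i _ => integrable_finsetSum _ fun j _ => hint _ hsb i j]
    have : ∀ i, ∫ x in s ∩ Icc (-(n : ℝ)) n, ∑ j, a i * w.density x i j * a j ∂w.tr
        = ∑ j, a i * (w.entry i j).value (s ∩ Icc (-(n : ℝ)) n) * a j := by
      intro i
      rw [integral_finsetSum _ fun j _ => hint _ hsb i j]
      refine Finset.sum_congr rfl fun j _ => ?_
      rw [integral_mul_const, integral_const_mul, w.setIntegral_density i j hsb]
    simp only [this]
    have hP := (w.nonneg _ (hs.inter measurableSet_Icc) hsb).dotProduct_mulVec_nonneg a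
    simp [dotProduct, Matrix.mulVec, Fin.sum_univ_two] at hP ⊢
    linarith
  have hcov : (⋃ n : ℕ, Icc (-(n : ℝ)) n) = univ := by
    refine eq_univ_of_forall fun x => ?_
    obtain ⟨n, hn⟩ := exists_nat_ge |x|
    exact mem_iUnion.2 ⟨n, abs_le.1 hn⟩
  rw [← Measure.restrict_univ (μ := w.tr), ← hcov, ae_restrict_iUnion_iff]
  exact step

lemma Weight.density_ae_posSemidef (w : Weight) :
    ∀ᵐ x ∂w.tr, ∀ a : Fin 2 → ℝ, 0 ≤ ∑ i, ∑ j, a i * w.density x i j * a j := by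
  have h : ∀ᵐ x ∂w.tr, ∀ p : Fin 2 → ℚ,
      0 ≤ ∑ i, ∑ j, (p i : ℝ) * w.density x i j * (p j : ℝ) :=
    ae_all_iff.2 fun p => w.density_ae_nonneg fun i => (p i : ℝ)
  filter_upwards [h] with x hx a
  have hd : DenseRange (fun p : Fin 2 → ℚ => fun i => (p i : ℝ)) :=
    DenseRange.piMap fun _ => Rat.denseRange_cast
  have hc : IsClosed {a : Fin 2 → ℝ | 0 ≤ ∑ i, ∑ j, a i * w.density x i j * a j} :=
    isClosed_le continuous_const (by fun_prop)
  exact hd.induction_on a hc hx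

lemma Weight.quad_ae_nonneg (w : Weight) :
    ∀ᵐ x ∂w.tr, ∀ f : ℝ → Fin 2 → ℂ, 0 ≤ w.quad f x := by
  filter_upwards [w.density_ae_posSemidef] with x hx f
  have h1 := hx fun i => (f x i).re
  have h2 := hx fun i => (f x i).im
  simp [Weight.quad, Fin.sum_univ_two] at h1 h2 ⊢
  linarith

lemma Weight.quad_add_add_quad_sub (w : Weight) (f g : ℝ → Fin 2 → ℂ) (x : ℝ) :
    w.quad (f + g) x + w.quad (f - g) x = 2 * w.quad f x + 2 * w.quad g x := by
  simp [Weight.quad, Fin.sum_univ_two]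
  ring

lemma Weight.quad_smul (w : Weight) (c : ℂ) (f : ℝ → Fin 2 → ℂ) (x : ℝ) :
    w.quad (c • f) x = Complex.normSq c * w.quad f x := by
  simp [Weight.quad, Fin.sum_univ_two, Complex.normSq_apply]
  ring

lemma Weight.aemeasurable_quad (w : Weight) {f : ℝ → Fin 2 → ℂ}
    (hf : AEStronglyMeasurable f w.tr) : AEMeasurable (w.quad f) w.tr := by
  have hfi : ∀ i, AEMeasurable (fun x => f x i) w.tr := fun i =>
    (measurable_pi_apply i).comp_aemeasurable hf.aemeasurable
  have hd : ∀ i j, Measurable fun x => (w.density x i j : ℂ) := fun i j =>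
    Complex.measurable_ofReal.comp (w.measurable_density i j)
  unfold Weight.quad
  refine Complex.measurable_re.comp_aemeasurable ?_
  refine Finset.aemeasurable_fun_sum _ fun i _ => Finset.aemeasurable_fun_sum _ fun j _ => ?_
  exact ((continuous_star.measurable.comp_aemeasurable (hfi i)).mul
    (hd i j).aemeasurable).mul (hfi j)

lemma Weight.normSq_zero (w : Weight) : w.normSq 0 = 0 := by
  simp [Weight.normSq, Weight.quad]

lemma Weight.normSq_smul (w : Weight) (c : ℂ) (f : ℝ → Fin 2 → ℂ) :
    w.normSq (c • f) = ENNReal.ofReal (Complex.normSq c) * w.normSq f := by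
  simp only [Weight.normSq, w.quad_smul]
  rw [← lintegral_const_mul' _ _ ENNReal.ofReal_ne_top]
  refine lintegral_congr fun x => ?_
  rw [ENNReal.ofReal_mul (Complex.normSq_nonneg c)]

lemma Weight.normSq_add_le (w : Weight) {f g : ℝ → Fin 2 → ℂ}
    (hf : AEStronglyMeasurable f w.tr) :
    w.normSq (f + g) ≤ 2 * w.normSq f + 2 * w.normSq g := by
  simp only [Weight.normSq]
  rw [← lintegral_const_mul' _ _ ENNReal.ofNat_ne_top,
    ← lintegral_const_mul' _ _ ENNReal.ofNat_ne_top,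
    ← lintegral_add_left' ((w.aemeasurable_quad hf).ennreal_ofReal.const_mul 2)]
  refine lintegral_mono_ae ?_
  filter_upwards [w.quad_ae_nonneg] with x hx
  have h := w.quad_add_add_quad_sub f g x
  have h1 := hx f
  have h2 := hx g
  have h3 := hx (f - g)
  calc ENNReal.ofReal (w.quad (f + g) x)
      ≤ ENNReal.ofReal (2 * w.quad f x + 2 * w.quad g x) :=
        ENNReal.ofReal_le_ofReal (by linarith)
    _ = 2 * ENNReal.ofReal (w.quad f x) + 2 * ENNReal.ofReal (w.quad g x) := by
        rw [ENNReal.ofReal_add (by linarith) (by linarith), ENNReal.ofReal_mul (by norm_num),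
          ENNReal.ofReal_mul (by norm_num), ENNReal.ofReal_ofNat]

/-- The space `𝓛²(w)` of functions with values in `ℂ²` whose components are measurable with respect
to `tr w` and which satisfy `∫ f* w f < ∞`. -/
def scriptL2 (w : Weight) : Submodule ℂ (ℝ → Fin 2 → ℂ) where
  carrier := {f | AEStronglyMeasurable f w.tr ∧ w.normSq f < ∞}
  zero_mem' := ⟨aestronglyMeasurable_zero, by rw [w.normSq_zero]; exact ENNReal.zero_lt_top⟩
  add_mem' := fun {f g} hf hg => ⟨hf.1.add hg.1, (w.normSq_add_le hf.1).trans_lt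
    (ENNReal.add_lt_top.2 ⟨ENNReal.mul_lt_top ENNReal.ofNat_lt_top hf.2,
      ENNReal.mul_lt_top ENNReal.ofNat_lt_top hg.2⟩)⟩
  smul_mem' := fun c f hf => ⟨hf.1.const_smul c, by
    rw [w.normSq_smul]
    exact ENNReal.mul_lt_top ENNReal.ofReal_lt_top hf.2⟩

/-- The kernel of the seminorm of `𝓛²(w)`. -/
def nullL2 (w : Weight) : Submodule ℂ (scriptL2 w) where
  carrier := {f | w.normSq f = 0}
  zero_mem' := w.normSq_zero
  add_mem' := fun {f g} hf hg => by
    have hf' : w.normSq f = 0 := hf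
    have hg' : w.normSq g = 0 := hg
    have h := w.normSq_add_le (g := (g : ℝ → Fin 2 → ℂ)) f.2.1
    rw [hf', hg', mul_zero, add_zero] at h
    exact nonpos_iff_eq_zero.1 h
  smul_mem' := fun c f hf => by
    have hf' : w.normSq f = 0 := hf
    change w.normSq (c • (f : ℝ → Fin 2 → ℂ)) = 0
    rw [w.normSq_smul, hf', mul_zero]

/-- The space `L²(w)`: the quotient of `𝓛²(w)` by the kernel of its seminorm. -/
abbrev L2 (w : Weight) : Type := scriptL2 w ⧸ nullL2 w

/-! Balanced functions of locally bounded variation and the differential equation -/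

/-- `u` is a balanced function of locally bounded variation: its value at each point is the mean
of its one-sided limits there. -/
def IsBalancedBV (u : ℝ → Fin 2 → ℂ) : Prop :=
  LocallyBoundedVariationOn u univ ∧
    ∀ x, ∃ l r : Fin 2 → ℂ, Tendsto u (𝓝[<] x) (𝓝 l) ∧ Tendsto u (𝓝[>] x) (𝓝 r) ∧
      u x = (1 / 2 : ℂ) • (l + r)

/-- The `i`-th component of the distribution `J u' + q u` applied to the test function `φ`. -/
def lhs (J : Matrix (Fin 2) (Fin 2) ℝ) (q : Matrix (Fin 2) (Fin 2) OrderZero)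
    (u : ℝ → Fin 2 → ℂ) (φ : ℝ → ℂ) (i : Fin 2) : ℂ :=
  ∑ j, ((J i j : ℂ) * -(∫ x, u x j * deriv φ x) + (q i j).integral fun x => φ x * u x j)

/-- `J u' + q u = w f` in the sense of distributions. -/
def Solves (J : Matrix (Fin 2) (Fin 2) ℝ) (q : Matrix (Fin 2) (Fin 2) OrderZero) (w : Weight)
    (u f : ℝ → Fin 2 → ℂ) : Prop :=
  ∀ φ, IsTest φ → ∀ i, lhs J q u φ i = w.apply f φ i

/-- The linear relation `T_max` in `L²(w) × L²(w)`. -/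
def Tmax (J : Matrix (Fin 2) (Fin 2) ℝ) (q : Matrix (Fin 2) (Fin 2) OrderZero) (w : Weight) :
    Set (L2 w × L2 w) :=
  {p | ∃ u f : scriptL2 w, IsBalancedBV u ∧ Solves J q w u f ∧
    p = (Submodule.Quotient.mk u, Submodule.Quotient.mk f)}

lemma IsBalancedBV.zero : IsBalancedBV 0 := by
  refine ⟨fun a b _ _ => ?_, fun x => ⟨0, 0, tendsto_const_nhds, tendsto_const_nhds, by simp⟩⟩
  have : eVariationOn (0 : ℝ → Fin 2 → ℂ) (univ ∩ Icc a b) = 0 :=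
    eVariationOn.constant_on (by
      rintro _ ⟨x, _, rfl⟩ _ ⟨y, _, rfl⟩
      rfl)
  rw [BoundedVariationOn, this]
  exact ENNReal.zero_ne_top

lemma IsBalancedBV.add {u v : ℝ → Fin 2 → ℂ} (hu : IsBalancedBV u) (hv : IsBalancedBV v) :
    IsBalancedBV (u + v) := by
  refine ⟨fun a b ha hb => ?_, fun x => ?_⟩
  · have h : eVariationOn (u + v) (univ ∩ Icc a b)
        ≤ eVariationOn u (univ ∩ Icc a b) + eVariationOn v (univ ∩ Icc a b) := by
      refine iSup_le fun p => ?_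
      calc ∑ i ∈ Finset.range p.1, edist ((u + v) (p.2.1 (i + 1))) ((u + v) (p.2.1 i))
          ≤ ∑ i ∈ Finset.range p.1, (edist (u (p.2.1 (i + 1))) (u (p.2.1 i))
              + edist (v (p.2.1 (i + 1))) (v (p.2.1 i))) :=
            Finset.sum_le_sum fun i _ => edist_add_add_le _ _ _ _
        _ ≤ _ := by
            rw [Finset.sum_add_distrib]
            exact add_le_add (eVariationOn.sum_le p.2.2.1 p.2.2.2)
              (eVariationOn.sum_le p.2.2.1 p.2.2.2)
    exact ne_top_of_le_ne_top (ENNReal.add_ne_top.2 ⟨hu.1 a b ha hb, hv.1 a b ha hb⟩) h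
  · obtain ⟨l, r, hl, hr, he⟩ := hu.2 x
    obtain ⟨l', r', hl', hr', he'⟩ := hv.2 x
    refine ⟨l + l', r + r', hl.add hl', hr.add hr', ?_⟩
    rw [Pi.add_apply, he, he']
    module

lemma IsBalancedBV.smul {u : ℝ → Fin 2 → ℂ} (c : ℂ) (hu : IsBalancedBV u) :
    IsBalancedBV (c • u) := by
  refine ⟨(lipschitzWith_smul c).comp_locallyBoundedVariationOn hu.1, fun x => ?_⟩
  obtain ⟨l, r, hl, hr, he⟩ := hu.2 x
  refine ⟨c • l, c • r, hl.const_smul c, hr.const_smul c, ?_⟩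
  rw [Pi.smul_apply, he]
  module

lemma IsBalancedBV.measurable {u : ℝ → Fin 2 → ℂ} (hu : IsBalancedBV u) : Measurable u := by
  have aux : ∀ g : ℝ → ℝ, LocallyBoundedVariationOn g univ → Measurable g := by
    intro g hg
    obtain ⟨p, q, hp, hq, rfl⟩ := hg.exists_monotoneOn_sub_monotoneOn
    exact (monotoneOn_univ.1 hp).measurable.sub (monotoneOn_univ.1 hq).measurable
  refine measurable_pi_iff.2 fun i => ?_
  have hi : LocallyBoundedVariationOn (fun x => u x i) univ :=
    (LipschitzWith.eval i).comp_locallyBoundedVariationOn hu.1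
  have hre : Measurable fun x => (u x i).re :=
    aux _ (Complex.reCLM.lipschitz.comp_locallyBoundedVariationOn hi)
  have him : Measurable fun x => (u x i).im :=
    aux _ (Complex.imCLM.lipschitz.comp_locallyBoundedVariationOn hi)
  have := Complex.measurable_ofReal.comp hre |>.add
    ((Complex.measurable_ofReal.comp him).mul_const Complex.I)
  convert this using 2 with x
  simp

lemma IsBalancedBV.exists_bound {u : ℝ → Fin 2 → ℂ} (hu : IsBalancedBV u) {K : Set ℝ}
    (hK : IsCompact K) : ∃ C : ℝ, ∀ x ∈ K, ∀ i, ‖u x i‖ ≤ C := by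
  obtain ⟨R, hR⟩ := hK.isBounded.subset_closedBall 0
  have hb : BoundedVariationOn u (univ ∩ Icc (-|R|) |R|) := hu.1 _ _ (mem_univ _) (mem_univ _)
  refine ⟨(eVariationOn u (univ ∩ Icc (-|R|) |R|)).toReal + ‖u 0‖, fun x hx i => ?_⟩
  have hx' : |x| ≤ R := by simpa using hR hx
  have hxR : x ∈ univ ∩ Icc (-|R|) |R| := ⟨mem_univ _, abs_le.1 (hx'.trans (le_abs_self R))⟩
  have h0 : (0 : ℝ) ∈ univ ∩ Icc (-|R|) |R| := ⟨mem_univ _, by simp, by simp⟩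
  have h1 := hb.dist_le hxR h0
  rw [dist_eq_norm] at h1
  calc ‖u x i‖ ≤ ‖u x‖ := norm_le_pi_norm _ _
    _ = ‖(u x - u 0) + u 0‖ := by simp
    _ ≤ _ := (norm_add_le _ _).trans (by gcongr)

/-- Compactly supported continuous function, times a component of `u`, times a function that is
integrable on compact sets. -/
lemma IsBalancedBV.integrable_mul {u : ℝ → Fin 2 → ℂ} (hu : IsBalancedBV u) (j : Fin 2)
    {φ : ℝ → ℂ} (hφ : Continuous φ) (hc : HasCompactSupport φ) {μ : Measure ℝ} {h : ℝ → ℂ}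
    (hh : LocallyIntegrable h μ) : Integrable (fun x => φ x * (h x * u x j)) μ := by
  obtain ⟨C, hC⟩ := hu.exists_bound hc.isCompact
  have h1 : Integrable (fun x => φ x * h x) μ :=
    hh.integrable_smul_left_of_hasCompactSupport hφ hc
  have hK : MeasurableSet (tsupport φ) := (isClosed_tsupport φ).measurableSet
  have hm : Measurable fun x => u x j := (measurable_pi_apply j).comp hu.measurable
  have h2 : Integrable (fun x => (tsupport φ).indicator (fun y => u y j) x * (φ x * h x)) μ := by
    refine h1.bdd_mul (c := max C 0) (hm.indicator hK).aestronglyMeasurable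
      (Eventually.of_forall fun x => ?_)
    by_cases hx : x ∈ tsupport φ
    · rw [indicator_of_mem hx]
      exact (hC x hx j).trans (le_max_left _ _)
    · rw [indicator_of_notMem hx, norm_zero]
      exact le_max_right _ _
  refine h2.congr (Eventually.of_forall fun x => ?_)
  by_cases hx : x ∈ tsupport φ
  · simp only [indicator_of_mem hx]
    ring
  · simp [image_eq_zero_of_notMem_tsupport hx]

lemma IsBalancedBV.integrable_mul' {u : ℝ → Fin 2 → ℂ} (hu : IsBalancedBV u) (j : Fin 2)
    {φ : ℝ → ℂ} (hφ : Continuous φ) (hc : HasCompactSupport φ) (μ : Measure ℝ)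
    [IsLocallyFiniteMeasure μ] : Integrable (fun x => φ x * u x j) μ := by
  simpa using hu.integrable_mul j hφ hc (μ := μ) (h := fun _ => 1) (locallyIntegrable_const 1)

lemma IsBalancedBV.integrable_deriv {u : ℝ → Fin 2 → ℂ} (hu : IsBalancedBV u) (j : Fin 2)
    {φ : ℝ → ℂ} (hφ : IsTest φ) : Integrable (fun x => u x j * deriv φ x) := by
  have := hu.integrable_mul' j (φ := deriv φ) (hφ.1.continuous_deriv (by simp))
    hφ.2.deriv volume
  exact this.congr (Eventually.of_forall fun x => mul_comm _ _)

lemma Weight.locallyIntegrable_density (w : Weight) (i j : Fin 2) :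
    LocallyIntegrable (fun x => (w.density x i j : ℂ)) w.tr := by
  refine (locallyIntegrable_iff).2 fun K hK => ?_
  exact (w.integrableOn_density i j hK.isBounded).ofReal

lemma lhs_add (J : Matrix (Fin 2) (Fin 2) ℝ) (q : Matrix (Fin 2) (Fin 2) OrderZero)
    {u v : ℝ → Fin 2 → ℂ} (hu : IsBalancedBV u) (hv : IsBalancedBV v) {φ : ℝ → ℂ}
    (hφ : IsTest φ) (i : Fin 2) : lhs J q (u + v) φ i = lhs J q u φ i + lhs J q v φ i := by
  simp only [lhs, ← Finset.sum_add_distrib, OrderZero.integral]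
  refine Finset.sum_congr rfl fun j _ => ?_
  simp only [Pi.add_apply, mul_add, add_mul]
  rw [integral_add (hu.integrable_deriv j hφ) (hv.integrable_deriv j hφ),
    integral_add (hu.integrable_mul' j hφ.1.continuous hφ.2 _)
      (hv.integrable_mul' j hφ.1.continuous hφ.2 _),
    integral_add (hu.integrable_mul' j hφ.1.continuous hφ.2 _)
      (hv.integrable_mul' j hφ.1.continuous hφ.2 _)]
  ring

lemma lhs_smul (J : Matrix (Fin 2) (Fin 2) ℝ) (q : Matrix (Fin 2) (Fin 2) OrderZero)
    (c : ℂ) (u : ℝ → Fin 2 → ℂ) (φ : ℝ → ℂ) (i : Fin 2) :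
    lhs J q (c • u) φ i = c * lhs J q u φ i := by
  simp only [lhs, Finset.mul_sum, OrderZero.integral]
  refine Finset.sum_congr rfl fun j _ => ?_
  simp only [Pi.smul_apply, smul_eq_mul, mul_assoc, mul_left_comm _ c, integral_const_mul]
  ring

lemma Weight.apply_add (w : Weight) {u v : ℝ → Fin 2 → ℂ} (hu : IsBalancedBV u)
    (hv : IsBalancedBV v) {φ : ℝ → ℂ} (hφ : IsTest φ) (i : Fin 2) :
    w.apply (u + v) φ i = w.apply u φ i + w.apply v φ i := by
  have hint : ∀ z : ℝ → Fin 2 → ℂ, IsBalancedBV z →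
      Integrable (fun x => φ x * ∑ j, (w.density x i j : ℂ) * z x j) w.tr := by
    intro z hz
    simp only [Finset.mul_sum]
    exact integrable_finsetSum _ fun j _ =>
      hz.integrable_mul j hφ.1.continuous hφ.2 (w.locallyIntegrable_density i j)
  simp only [Weight.apply]
  rw [← integral_add (hint u hu) (hint v hv)]
  refine integral_congr_ae (Eventually.of_forall fun x => ?_)
  simp only [Pi.add_apply, mul_add, Finset.sum_add_distrib]

lemma Weight.apply_smul (w : Weight) (c : ℂ) (u : ℝ → Fin 2 → ℂ) (φ : ℝ → ℂ) (i : Fin 2) :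
    w.apply (c • u) φ i = c * w.apply u φ i := by
  simp only [Weight.apply, Pi.smul_apply, smul_eq_mul, mul_left_comm _ c, ← Finset.mul_sum,
    integral_const_mul]

lemma lhs_zero (J : Matrix (Fin 2) (Fin 2) ℝ) (q : Matrix (Fin 2) (Fin 2) OrderZero)
    (φ : ℝ → ℂ) (i : Fin 2) : lhs J q 0 φ i = 0 := by
  simp [lhs, OrderZero.integral]

lemma Weight.apply_zero (w : Weight) (φ : ℝ → ℂ) (i : Fin 2) : w.apply 0 φ i = 0 := by
  simp [Weight.apply]

/-- The space of balanced solutions, of locally bounded variation, of `J u' + q u = lam w u`. -/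
def solutions (J : Matrix (Fin 2) (Fin 2) ℝ) (q : Matrix (Fin 2) (Fin 2) OrderZero) (w : Weight)
    (lam : ℂ) : Submodule ℂ (ℝ → Fin 2 → ℂ) where
  carrier := {u | IsBalancedBV u ∧ Solves J q w u (lam • u)}
  zero_mem' := ⟨IsBalancedBV.zero, fun φ _ i => by
    rw [smul_zero, lhs_zero, w.apply_zero]⟩
  add_mem' := fun {u v} hu hv => ⟨hu.1.add hv.1, fun φ hφ i => by
    rw [smul_add, lhs_add J q hu.1 hv.1 hφ, w.apply_add (hu.1.smul lam) (hv.1.smul lam) hφ,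
      hu.2 φ hφ, hv.2 φ hφ]⟩
  smul_mem' := fun c u hu => ⟨hu.1.smul c, fun φ hφ i => by
    rw [smul_comm, lhs_smul, w.apply_smul, hu.2 φ hφ]⟩

/-- The space `𝓛₀` of all `u` such that `J u' + q u = 0` and `w u = 0`. -/
def L0 (J : Matrix (Fin 2) (Fin 2) ℝ) (q : Matrix (Fin 2) (Fin 2) OrderZero) (w : Weight) :
    Submodule ℂ (ℝ → Fin 2 → ℂ) where
  carrier := {u | IsBalancedBV u ∧ (∀ φ, IsTest φ → ∀ i, lhs J q u φ i = 0) ∧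
    ∀ φ, IsTest φ → ∀ i, w.apply u φ i = 0}
  zero_mem' := ⟨IsBalancedBV.zero, fun φ _ i => lhs_zero J q φ i, fun φ _ i => w.apply_zero φ i⟩
  add_mem' := fun {u v} hu hv => ⟨hu.1.add hv.1,
    fun φ hφ i => by rw [lhs_add J q hu.1 hv.1 hφ, hu.2.1 φ hφ, hv.2.1 φ hφ, add_zero],
    fun φ hφ i => by rw [w.apply_add hu.1 hv.1 hφ, hu.2.2 φ hφ, hv.2.2 φ hφ, add_zero]⟩
  smul_mem' := fun c u hu => ⟨hu.1.smul c,
    fun φ hφ i => by rw [lhs_smul, hu.2.1 φ hφ, mul_zero],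
    fun φ hφ i => by rw [w.apply_smul, hu.2.2 φ hφ, mul_zero]⟩

/-! The exceptional set, monodromy matrices and the Floquet discriminant -/

/-- The matrix `J + (s / 2) (Δ_q(x) - lam Δ_w(x))`; `s = 1` and `s = -1` give `B₊` and `B₋`. -/
def B (J : Matrix (Fin 2) (Fin 2) ℝ) (q : Matrix (Fin 2) (Fin 2) OrderZero) (w : Weight)
    (s : ℂ) (x : ℝ) (lam : ℂ) : Matrix (Fin 2) (Fin 2) ℂ :=
  J.map (fun t : ℝ => (t : ℂ)) + (s / 2) • ((jump q x).map (fun t : ℝ => (t : ℂ))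
    - lam • (jump w.entry x).map (fun t : ℝ => (t : ℂ)))

/-- The exceptional set `Λ` of those `lam` for which `B₊(x, lam)` or `B₋(x, lam)` fails to be
invertible for some `x`. -/
def exceptionalSet (J : Matrix (Fin 2) (Fin 2) ℝ) (q : Matrix (Fin 2) (Fin 2) OrderZero)
    (w : Weight) : Set ℂ :=
  {lam | ∃ x : ℝ, ¬ IsUnit (B J q w 1 x lam) ∨ ¬ IsUnit (B J q w (-1) x lam)}

/-- The fundamental matrix of solutions with columns given by a basis of the solution space. -/
def fundamentalMatrix {J : Matrix (Fin 2) (Fin 2) ℝ} {q : Matrix (Fin 2) (Fin 2) OrderZero}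
    {w : Weight} {lam : ℂ} (b : Module.Basis (Fin 2) ℂ (solutions J q w lam)) (x : ℝ) :
    Matrix (Fin 2) (Fin 2) ℂ :=
  Matrix.of fun i k => (b k : ℝ → Fin 2 → ℂ) x i

/-- `M` is a monodromy matrix of `J u' + q u = lam w u`: `U(x + ω) = U(x) M` for some fundamental
matrix `U` of solutions. -/
def IsMonodromyMatrix (J : Matrix (Fin 2) (Fin 2) ℝ) (q : Matrix (Fin 2) (Fin 2) OrderZero)
    (w : Weight) (ω : ℝ) (lam : ℂ) (M : Matrix (Fin 2) (Fin 2) ℂ) : Prop :=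
  ∃ b : Module.Basis (Fin 2) ℂ (solutions J q w lam),
    ∀ x, fundamentalMatrix b (x + ω) = fundamentalMatrix b x * M

open scoped Classical in
/-- The Floquet discriminant `D(lam) = tr M(lam)`, where `M(lam)` is a monodromy matrix. It is
meaningful for `lam` outside the exceptional set, where monodromy matrices exist and are similar
to each other. -/
def discriminant (J : Matrix (Fin 2) (Fin 2) ℝ) (q : Matrix (Fin 2) (Fin 2) OrderZero)
    (w : Weight) (ω : ℝ) (lam : ℂ) : ℂ :=
  if h : ∃ M, IsMonodromyMatrix J q w ω lam M then h.choose.trace else 0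

end Floquet

end

open Floquet

set_option linter.unusedSectionVars false

noncomputable section

namespace Floquet

open Function (leftLim)

/-! Balanced primitives of locally integrable functions -/

section Primitive

variable {E : Type*} [NormedAddCommGroup E] [NormedSpace ℝ E]

/-! The proof turns on `L0`, the space of homogeneous solutions that the weight does not see.
Constancy of the discriminant and degeneracy of `Tmax` are both equivalent to `L0 ≠ ⊥`.

Suppose `L0 ≠ ⊥`. Translation by the period acts on this finite-dimensional space, so some nonzero
`v` in it has a multiplier `ρ` (`exists_multiplier`). Such a `v` solves the equation for every
spectral parameter, and the monodromy has determinant one. Hence the discriminant is always `ρ +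
1/ρ` (`discriminant_const_of_L0`). If `L0` is a line, conjugation preserves it, so `ρ` is real and
`|ρ + 1/ρ| ≥ 2` (`discriminant_ne_of_finrank_L0`). Because `w v = 0`, the Wronskian of `v` with any
solution of `J u' + q u = w f` is constant. If it vanishes, then `w u = 0`; at atoms this uses that
`B₊` is invertible for all real parameters (`HasSource.wMat_mulVec_eq_zero`). So modulo functions
killed by `w`, a solution `u` is homogeneous, and its translate is `ρ⁻¹ u`. The density of its norm
is then multiplied by a constant under translation, which is incompatible with a finite nonzero
total. This gives `Tmax_eq_of_L0`.

Suppose `L0 = ⊥`. A homogeneous solution killed by `w` on two periods is zero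
(`eq_zero_of_wMat_mulVec_eq_zero`). It is therefore impossible that for every homogeneous `y` some
`u` has source `w ȳ` on two periods and vanishes at both ends: Lagrange's identity would give zero
norm of `ȳ` there, hence `y = 0` (`false_of_forall_exists_compactly_supported`). Yet either side of
the equivalence supplies such `u`. If `Tmax` is degenerate, take `f` to be `ȳ` cut off to two
periods. The corresponding `u` is killed by `w`, and it is homogeneous outside the two periods,
hence zero at their ends (`L0_ne_bot_of_Tmax`). If the discriminant is constant, take a unimodular
`z` that is not a two-period multiplier. The problem `u(2ω) = z u(0)` is self-adjoint and has no
real eigenvalue at all, since the condition on `z` does not involve the parameter. Its solution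
operator, sandwiched between square roots of the weight, is compact and symmetric without nonzero
eigenvalues, hence zero (`exists_annihilated_solution`). So the solution with source `w ȳ` is killed
by `w`. Comparing two values of `z` shows that it vanishes at both ends
(`L0_ne_bot_of_discriminant_const`).

The analysis behind this replaces all measures by densities with respect to `baseMeasure`, so that
solutions become balanced primitives (`solves_iff`). Initial value problems reduce to a Volterra
equation (`exists_volterra`), and Lagrange's identity is the product rule for balanced functions
(`IsBalancedPrimitive.mul_sub`). -/

/-- The left-hand limit of a balanced primitive `u` of `F ν`. -/
def leftValue (ν : Measure ℝ) (F u : ℝ → E) (x : ℝ) : E :=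
  u x - (ν.real {x} / 2) • F x

/-- `u` is a balanced function whose distributional derivative is the measure `F ν`. -/
def IsBalancedPrimitive (ν : Measure ℝ) (F u : ℝ → E) : Prop :=
  LocallyIntegrable F ν ∧ ∀ x y, x ≤ y →
    leftValue ν F u y - leftValue ν F u x = ∫ t in Ico x y, F t ∂ν

variable {ν : Measure ℝ} {F G u v : ℝ → E}

lemma locallyIntegrable_norm (hF : LocallyIntegrable F ν) :
    LocallyIntegrable (fun t => ‖F t‖) ν :=
  locallyIntegrable_iff.2 fun _ hK => (hF.integrableOn_isCompact hK).norm

lemma integrableOn_of_isBounded (hF : LocallyIntegrable F ν) {s : Set ℝ}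
    (hs : Bornology.IsBounded s) : IntegrableOn F s ν := by
  obtain ⟨R, hR⟩ := hs.subset_closedBall 0
  exact (hF.integrableOn_isCompact (isCompact_closedBall 0 R)).mono_set hR

lemma integrableOn_Ico (hF : LocallyIntegrable F ν) (x y : ℝ) : IntegrableOn F (Ico x y) ν :=
  integrableOn_of_isBounded hF (Metric.isBounded_Ico x y)

lemma setIntegral_Ico_add (hF : LocallyIntegrable F ν) {x y z : ℝ} (hxy : x ≤ y) (hyz : y ≤ z) :
    ∫ t in Ico x z, F t ∂ν = (∫ t in Ico x y, F t ∂ν) + ∫ t in Ico y z, F t ∂ν := by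
  rw [← Ico_union_Ico_eq_Ico hxy hyz]
  refine setIntegral_union ?_ measurableSet_Ico (integrableOn_Ico hF _ _) (integrableOn_Ico hF _ _)
  exact Set.disjoint_left.2 fun t h1 h2 => absurd h1.2 (not_lt.2 h2.1)

lemma setIntegral_singleton' [CompleteSpace E] (x : ℝ) :
    ∫ t in ({x} : Set ℝ), F t ∂ν = ν.real {x} • F x := by
  rw [Measure.restrict_singleton, integral_smul_measure, integral_dirac, Measure.real]

lemma setIntegral_Ico_eq_singleton_add [CompleteSpace E] (hF : LocallyIntegrable F ν) {x y : ℝ}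
    (hxy : x < y) :
    ∫ t in Ico x y, F t ∂ν = ν.real {x} • F x + ∫ t in Ioo x y, F t ∂ν := by
  rw [← setIntegral_singleton', ← Ioo_insert_left hxy, Set.insert_eq]
  refine setIntegral_union (by simp) measurableSet_Ioo
    (integrableOn_of_isBounded hF Bornology.isBounded_singleton)
    (integrableOn_of_isBounded hF (Metric.isBounded_Ioo x y))

lemma setIntegral_Ioc_eq_singleton_add [CompleteSpace E] (hF : LocallyIntegrable F ν) {x y : ℝ}
    (hxy : x < y) :
    ∫ t in Ioc x y, F t ∂ν = ν.real {y} • F y + ∫ t in Ioo x y, F t ∂ν := by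
  rw [← setIntegral_singleton', ← Ioo_insert_right hxy, Set.insert_eq]
  refine setIntegral_union (by simp) measurableSet_Ioo
    (integrableOn_of_isBounded hF Bornology.isBounded_singleton)
    (integrableOn_of_isBounded hF (Metric.isBounded_Ioo x y))

/-- A point at which the two functions differ is a null set, and there both sides vanish. -/
lemma smul_eq_of_ae_eq (h : F =ᵐ[ν] G) (x : ℝ) : ν.real {x} • F x = ν.real {x} • G x := by
  by_cases h0 : ν {x} = 0
  · simp [Measure.real, h0]
  · congr 1
    by_contra hne
    exact h0 (measure_mono_null (singleton_subset_iff.2 hne) h)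

lemma leftValue_congr (h : F =ᵐ[ν] G) (u : ℝ → E) (x : ℝ) :
    leftValue ν F u x = leftValue ν G u x := by
  have := smul_eq_of_ae_eq h x
  simp only [leftValue, div_eq_inv_mul, mul_smul, this]

lemma IsBalancedPrimitive.congr (hu : IsBalancedPrimitive ν F u) (h : F =ᵐ[ν] G) :
    IsBalancedPrimitive ν G u := by
  refine ⟨hu.1.congr h, fun x y hxy => ?_⟩
  rw [← leftValue_congr h, ← leftValue_congr h, hu.2 x y hxy]
  exact integral_congr_ae (ae_restrict_of_ae h)

lemma leftValue_add (x : ℝ) :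
    leftValue ν (F + G) (u + v) x = leftValue ν F u x + leftValue ν G v x := by
  simp only [leftValue, Pi.add_apply, smul_add]
  abel

lemma leftValue_smul {𝕜 : Type*} [NormedField 𝕜] [NormedSpace 𝕜 E] [SMulCommClass ℝ 𝕜 E]
    (c : 𝕜) (x : ℝ) : leftValue ν (c • F) (c • u) x = c • leftValue ν F u x := by
  simp only [leftValue, Pi.smul_apply, smul_sub]
  rw [smul_comm]

lemma IsBalancedPrimitive.add (hu : IsBalancedPrimitive ν F u) (hv : IsBalancedPrimitive ν G v) :
    IsBalancedPrimitive ν (F + G) (u + v) := by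
  refine ⟨hu.1.add hv.1, fun x y hxy => ?_⟩
  rw [leftValue_add, leftValue_add, add_sub_add_comm, hu.2 x y hxy, hv.2 x y hxy]
  exact (integral_add (integrableOn_Ico hu.1 _ _) (integrableOn_Ico hv.1 _ _)).symm

lemma IsBalancedPrimitive.smul {𝕜 : Type*} [NontriviallyNormedField 𝕜] [NormedSpace 𝕜 E]
    [SMulCommClass ℝ 𝕜 E] (c : 𝕜) (hu : IsBalancedPrimitive ν F u) :
    IsBalancedPrimitive ν (c • F) (c • u) := by
  refine ⟨hu.1.smul c, fun x y hxy => ?_⟩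
  rw [leftValue_smul, leftValue_smul, ← smul_sub, hu.2 x y hxy]
  exact (integral_smul c _).symm

lemma leftValue_clm {E' : Type*} [NormedAddCommGroup E'] [NormedSpace ℝ E'] (L : E →L[ℝ] E')
    (x : ℝ) : leftValue ν (fun t => L (F t)) (fun t => L (u t)) x = L (leftValue ν F u x) := by
  simp [leftValue]

lemma LocallyIntegrable.clm {E' : Type*} [NormedAddCommGroup E'] [NormedSpace ℝ E'] (L : E →L[ℝ] E')
    (hF : LocallyIntegrable F ν) : LocallyIntegrable (fun t => L (F t)) ν :=
  locallyIntegrable_iff.2 fun _ hK => L.integrable_comp (hF.integrableOn_isCompact hK)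

lemma IsBalancedPrimitive.clm [CompleteSpace E] {E' : Type*} [NormedAddCommGroup E']
    [NormedSpace ℝ E'] [CompleteSpace E'] (L : E →L[ℝ] E') (hu : IsBalancedPrimitive ν F u) :
    IsBalancedPrimitive ν (fun t => L (F t)) (fun t => L (u t)) := by
  refine ⟨LocallyIntegrable.clm L hu.1, fun x y hxy => ?_⟩
  rw [leftValue_clm, leftValue_clm, ← map_sub, hu.2 x y hxy,
    ContinuousLinearMap.integral_comp_comm _ (integrableOn_Ico hu.1 _ _)]

/-- The signed integral of `F ν` from `a` to `x`. -/
def signedIntegral (ν : Measure ℝ) (F : ℝ → E) (a x : ℝ) : E :=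
  if a ≤ x then ∫ t in Ico a x, F t ∂ν else -∫ t in Ico x a, F t ∂ν

lemma signedIntegral_self (a : ℝ) : signedIntegral ν F a a = 0 := by
  simp [signedIntegral]

lemma signedIntegral_sub (hF : LocallyIntegrable F ν) (a : ℝ) {x y : ℝ} (hxy : x ≤ y) :
    signedIntegral ν F a y - signedIntegral ν F a x = ∫ t in Ico x y, F t ∂ν := by
  unfold signedIntegral
  by_cases hx : a ≤ x
  · rw [if_pos hx, if_pos (hx.trans hxy), setIntegral_Ico_add hF hx hxy]
    abel
  · rw [if_neg hx]
    push Not at hx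
    by_cases hy : a ≤ y
    · rw [if_pos hy, setIntegral_Ico_add hF hx.le hy]
      abel
    · rw [if_neg hy]
      push Not at hy
      rw [setIntegral_Ico_add hF hxy hy.le]
      abel

/-- The balanced primitive of `F ν` with left-hand limit `c` at `a`. -/
def primitive (ν : Measure ℝ) (F : ℝ → E) (a : ℝ) (c : E) (x : ℝ) : E :=
  c + signedIntegral ν F a x + (ν.real {x} / 2) • F x

lemma leftValue_primitive (F : ℝ → E) (a : ℝ) (c : E) (x : ℝ) :
    leftValue ν F (primitive ν F a c) x = c + signedIntegral ν F a x := by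
  simp [leftValue, primitive]

lemma isBalancedPrimitive_primitive (hF : LocallyIntegrable F ν) (a : ℝ) (c : E) :
    IsBalancedPrimitive ν F (primitive ν F a c) :=
  ⟨hF, fun x y hxy => by
    rw [leftValue_primitive, leftValue_primitive, add_sub_add_left_eq_sub,
      signedIntegral_sub hF a hxy]⟩

lemma IsBalancedPrimitive.leftValue_eq (hu : IsBalancedPrimitive ν F u) (a x : ℝ) :
    leftValue ν F u x = leftValue ν F u a + signedIntegral ν F a x := by
  unfold signedIntegral
  split_ifs with h
  · rw [← hu.2 a x h]
    abel
  · rw [← hu.2 x a (not_le.1 h).le]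
    abel

lemma eq_leftValue_add (x : ℝ) : u x = leftValue ν F u x + (ν.real {x} / 2) • F x := by
  simp [leftValue]

variable [CompleteSpace E]

/-- Balancing makes both end atoms count by one half, so the triangle inequality can be applied term
by term. -/
lemma IsBalancedPrimitive.sub_eq (hu : IsBalancedPrimitive ν F u) {x y : ℝ} (hxy : x < y) :
    u y - u x = (ν.real {x} / 2) • F x + (∫ t in Ioo x y, F t ∂ν) + (ν.real {y} / 2) • F y := by
  have h := hu.2 x y hxy.le
  rw [setIntegral_Ico_eq_singleton_add hu.1 hxy] at h
  rw [eq_leftValue_add (u := u) (F := F) (ν := ν) y, eq_leftValue_add (u := u) (F := F) (ν := ν) x]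
  have h2 : leftValue ν F u y = leftValue ν F u x +
    (ν.real {x} • F x + ∫ t in Ioo x y, F t ∂ν) := by rw [← h]; abel
  rw [h2]
  module

/-- The balanced primitive of `‖F‖` is monotone and serves as a variation function for `u`. -/
lemma IsBalancedPrimitive.norm_sub_le (hu : IsBalancedPrimitive ν F u) {V : ℝ → ℝ}
    (hV : IsBalancedPrimitive ν (fun t => ‖F t‖) V) {x y : ℝ} (hxy : x ≤ y) :
    ‖u y - u x‖ ≤ V y - V x := by
  rcases hxy.eq_or_lt with rfl | hxy
  · simp
  rw [hu.sub_eq hxy, hV.sub_eq hxy]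
  refine (norm_add₃_le).trans ?_
  rw [norm_smul, norm_smul, Real.norm_of_nonneg (by positivity), Real.norm_of_nonneg (by positivity)]
  gcongr
  · rfl
  · exact norm_integral_le_integral_norm _
  · rfl

lemma IsBalancedPrimitive.locallyBoundedVariationOn (hu : IsBalancedPrimitive ν F u) :
    LocallyBoundedVariationOn u univ := by
  have hF' : LocallyIntegrable (fun t => ‖F t‖) ν := (locallyIntegrable_norm hu.1)
  have hV := isBalancedPrimitive_primitive hF' 0 0
  set V := primitive ν (fun t => ‖F t‖) 0 0
  have hle : ∀ x y, x ≤ y → ‖u y - u x‖ ≤ V y - V x := fun x y h => hu.norm_sub_le hV h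
  have hmono : Monotone V := fun x y h => sub_nonneg.1 ((norm_nonneg _).trans (hle x y h))
  intro a b ha hb
  have hVb := (hmono.monotoneOn univ).locallyBoundedVariationOn a b ha hb
  refine ne_top_of_le_ne_top hVb ?_
  refine iSup_le fun p => ?_
  refine (Finset.sum_le_sum fun i _ => ?_).trans (eVariationOn.sum_le p.2.2.1 p.2.2.2)
  have hi : p.2.1 i ≤ p.2.1 (i + 1) := p.2.2.1 (Nat.le_succ i)
  rw [edist_dist, edist_dist, dist_eq_norm, dist_eq_norm]
  refine ENNReal.ofReal_le_ofReal ((hle _ _ hi).trans (le_abs_self _))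

lemma tendsto_setIntegral_Ico_left (hF : LocallyIntegrable F ν) (x : ℝ) :
    Tendsto (fun y => ∫ t in Ico y x, F t ∂ν) (𝓝[<] x) (𝓝 0) := by
  have h : Tendsto (fun y => ∫ t, (Ico y x).indicator F t ∂ν) (𝓝[<] x)
      (𝓝 (∫ _, (0 : E) ∂ν)) := by
    refine tendsto_integral_filter_of_dominated_convergence
      (fun t => (Ico (x - 1) x).indicator (fun t => ‖F t‖) t) ?_ ?_ ?_ ?_
    · exact Eventually.of_forall fun y =>
        ((integrable_indicator_iff measurableSet_Ico).2 (integrableOn_Ico hF _ _)).1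
    · have : ∀ᶠ y in 𝓝[<] x, x - 1 < y :=
        mem_nhdsWithin_of_mem_nhds (lt_mem_nhds (by linarith))
      filter_upwards [this] with y hy
      refine Eventually.of_forall fun t => ?_
      rw [norm_indicator_eq_indicator_norm]
      exact indicator_le_indicator_of_subset (Ico_subset_Ico_left hy.le) (fun _ => norm_nonneg _) t
    · exact (integrable_indicator_iff measurableSet_Ico).2 (integrableOn_Ico hF _ _).norm
    · refine Eventually.of_forall fun t => ?_
      refine tendsto_const_nhds.congr' ?_
      by_cases ht : t < x
      · have : ∀ᶠ y in 𝓝[<] x, t < y := mem_nhdsWithin_of_mem_nhds (lt_mem_nhds ht)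
        filter_upwards [this] with y hy
        rw [indicator_of_notMem]
        exact fun h => absurd h.1 (not_le.2 hy)
      · exact Eventually.of_forall fun y => (indicator_of_notMem (fun h => ht h.2) _).symm
  simpa [integral_indicator measurableSet_Ico] using h

lemma tendsto_setIntegral_Ioc_right (hF : LocallyIntegrable F ν) (x : ℝ) :
    Tendsto (fun y => ∫ t in Ioc x y, F t ∂ν) (𝓝[>] x) (𝓝 0) := by
  have hI : ∀ y, IntegrableOn F (Ioc x y) ν := fun y =>
    integrableOn_of_isBounded hF (Metric.isBounded_Ioc x y)
  have h : Tendsto (fun y => ∫ t, (Ioc x y).indicator F t ∂ν) (𝓝[>] x)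
      (𝓝 (∫ _, (0 : E) ∂ν)) := by
    refine tendsto_integral_filter_of_dominated_convergence
      (fun t => (Ioc x (x + 1)).indicator (fun t => ‖F t‖) t) ?_ ?_ ?_ ?_
    · exact Eventually.of_forall fun y =>
        ((integrable_indicator_iff measurableSet_Ioc).2 (hI y)).1
    · have : ∀ᶠ y in 𝓝[>] x, y < x + 1 :=
        mem_nhdsWithin_of_mem_nhds (gt_mem_nhds (by linarith))
      filter_upwards [this] with y hy
      refine Eventually.of_forall fun t => ?_
      rw [norm_indicator_eq_indicator_norm]
      exact indicator_le_indicator_of_subset (Ioc_subset_Ioc_right hy.le) (fun _ => norm_nonneg _) t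
    · exact (integrable_indicator_iff measurableSet_Ioc).2 (hI _).norm
    · refine Eventually.of_forall fun t => ?_
      refine tendsto_const_nhds.congr' ?_
      by_cases ht : x < t
      · have : ∀ᶠ y in 𝓝[>] x, y < t := mem_nhdsWithin_of_mem_nhds (gt_mem_nhds ht)
        filter_upwards [this] with y hy
        rw [indicator_of_notMem]
        exact fun h => absurd h.2 (not_le.2 hy)
      · exact Eventually.of_forall fun y => (indicator_of_notMem (fun h => ht h.1) _).symm
  simpa [integral_indicator measurableSet_Ioc] using h

/-- The error is at most the mass of `‖F‖ ν` on `[y, x)`, since the atom at `y` enters only by half.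
-/
lemma IsBalancedPrimitive.tendsto_left (hu : IsBalancedPrimitive ν F u) (x : ℝ) :
    Tendsto u (𝓝[<] x) (𝓝 (leftValue ν F u x)) := by
  rw [tendsto_iff_norm_sub_tendsto_zero]
  have h0 := tendsto_setIntegral_Ico_left (locallyIntegrable_norm hu.1) x
  refine squeeze_zero' (Eventually.of_forall fun _ => norm_nonneg _) ?_ h0
  filter_upwards [self_mem_nhdsWithin] with y hy
  have hy : y < x := hy
  rw [setIntegral_Ico_eq_singleton_add (locallyIntegrable_norm hu.1) hy]
  have h := hu.2 y x hy.le
  rw [setIntegral_Ico_eq_singleton_add hu.1 hy] at h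
  have h1 : u y - leftValue ν F u x = -((ν.real {y} / 2) • F y + ∫ t in Ioo y x, F t ∂ν) := by
    rw [eq_leftValue_add (u := u) (F := F) (ν := ν) y]
    have h2 : leftValue ν F u x = leftValue ν F u y +
      (ν.real {y} • F y + ∫ t in Ioo y x, F t ∂ν) := by rw [← h]; abel
    rw [h2]
    module
  rw [h1, norm_neg]
  refine (norm_add_le _ _).trans (add_le_add ?_ (norm_integral_le_integral_norm _))
  rw [norm_smul, Real.norm_of_nonneg (by positivity), smul_eq_mul]
  have : 0 ≤ ν.real {y} := measureReal_nonneg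
  gcongr
  linarith

lemma IsBalancedPrimitive.tendsto_right (hu : IsBalancedPrimitive ν F u) (x : ℝ) :
    Tendsto u (𝓝[>] x) (𝓝 (leftValue ν F u x + ν.real {x} • F x)) := by
  rw [tendsto_iff_norm_sub_tendsto_zero]
  have h0 := tendsto_setIntegral_Ioc_right (locallyIntegrable_norm hu.1) x
  refine squeeze_zero' (Eventually.of_forall fun _ => norm_nonneg _) ?_ h0
  filter_upwards [self_mem_nhdsWithin] with y hy
  have hy : x < y := hy
  rw [setIntegral_Ioc_eq_singleton_add (locallyIntegrable_norm hu.1) hy]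
  have h := hu.2 x y hy.le
  rw [setIntegral_Ico_eq_singleton_add hu.1 hy] at h
  have h1 : u y - (leftValue ν F u x + ν.real {x} • F x)
      = ((ν.real {y} / 2) • F y + ∫ t in Ioo x y, F t ∂ν) := by
    rw [eq_leftValue_add (u := u) (F := F) (ν := ν) y]
    have h2 : leftValue ν F u y = leftValue ν F u x +
      (ν.real {x} • F x + ∫ t in Ioo x y, F t ∂ν) := by rw [← h]; abel
    rw [h2]
    module
  rw [h1]
  refine (norm_add_le _ _).trans (add_le_add ?_ (norm_integral_le_integral_norm _))
  rw [norm_smul, Real.norm_of_nonneg (by positivity), smul_eq_mul]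
  have : 0 ≤ ν.real {y} := measureReal_nonneg
  gcongr
  linarith

end Primitive

lemma IsBalancedPrimitive.isBalancedBV {ν : Measure ℝ} {F u : ℝ → Fin 2 → ℂ}
    (hu : IsBalancedPrimitive ν F u) : IsBalancedBV u := by
  refine ⟨hu.locallyBoundedVariationOn, fun x => ⟨_, _, hu.tendsto_left x, hu.tendsto_right x, ?_⟩⟩
  ext i
  simp [leftValue]
  ring

/-! Products of balanced primitives -/

section Product

variable {ν : Measure ℝ}

/-- Padding a scalar function to two equal components makes the facts on `IsBalancedBV` available
for it. -/
lemma IsBalancedPrimitive.pi_const {F u : ℝ → ℂ} (hu : IsBalancedPrimitive ν F u) :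
    IsBalancedPrimitive ν (fun t (_ : Fin 2) => F t) (fun t _ => u t) :=
  hu.clm (ContinuousLinearMap.pi fun _ : Fin 2 => ContinuousLinearMap.id ℝ ℂ)

lemma IsBalancedPrimitive.measurable {F u : ℝ → ℂ} (hu : IsBalancedPrimitive ν F u) :
    Measurable u :=
  (measurable_pi_apply (0 : Fin 2)).comp hu.pi_const.isBalancedBV.measurable

lemma IsBalancedPrimitive.exists_bound {F u : ℝ → ℂ} (hu : IsBalancedPrimitive ν F u) {s : Set ℝ}
    (hs : Bornology.IsBounded s) : ∃ C : ℝ, ∀ x ∈ s, ‖u x‖ ≤ C := by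
  obtain ⟨R, hR⟩ := hs.subset_closedBall 0
  obtain ⟨C, hC⟩ := hu.pi_const.isBalancedBV.exists_bound (isCompact_closedBall (0 : ℝ) R)
  exact ⟨C, fun x hx => hC x (hR hx) 0⟩

lemma IsBalancedPrimitive.apply {F u : ℝ → Fin 2 → ℂ} (hu : IsBalancedPrimitive ν F u)
    (i : Fin 2) : IsBalancedPrimitive ν (fun t => F t i) (fun t => u t i) :=
  hu.clm (ContinuousLinearMap.proj (R := ℝ) (φ := fun _ : Fin 2 => ℂ) i)

lemma leftValue_apply (F u : ℝ → Fin 2 → ℂ) (x : ℝ) (i : Fin 2) :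
    leftValue ν F u x i = leftValue ν (fun t => F t i) (fun t => u t i) x := by
  simp [leftValue]

lemma IsBalancedPrimitive.of_apply {F u : ℝ → Fin 2 → ℂ}
    (h : ∀ i, IsBalancedPrimitive ν (fun t => F t i) (fun t => u t i)) :
    IsBalancedPrimitive ν F u := by
  have hF : LocallyIntegrable F ν := locallyIntegrable_iff.2 fun K hK =>
    Integrable.of_eval fun i => (h i).1.integrableOn_isCompact hK
  refine ⟨hF, fun x y hxy => ?_⟩
  ext i
  rw [eval_integral fun i => integrableOn_Ico (h i).1 x y, Pi.sub_apply, leftValue_apply, leftValue_apply, (h i).2 x y hxy]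

lemma IsBalancedPrimitive.star {F u : ℝ → ℂ} (hu : IsBalancedPrimitive ν F u) :
    IsBalancedPrimitive ν (fun t => star (F t)) (fun t => star (u t)) :=
  hu.clm (Complex.conjCLE : ℂ →L[ℝ] ℂ)

/-- A locally integrable function times a locally bounded one. -/
lemma LocallyIntegrable.mul_primitive {α F u : ℝ → ℂ} (hα : LocallyIntegrable α ν)
    (hu : IsBalancedPrimitive ν F u) : LocallyIntegrable (fun t => α t * u t) ν := by
  refine locallyIntegrable_iff.2 fun K hK => ?_
  obtain ⟨C, hC⟩ := hu.exists_bound hK.isBounded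
  refine (hα.integrableOn_isCompact hK).mul_bdd (c := C) hu.measurable.aestronglyMeasurable ?_
  exact (ae_restrict_iff' hK.measurableSet).2 (Eventually.of_forall hC)

/-- The kernel of the balanced primitive. -/
def balancedKernel (s t : ℝ) : ℂ := if s < t then 1 else if s = t then 1 / 2 else 0

lemma balancedKernel_add_swap (s t : ℝ) : balancedKernel s t + balancedKernel t s = 1 := by
  unfold balancedKernel
  rcases lt_trichotomy s t with h | h | h
  · simp [h, h.not_gt, h.ne']
  · subst h
    norm_num
  · simp [h, h.not_gt, h.ne']

lemma measurable_balancedKernel : Measurable fun p : ℝ × ℝ => balancedKernel p.1 p.2 :=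
  Measurable.ite (measurableSet_lt measurable_fst measurable_snd) measurable_const
    (Measurable.ite (measurableSet_eq_fun measurable_fst measurable_snd) measurable_const
      measurable_const)

lemma norm_balancedKernel_le (s t : ℝ) : ‖balancedKernel s t‖ ≤ 1 := by
  unfold balancedKernel
  split_ifs <;> norm_num

/-- The weight `1/2` on the diagonal accounts for the balanced value at `t`. In this form products
of primitives can be treated by Fubini. -/
lemma IsBalancedPrimitive.eq_integral_kernel {F u : ℝ → ℂ} (hu : IsBalancedPrimitive ν F u)
    {x y t : ℝ} (ht : t ∈ Ico x y) :
    u t = leftValue ν F u x + ∫ s in Ico x y, F s * balancedKernel s t ∂ν := by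
  have h1 : ∀ s ∈ Ico x y, F s * balancedKernel s t
      = (Ico x t).indicator F s + (1 / 2 : ℂ) * ({t} : Set ℝ).indicator F s := by
    intro s hs
    unfold balancedKernel
    by_cases h : s < t
    · rw [if_pos h, indicator_of_mem (show s ∈ Ico x t from ⟨hs.1, h⟩), indicator_of_notMem]
      · simp
      · exact h.ne
    · rw [if_neg h, indicator_of_notMem (fun h' => h h'.2)]
      by_cases h' : s = t
      · subst h'
        simp
        ring
      · rw [if_neg h', indicator_of_notMem (by simpa using h')]
        simp
  have hI := integrableOn_Ico hu.1 x y
  rw [setIntegral_congr_fun measurableSet_Ico h1, integral_add (hI.indicator measurableSet_Ico)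
    ((hI.indicator (measurableSet_singleton t)).const_mul _), integral_const_mul,
    setIntegral_indicator measurableSet_Ico, setIntegral_indicator (measurableSet_singleton t)]
  have h2 : Ico x y ∩ Ico x t = Ico x t :=
    inter_eq_right.2 (Ico_subset_Ico_right ht.2.le)
  have h3 : Ico x y ∩ {t} = {t} := inter_eq_right.2 (singleton_subset_iff.2 ht)
  rw [h2, h3, ← hu.2 x t ht.1, setIntegral_singleton', eq_leftValue_add (u := u) (F := F) (ν := ν) t]
  simp
  ring

/-- The product rule has no correction at common atoms precisely because the functions are balanced:
the two double integrals run over the same square, and their kernels add up to one even on the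
diagonal. -/
lemma IsBalancedPrimitive.mul_sub [IsLocallyFiniteMeasure ν] {α β a b : ℝ → ℂ}
    (ha : IsBalancedPrimitive ν α a) (hb : IsBalancedPrimitive ν β b) {x y : ℝ} (hxy : x ≤ y) :
    leftValue ν α a y * leftValue ν β b y - leftValue ν α a x * leftValue ν β b x
      = ∫ t in Ico x y, (α t * b t + a t * β t) ∂ν := by
  set μ := ν.restrict (Ico x y) with hμ
  have hα : Integrable α μ := integrableOn_Ico ha.1 x y
  have hβ : Integrable β μ := integrableOn_Ico hb.1 x y
  have hP : Integrable (fun p : ℝ × ℝ => α p.1 * β p.2) (μ.prod μ) := hα.mul_prod hβ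
  have hk1 : Integrable (fun p : ℝ × ℝ => α p.1 * β p.2 * balancedKernel p.1 p.2) (μ.prod μ) :=
    hP.mul_bdd (c := 1) measurable_balancedKernel.aestronglyMeasurable
      (Eventually.of_forall fun p => norm_balancedKernel_le _ _)
  have hk2 : Integrable (fun p : ℝ × ℝ => α p.1 * β p.2 * balancedKernel p.2 p.1) (μ.prod μ) :=
    hP.mul_bdd (c := 1) (measurable_balancedKernel.comp measurable_swap).aestronglyMeasurable
      (Eventually.of_forall fun p => norm_balancedKernel_le _ _)
  have e1 : ∫ t, α t * b t ∂μ = leftValue ν β b x * (∫ t, α t ∂μ)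
      + ∫ p, α p.1 * β p.2 * balancedKernel p.2 p.1 ∂(μ.prod μ) := by
    rw [integral_prod _ hk2, ← integral_const_mul, ← integral_add (hα.const_mul _)
      hk2.integral_prod_left]
    refine setIntegral_congr_fun measurableSet_Ico fun t ht => ?_
    simp only [mul_assoc, integral_const_mul]
    rw [hb.eq_integral_kernel ht]
    ring
  have e2 : ∫ t, a t * β t ∂μ = leftValue ν α a x * (∫ t, β t ∂μ)
      + ∫ p, α p.1 * β p.2 * balancedKernel p.1 p.2 ∂(μ.prod μ) := by
    rw [integral_prod_symm _ hk1, ← integral_const_mul, ← integral_add (hβ.const_mul _)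
      hk1.integral_prod_right]
    refine setIntegral_congr_fun measurableSet_Ico fun t ht => ?_
    simp only [mul_right_comm _ (β _), integral_mul_const]
    rw [ha.eq_integral_kernel ht]
    ring
  have e3 : (∫ p, α p.1 * β p.2 * balancedKernel p.2 p.1 ∂(μ.prod μ))
      + ∫ p, α p.1 * β p.2 * balancedKernel p.1 p.2 ∂(μ.prod μ)
      = (∫ t, α t ∂μ) * ∫ t, β t ∂μ := by
    rw [← integral_add hk2 hk1, ← integral_prod_mul]
    refine integral_congr_ae (Eventually.of_forall fun p => ?_)
    simp only
    rw [← mul_add, add_comm, balancedKernel_add_swap, mul_one]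
  have i1 : Integrable (fun t => α t * b t) μ :=
    integrableOn_Ico (LocallyIntegrable.mul_primitive ha.1 hb) x y
  have i2 : Integrable (fun t => a t * β t) μ := by
    have := integrableOn_Ico (LocallyIntegrable.mul_primitive hb.1 ha) x y
    simp only [mul_comm (a _)]
    exact this
  rw [integral_add i1 i2, e1, e2]
  have h1 : leftValue ν α a y = leftValue ν α a x + ∫ t, α t ∂μ := by rw [← ha.2 x y hxy]; ring
  have h2 : leftValue ν β b y = leftValue ν β b x + ∫ t, β t ∂μ := by rw [← hb.2 x y hxy]; ring
  rw [h1, h2]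
  linear_combination -e3

/-- Lagrange's identity in integrated form. -/
lemma IsBalancedPrimitive.dotProduct_sub [IsLocallyFiniteMeasure ν] {F G u v : ℝ → Fin 2 → ℂ}
    (hu : IsBalancedPrimitive ν F u) (hv : IsBalancedPrimitive ν G v)
    (J : Matrix (Fin 2) (Fin 2) ℂ) {x y : ℝ} (hxy : x ≤ y) :
    leftValue ν F u y ⬝ᵥ J *ᵥ leftValue ν G v y - leftValue ν F u x ⬝ᵥ J *ᵥ leftValue ν G v x
      = ∫ t in Ico x y, (F t ⬝ᵥ J *ᵥ v t + u t ⬝ᵥ J *ᵥ G t) ∂ν := by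
  have key : ∀ i j, IntegrableOn (fun t => F t i * v t j + u t i * G t j) (Ico x y) ν := by
    intro i j
    have i1 := integrableOn_Ico (LocallyIntegrable.mul_primitive (hu.apply i).1 (hv.apply j)) x y
    have i2 := integrableOn_Ico (LocallyIntegrable.mul_primitive (hv.apply j).1 (hu.apply i)) x y
    exact i1.add (by simpa only [mul_comm] using i2)
  obtain ⟨c, hc⟩ : ∃ c : Fin 2 → Fin 2 → ℂ, ∀ i j, J i j = c i j := ⟨fun i j => J i j, fun _ _ => rfl⟩
  have e : ∀ t, F t ⬝ᵥ J *ᵥ v t + u t ⬝ᵥ J *ᵥ G t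
      = ∑ i, ∑ j, c i j * (F t i * v t j + u t i * G t j) := by
    intro t
    simp [dotProduct, Matrix.mulVec, Fin.sum_univ_two, hc]
    ring
  simp only [e]
  rw [integral_finsetSum _ fun i _ => integrable_finsetSum _ fun j _ => (key i j).const_mul _]
  have e2 : ∀ i, ∫ t in Ico x y, ∑ j, c i j * (F t i * v t j + u t i * G t j) ∂ν
      = ∑ j, c i j * (leftValue ν F u y i * leftValue ν G v y j
        - leftValue ν F u x i * leftValue ν G v x j) := by
    intro i
    rw [integral_finsetSum _ fun j _ => (key i j).const_mul _]
    refine Finset.sum_congr rfl fun j _ => ?_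
    rw [integral_const_mul, ← (hu.apply i).mul_sub (hv.apply j) hxy]
    simp only [leftValue_apply]
  simp only [e2]
  simp [dotProduct, Matrix.mulVec, Fin.sum_univ_two, hc]
  ring

end Product

/-! Balanced primitives and distributional derivatives -/

section Distribution

variable {ν : Measure ℝ}

lemma countable_atoms (ν : Measure ℝ) [SigmaFinite ν] : {x | ν {x} ≠ 0}.Countable := by
  have := Measure.countable_meas_pos_of_disjoint_iUnion (μ := ν) (As := fun x : ℝ => ({x} : Set ℝ))
    (fun x => measurableSet_singleton x) (fun x y h => by simpa using h)
  simpa [pos_iff_ne_zero] using this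

/-- The two can differ only at atoms of `ν`, which are countably many and hence Lebesgue null. -/
lemma ae_eq_leftValue [SigmaFinite ν] {E : Type*} [NormedAddCommGroup E] [NormedSpace ℝ E]
    (F u : ℝ → E) : ∀ᵐ x : ℝ, u x = leftValue ν F u x := by
  have h : ∀ᵐ x : ℝ, x ∉ {x | ν {x} ≠ 0} :=
    measure_eq_zero_iff_ae_notMem.1 ((countable_atoms ν).measure_zero volume)
  filter_upwards [h] with x hx
  have hx : ν {x} = 0 := by simpa using hx
  simp [leftValue, Measure.real, hx]

lemma IsTest.exists_bound {φ : ℝ → ℂ} (hφ : IsTest φ) :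
    ∃ R : ℝ, 0 < R ∧ ∀ x, x ∉ Ioo (-R) R → φ x = 0 ∧ deriv φ x = 0 := by
  obtain ⟨R, hR⟩ := hφ.2.isCompact.isBounded.subset_closedBall 0
  refine ⟨|R| + 1, by positivity, fun x hx => ?_⟩
  have hx' : x ∉ tsupport φ := by
    intro h
    have := hR h
    rw [Metric.mem_closedBall, dist_zero_right, Real.norm_eq_abs] at this
    exact hx (abs_lt.1 (this.trans_lt ((le_abs_self R).trans_lt (lt_add_one _))))
  exact ⟨image_eq_zero_of_notMem_tsupport hx',
    image_eq_zero_of_notMem_tsupport fun h => hx' (tsupport_deriv_subset h)⟩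

lemma IsTest.integrable_deriv {φ : ℝ → ℂ} (hφ : IsTest φ) : Integrable (deriv φ) :=
  (hφ.1.continuous_deriv (by simp)).integrable_of_hasCompactSupport hφ.2.deriv

lemma IsTest.integral_deriv {φ : ℝ → ℂ} (hφ : IsTest φ) : ∫ x, deriv φ x = 0 := by
  have h1 : ContDiff ℝ 1 φ := hφ.1.of_le (by exact_mod_cast le_top)
  have := integral_add_compl (s := Iic (0 : ℝ)) measurableSet_Iic hφ.integrable_deriv
  rw [← this, compl_Iic, hφ.2.integral_Iic_deriv_eq h1, hφ.2.integral_Ioi_deriv_eq h1]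
  ring

/-- Fubini on the triangle `t < x`. The constant `leftValue ν F u (-R)` drops out because a test
function's derivative has integral zero. -/
lemma IsBalancedPrimitive.integral_mul_deriv [IsLocallyFiniteMeasure ν] {F u : ℝ → ℂ}
    (hu : IsBalancedPrimitive ν F u) {φ : ℝ → ℂ} (hφ : IsTest φ) :
    ∫ x, u x * deriv φ x = -∫ x, φ x * F x ∂ν := by
  obtain ⟨R, hR0, hR⟩ := hφ.exists_bound
  have h1 : ContDiff ℝ 1 φ := hφ.1.of_le (by exact_mod_cast le_top)
  set μ := ν.restrict (Ico (-R) R) with hμ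
  have hF : Integrable F μ := integrableOn_Ico hu.1 _ _
  set K : ℝ × ℝ → ℂ := {p : ℝ × ℝ | p.2 < p.1}.indicator fun p => deriv φ p.1 * F p.2 with hK
  have hKi : Integrable K (volume.prod μ) :=
    (hφ.integrable_deriv.mul_prod hF).indicator (measurableSet_lt measurable_snd measurable_fst)
  have e1 : ∀ᵐ x : ℝ, u x * deriv φ x
      = leftValue ν F u (-R) * deriv φ x + ∫ t, K (x, t) ∂μ := by
    filter_upwards [ae_eq_leftValue (ν := ν) F u] with x hx
    have hKx : ∀ t, K (x, t) = deriv φ x * (Iio x).indicator F t := by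
      intro t
      by_cases h : t < x
      · simp [hK, h]
      · simp [hK, h]
    simp only [hKx, integral_const_mul]
    by_cases hxR : x ∈ Ioo (-R) R
    · rw [hx, ← add_sub_cancel (leftValue ν F u (-R)) (leftValue ν F u x), hu.2 (-R) x hxR.1.le,
        setIntegral_indicator measurableSet_Iio]
      have : Ico (-R) R ∩ Iio x = Ico (-R) x := by
        ext t
        simp only [mem_inter_iff, mem_Ico, mem_Iio]
        exact ⟨fun h => ⟨h.1.1, h.2⟩, fun h => ⟨⟨h.1, h.2.trans hxR.2⟩, h.2⟩⟩
      rw [this]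
      ring
    · simp [(hR x hxR).2]
  rw [integral_congr_ae e1, integral_add (hφ.integrable_deriv.const_mul _) hKi.integral_prod_left,
    integral_const_mul, hφ.integral_deriv, mul_zero, zero_add,
    integral_integral_swap (f := fun x t => K (x, t)) hKi]
  have e2 : ∀ t, ∫ x, K (x, t) = -(φ t * F t) := by
    intro t
    have hKt : ∀ x, K (x, t) = (Ioi t).indicator (deriv φ) x * F t := by
      intro x
      by_cases h : t < x
      · simp [hK, h]
      · simp [hK, h]
    simp only [hKt, integral_mul_const]
    rw [integral_indicator measurableSet_Ioi, hφ.2.integral_Ioi_deriv_eq h1]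
    ring
  simp only [e2, integral_neg]
  congr 1
  refine setIntegral_eq_integral_of_forall_compl_eq_zero fun x hx => ?_
  rw [(hR x fun h => hx ⟨h.1.le, h.2⟩).1, zero_mul]

/-- The integral from `-∞` is constant to the right of the support, and that constant is the total
integral, so it is compactly supported. -/
lemma isTest_primitive {g : ℝ → ℝ} (hg : ContDiff ℝ ((⊤ : ℕ∞) : WithTop ℕ∞) g)
    (hc : HasCompactSupport g) (h0 : ∫ x, g x = 0) :
    ∃ φ : ℝ → ℂ, IsTest φ ∧ ∀ x, deriv φ x = (g x : ℂ) := by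
  obtain ⟨R, hR⟩ := hc.isCompact.isBounded.subset_closedBall 0
  have hz : ∀ x, |R| < |x| → g x = 0 := by
    intro x hx
    refine image_eq_zero_of_notMem_tsupport fun h => ?_
    have := hR h
    rw [Metric.mem_closedBall, dist_zero_right, Real.norm_eq_abs] at this
    exact absurd (this.trans (le_abs_self R)) (not_le.2 hx)
  have hgi : Integrable g := hg.continuous.integrable_of_hasCompactSupport hc
  set ψ : ℝ → ℝ := fun x => ∫ t in Iic x, g t with hψ
  have hd : ∀ x, HasDerivAt ψ (g x) x := by
    intro x
    have h1 : ∀ y, ψ y = ψ 0 + ∫ t in (0 : ℝ)..y, g t := by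
      intro y
      rw [hψ, ← intervalIntegral.integral_Iic_sub_Iic hgi.integrableOn hgi.integrableOn]
      ring
    rw [funext h1]
    exact (intervalIntegral.integral_hasDerivAt_right (hgi.intervalIntegrable)
      (hg.continuous.stronglyMeasurableAtFilter _ _) hg.continuous.continuousAt).const_add _
  have hψc : HasCompactSupport ψ := by
    refine HasCompactSupport.intro (isCompact_closedBall (0 : ℝ) |R|) fun x hx => ?_
    rw [Metric.mem_closedBall, dist_zero_right, Real.norm_eq_abs, not_le] at hx
    rcases lt_or_ge x 0 with h | h
    · refine setIntegral_eq_zero_of_forall_eq_zero fun t ht => hz t ?_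
      have ht : t ≤ x := ht
      rw [abs_of_neg h] at hx
      rw [abs_of_neg (ht.trans_lt h)]
      linarith
    · rw [hψ, ← h0]
      refine setIntegral_eq_integral_of_forall_compl_eq_zero fun t ht => hz t ?_
      have ht : x < t := not_le.1 ht
      rw [abs_of_nonneg h] at hx
      rw [abs_of_pos (h.trans_lt ht)]
      linarith
  have hψd : ContDiff ℝ ((⊤ : ℕ∞) : WithTop ℕ∞) ψ := by
    refine contDiff_infty_iff_deriv.2 ⟨fun x => (hd x).differentiableAt, ?_⟩
    rwa [show deriv ψ = g from funext fun x => (hd x).deriv]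
  refine ⟨fun x => (ψ x : ℂ), ⟨Complex.ofRealCLM.contDiff.comp hψd, ?_⟩, fun x => ?_⟩
  · exact hψc.comp_left (g := fun t : ℝ => (t : ℂ)) Complex.ofReal_zero
  · exact (hd x).ofReal_comp.deriv

/-- The lemma of du Bois-Reymond: subtracting from `g` its integral times a normalised bump `ρ`
leaves the derivative of a test function. The constant is therefore the mean of `d` against `ρ`. -/
lemma ae_eq_const_of_integral_mul_deriv_eq_zero {d : ℝ → ℂ} (hd : LocallyIntegrable d)
    (h : ∀ φ, IsTest φ → ∫ x, d x * deriv φ x = 0) : ∃ c : ℂ, ∀ᵐ x : ℝ, d x = c := by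
  -- The radii are arbitrary; only the normalisation to integral one is used.
  let b : ContDiffBump (0 : ℝ) := ⟨1, 2, one_pos, one_lt_two⟩
  set ρ : ℝ → ℝ := b.normed volume with hρ
  have hρd : ContDiff ℝ ((⊤ : ℕ∞) : WithTop ℕ∞) ρ := b.contDiff_normed
  have hρc : HasCompactSupport ρ := b.hasCompactSupport_normed
  have hmul : ∀ g : ℝ → ℝ, Continuous g → HasCompactSupport g → Integrable fun x => g x • d x :=
    fun g hg hc => hd.integrable_smul_left_of_hasCompactSupport hg hc
  refine ⟨∫ x, ρ x • d x, ?_⟩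
  refine ae_eq_of_integral_contDiff_smul_eq hd (locallyIntegrable_const _) fun g hg hc => ?_
  have hgi : Integrable g := hg.continuous.integrable_of_hasCompactSupport hc
  have hρi : Integrable ρ := hρd.continuous.integrable_of_hasCompactSupport hρc
  set m := ∫ x, g x with hm
  obtain ⟨φ, hφ, hφd⟩ := isTest_primitive (g := fun x => g x - m * ρ x)
    (hg.sub (contDiff_const.mul hρd)) (hc.sub hρc.mul_left)
    (by rw [integral_sub hgi (hρi.const_mul _), integral_const_mul, hρ, b.integral_normed]; simp [hm])
  have h1 := h φ hφ
  have h2 : ∀ x, d x * deriv φ x = g x • d x - m • (ρ x • d x) := by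
    intro x
    rw [hφd]
    simp only [Complex.real_smul]
    push_cast
    ring
  simp only [h2] at h1
  have hi2 : Integrable (fun x => m • ρ x • d x) := (hmul ρ hρd.continuous hρc).smul m
  rw [integral_sub (hmul g hg.continuous hc) hi2, integral_smul, sub_eq_zero] at h1
  rw [h1, integral_smul_const]

/-- If the limit were different, `d` would avoid `c` on a neighbourhood within `s`, which has
positive measure. -/
lemma eq_of_tendsto_of_ae_eq {E : Type*} [TopologicalSpace E] [T2Space E] {d : ℝ → E} {c l : E}
    {x : ℝ} {s : Set ℝ} (hs : ∀ U ∈ 𝓝[s] x, volume U ≠ 0) (h : ∀ᵐ x : ℝ, d x = c)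
    (hl : Tendsto d (𝓝[s] x) (𝓝 l)) : l = c := by
  by_contra hne
  have h1 : ∀ᶠ y in 𝓝[s] x, d y ≠ c := hl.eventually_ne hne
  exact hs _ h1 (by simpa [ae_iff] using h)

lemma volume_ne_zero_of_mem_nhdsLT {x : ℝ} {U : Set ℝ} (hU : U ∈ 𝓝[<] x) : volume U ≠ 0 := by
  obtain ⟨y, hy, hyU⟩ := (mem_nhdsLT_iff_exists_Ioo_subset).1 hU
  intro h0
  have := measure_mono_null hyU h0
  rw [Real.volume_Ioo, ENNReal.ofReal_eq_zero] at this
  have hy : y < x := hy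
  linarith

lemma volume_ne_zero_of_mem_nhdsGT {x : ℝ} {U : Set ℝ} (hU : U ∈ 𝓝[>] x) : volume U ≠ 0 := by
  obtain ⟨y, hy, hyU⟩ := (mem_nhdsGT_iff_exists_Ioo_subset).1 hU
  intro h0
  have := measure_mono_null hyU h0
  rw [Real.volume_Ioo, ENNReal.ofReal_eq_zero] at this
  have hy : x < y := hy
  linarith

lemma IsBalancedBV.locallyIntegrable {u : ℝ → Fin 2 → ℂ} (hu : IsBalancedBV u) (i : Fin 2)
    (μ : Measure ℝ) [IsLocallyFiniteMeasure μ] : LocallyIntegrable (fun x => u x i) μ := by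
  refine locallyIntegrable_iff.2 fun K hK => ?_
  obtain ⟨C, hC⟩ := hu.exists_bound hK
  refine Measure.integrableOn_of_bounded (M := C) hK.measure_lt_top.ne
    ((measurable_pi_apply i).comp hu.measurable).aestronglyMeasurable ?_
  exact (ae_restrict_iff' hK.measurableSet).2 (Eventually.of_forall fun x hx => hC x hx i)

/-- A balanced function of locally bounded variation whose distributional derivative is `F ν` is a
balanced primitive of `F ν`. -/
lemma IsBalancedBV.isBalancedPrimitive [IsLocallyFiniteMeasure ν] {F u : ℝ → Fin 2 → ℂ}
    (hu : IsBalancedBV u) (hF : LocallyIntegrable F ν)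
    (h : ∀ φ, IsTest φ → ∀ i, ∫ x, u x i * deriv φ x = -∫ x, φ x * F x i ∂ν) :
    IsBalancedPrimitive ν F u := by
  have hP := isBalancedPrimitive_primitive hF 0 0
  set P := primitive ν F 0 0
  have hPb := hP.isBalancedBV
  have hd : IsBalancedBV (u + (-1 : ℂ) • P) := hu.add (hPb.smul _)
  have hc : ∀ i, ∃ c : ℂ, ∀ᵐ x : ℝ, (u + (-1 : ℂ) • P) x i = c := by
    intro i
    refine ae_eq_const_of_integral_mul_deriv_eq_zero (hd.locallyIntegrable i volume) fun φ hφ => ?_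
    have e : ∀ x, (u + (-1 : ℂ) • P) x i * deriv φ x = u x i * deriv φ x - P x i * deriv φ x := by
      intro x
      simp
      ring
    simp only [e]
    rw [integral_sub (hu.integrable_deriv i hφ) (hPb.integrable_deriv i hφ), h φ hφ i,
      (hP.apply i).integral_mul_deriv hφ, sub_self]
  choose c hc using hc
  have hae : ∀ᵐ x : ℝ, (u + (-1 : ℂ) • P) x = c := by
    filter_upwards [ae_all_iff.2 hc] with x hx
    exact funext hx
  -- A function that is constant almost everywhere has this constant as both one-sided limits, and a
  -- balanced function is their mean everywhere.
  have heq : ∀ x, u x = c + P x := by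
    intro x
    obtain ⟨l, r, hl, hr, he⟩ := hd.2 x
    rw [eq_of_tendsto_of_ae_eq (fun U hU => volume_ne_zero_of_mem_nhdsLT hU) hae hl,
      eq_of_tendsto_of_ae_eq (fun U hU => volume_ne_zero_of_mem_nhdsGT hU) hae hr] at he
    have : u x = (u + (-1 : ℂ) • P) x + P x := by simp
    rw [this, he]
    module
  have hu' : u = fun x => c + P x := funext heq
  refine ⟨hF, fun x y hxy => ?_⟩
  rw [← hP.2 x y hxy, hu']
  simp only [leftValue]
  abel

end Distribution

/-! A two-sided Volterra equation with respect to a measure -/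

section Volterra

/-- The points strictly between the base point `a` and `x`, together with `a` if `a < x`. -/
def reach (a x : ℝ) : Set ℝ := if a ≤ x then Ico a x else Ioo x a

lemma mem_reach {a x y : ℝ} : y ∈ reach a x ↔ (a ≤ y ∧ y < x) ∨ (x < y ∧ y < a) := by
  unfold reach
  split_ifs with h
  · simp only [mem_Ico]
    constructor
    · exact Or.inl
    · rintro (h' | h')
      · exact h'
      · exact absurd (h'.1.trans h'.2) (not_lt.2 h)
  · simp only [mem_Ioo]
    constructor
    · exact Or.inr
    · rintro (h' | h')
      · exact absurd (h'.1.trans h'.2.le) h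
      · exact h'

lemma measurableSet_reach_prod (a : ℝ) : MeasurableSet {p : ℝ × ℝ | p.2 ∈ reach a p.1} := by
  simp only [mem_reach]
  exact ((measurableSet_le measurable_const measurable_snd).inter
    (measurableSet_lt measurable_snd measurable_fst)).union
    ((measurableSet_lt measurable_fst measurable_snd).inter
    (measurableSet_lt measurable_snd measurable_const))

lemma measurableSet_reach (a x : ℝ) : MeasurableSet (reach a x) := by
  unfold reach
  split_ifs <;> measurability

lemma isBounded_reach (a x : ℝ) : Bornology.IsBounded (reach a x) := by
  unfold reach
  split_ifs
  · exact Metric.isBounded_Ico _ _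
  · exact Metric.isBounded_Ioo _ _

lemma reach_subset {a x y : ℝ} (hy : y ∈ reach a x) : reach a y ⊆ reach a x := by
  intro z hz
  rw [mem_reach] at *
  grind

/-- The point of `K` nearest to `a` works, as all points of `reach a y` are strictly nearer to `a`
than `y`. -/
lemma exists_subset_reach_diff {a x : ℝ} {K : Set ℝ} (hK : IsCompact K) (hne : K.Nonempty)
    (hKx : K ⊆ reach a x) : ∃ y ∈ K, K ⊆ reach a x \ reach a y := by
  obtain ⟨y, hy, hmin⟩ := hK.exists_isMinOn hne (f := fun y => |y - a|) (by fun_prop)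
  refine ⟨y, hy, fun z hz => ⟨hKx hz, fun hzy => ?_⟩⟩
  have h1 : |y - a| ≤ |z - a| := hmin hz
  have hz' := hKx hz
  have hy' := hKx hy
  rw [mem_reach] at *
  grind

/-- A substitute for the change of variables `s = μ (reach a y)` that tolerates atoms. By inner
regularity a compact `K` may replace the superlevel set; it avoids `reach a y` for its point `y`
nearest to `a`, and that set already has mass more than `t`. -/
lemma measure_reach_tail (μ : Measure ℝ) [IsFiniteMeasure μ] (a x t : ℝ)
    (hμ : μ (reach a x)ᶜ = 0) :
    μ {y | t < μ.real (reach a y)} ≤ ENNReal.ofReal (μ.real (reach a x) - t) := by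
  have hm : Measurable fun y => μ.real (reach a y) :=
    (measurable_measure_prodMk_left (measurableSet_reach_prod a)).ennreal_toReal
  set A := {y | t < μ.real (reach a y)} ∩ reach a x with hA
  have hAm : MeasurableSet A := (measurableSet_lt measurable_const hm).inter (measurableSet_reach a x)
  have h1 : μ {y | t < μ.real (reach a y)} ≤ μ A := by
    have : {y | t < μ.real (reach a y)} ⊆ A ∪ (reach a x)ᶜ := by
      intro y hy
      by_cases h : y ∈ reach a x
      · exact Or.inl ⟨hy, h⟩
      · exact Or.inr h
    refine (measure_mono this).trans ((measure_union_le _ _).trans ?_)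
    rw [hμ, add_zero]
  refine h1.trans ?_
  rw [hAm.measure_eq_iSup_isCompact_of_ne_top (measure_ne_top μ A)]
  refine iSup_le fun K => iSup_le fun hKA => iSup_le fun hK => ?_
  rcases K.eq_empty_or_nonempty with rfl | hne
  · simp
  obtain ⟨y, hy, hKy⟩ := exists_subset_reach_diff hK hne (fun z hz => (hKA hz).2)
  have hsub : reach a y ⊆ reach a x := reach_subset (hKA hy).2
  calc μ K ≤ μ (reach a x \ reach a y) := measure_mono hKy
    _ = ENNReal.ofReal (μ.real (reach a x \ reach a y)) := by
        rw [Measure.real, ENNReal.ofReal_toReal (measure_ne_top _ _)]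
    _ ≤ _ := by
        refine ENNReal.ofReal_le_ofReal ?_
        rw [measureReal_sdiff hsub (measurableSet_reach a y)]
        have : t < μ.real (reach a y) := (hKA hy).1
        linarith

lemma integral_two_mul_exp (c : ℝ) : ∫ t in (0 : ℝ)..c, 2 * Real.exp (2 * t) = Real.exp (2 * c) - 1 := by
  have h : ∀ t, HasDerivAt (fun t => Real.exp (2 * t)) (2 * Real.exp (2 * t)) t := by
    intro t
    have := ((hasDerivAt_id t).const_mul 2).exp
    simpa [mul_comm] using this
  rw [intervalIntegral.integral_eq_sub_of_hasDerivAt (fun t _ => h t)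
    (Continuous.intervalIntegrable (by fun_prop) _ _)]
  simp

lemma integral_tail_mul_exp (L : ℝ) : ∫ t in (0 : ℝ)..L, (L - t) * (2 * Real.exp (2 * t))
    = (Real.exp (2 * L) - 1) / 2 - L := by
  have h : ∀ t, HasDerivAt (fun t => (L - t) * Real.exp (2 * t) + Real.exp (2 * t) / 2)
      ((L - t) * (2 * Real.exp (2 * t))) t := by
    intro t
    have h1 := ((hasDerivAt_id t).const_mul 2).exp
    have h2 := ((hasDerivAt_id t).const_sub L).mul h1
    refine (h2.add (h1.div_const 2)).congr_deriv ?_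
    simp only [id]
    ring
  rw [intervalIntegral.integral_eq_sub_of_hasDerivAt (fun t _ => h t)
    (Continuous.intervalIntegrable (by fun_prop) _ _)]
  simp
  ring

/-- For a measure without atoms the integral would be `(exp (2 L) - 1) / 2`. In general the layer
cake formula and `measure_reach_tail` give the inequality. The factor `1/2` on the right is what
makes the Picard iteration contract. -/
lemma lintegral_exp_reach_le (μ : Measure ℝ) [IsFiniteMeasure μ] (a x : ℝ)
    (hμ : μ (reach a x)ᶜ = 0) :
    ∫⁻ y, ENNReal.ofReal (Real.exp (2 * μ.real (reach a y))) ∂μ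
      ≤ ENNReal.ofReal (Real.exp (2 * μ.real (reach a x)) / 2) := by
  have hm : Measurable fun y => μ.real (reach a y) :=
    (measurable_measure_prodMk_left (measurableSet_reach_prod a)).ennreal_toReal
  set L := μ.real (reach a x) with hL
  have hL0 : 0 ≤ L := measureReal_nonneg
  have hcake := lintegral_comp_eq_lintegral_meas_lt_mul μ (f := fun y => μ.real (reach a y))
    (g := fun t => 2 * Real.exp (2 * t)) (Eventually.of_forall fun y => measureReal_nonneg)
    hm.aemeasurable (fun t _ => Continuous.intervalIntegrable (by fun_prop) _ _)
    (Eventually.of_forall fun t => by positivity)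
  simp only [integral_two_mul_exp] at hcake
  have h1 : ∫⁻ t in Ioi (0 : ℝ), μ {y | t < μ.real (reach a y)} * ENNReal.ofReal (2 * Real.exp (2 * t))
      ≤ ENNReal.ofReal ((Real.exp (2 * L) - 1) / 2 - L) := by
    rw [← integral_tail_mul_exp, intervalIntegral.integral_of_le hL0,
      ofReal_integral_eq_lintegral_ofReal]
    · rw [← lintegral_indicator measurableSet_Ioi, ← lintegral_indicator measurableSet_Ioc]
      refine lintegral_mono fun t => ?_
      by_cases h0 : 0 < t
      · rw [indicator_of_mem (show t ∈ Ioi (0 : ℝ) from h0)]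
        have h := measure_reach_tail μ a x t hμ
        by_cases htL : t ≤ L
        · rw [indicator_of_mem (show t ∈ Ioc 0 L from ⟨h0, htL⟩), ENNReal.ofReal_mul (p := L - t) (by linarith)]
          exact mul_le_mul_left h _
        · rw [ENNReal.ofReal_of_nonpos (by linarith), nonpos_iff_eq_zero] at h
          simp [h]
      · rw [indicator_of_notMem (by simpa using h0)]
        exact zero_le
    · exact (Continuous.integrableOn_Icc (by fun_prop)).mono_set Ioc_subset_Icc_self
    · refine (ae_restrict_iff' measurableSet_Ioc).2 (Eventually.of_forall fun t ht => ?_)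
      have : 0 ≤ L - t := sub_nonneg.2 ht.2
      positivity
  -- The layer cake formula represents functions that vanish at level zero, so the constant one is
  -- split off; it contributes the total mass `L`.
  have h2 : ∀ y, ENNReal.ofReal (Real.exp (2 * μ.real (reach a y)))
      = ENNReal.ofReal (Real.exp (2 * μ.real (reach a y)) - 1) + 1 := by
    intro y
    have : 0 ≤ Real.exp (2 * μ.real (reach a y)) - 1 :=
      sub_nonneg.2 (Real.one_le_exp (by positivity))
    rw [← ENNReal.ofReal_one, ← ENNReal.ofReal_add this zero_le_one]
    congr 1
    ring
  simp only [h2]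
  rw [lintegral_add_right _ measurable_const, lintegral_one, hcake]
  have h3 : μ univ = ENNReal.ofReal L := by
    rw [hL, Measure.real, ENNReal.ofReal_toReal (measure_ne_top _ _),
      ← union_compl_self (reach a x)]
    refine le_antisymm ((measure_union_le _ _).trans_eq ?_) (measure_mono subset_union_left)
    rw [hμ, add_zero]
  rw [h3]
  have h4 : 0 ≤ (Real.exp (2 * L) - 1) / 2 - L := by
    have := Real.add_one_le_exp (2 * L)
    linarith
  refine (add_le_add_left h1 _).trans ?_
  rw [← ENNReal.ofReal_add h4 hL0]
  refine ENNReal.ofReal_le_ofReal ?_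
  linarith

variable {ν : Measure ℝ} {κ : ℝ → ℝ}

/-- The weight exponent. -/
def reachIntegral (ν : Measure ℝ) (κ : ℝ → ℝ) (a x : ℝ) : ℝ := ∫ t in reach a x, κ t ∂ν

lemma integrableOn_reach {E : Type*} [NormedAddCommGroup E] [NormedSpace ℝ E]
    {F : ℝ → E} (hF : LocallyIntegrable F ν) (a x : ℝ) : IntegrableOn F (reach a x) ν :=
  integrableOn_of_isBounded hF (isBounded_reach a x)

lemma stronglyMeasurable_setIntegral_reach [SFinite ν] {E : Type*} [NormedAddCommGroup E]
    [NormedSpace ℝ E] {F : ℝ → E} (hF : StronglyMeasurable F) (a : ℝ) :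
    StronglyMeasurable fun x => ∫ t in reach a x, F t ∂ν := by
  have h : StronglyMeasurable fun p : ℝ × ℝ =>
      {p : ℝ × ℝ | p.2 ∈ reach a p.1}.indicator (fun p => F p.2) p :=
    (hF.comp_measurable measurable_snd).indicator (measurableSet_reach_prod a)
  have h' := h.integral_prod_right' (ν := ν)
  have e : (fun x => ∫ t in reach a x, F t ∂ν) = fun x => ∫ y,
      {p : ℝ × ℝ | p.2 ∈ reach a p.1}.indicator (fun p => F p.2) (x, y) ∂ν := by
    ext x
    rw [← integral_indicator (measurableSet_reach a x)]
    rfl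
  rwa [e]

/-- This is `lintegral_exp_reach_le` for the finite measure `κ ν` on `reach a x`. -/
lemma setIntegral_exp_reach_le [IsLocallyFiniteMeasure ν] (hκ : LocallyIntegrable κ ν)
    (hκm : Measurable κ) (h0 : ∀ x, 0 ≤ κ x) (a x : ℝ) :
    IntegrableOn (fun y => κ y * Real.exp (2 * reachIntegral ν κ a y)) (reach a x) ν ∧
    ∫ y in reach a x, κ y * Real.exp (2 * reachIntegral ν κ a y) ∂ν
      ≤ Real.exp (2 * reachIntegral ν κ a x) / 2 := by
  have hκi := integrableOn_reach hκ a x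
  set μ := (ν.restrict (reach a x)).withDensity fun y => ENNReal.ofReal (κ y) with hμ
  have : IsFiniteMeasure μ := isFiniteMeasure_withDensity_ofReal hκi.2
  have hreal : ∀ y, reach a y ⊆ reach a x → μ.real (reach a y) = reachIntegral ν κ a y := by
    intro y hy
    rw [Measure.real, hμ, withDensity_apply _ (measurableSet_reach a y),
      Measure.restrict_restrict (measurableSet_reach a y), inter_eq_left.2 hy, reachIntegral,
      integral_eq_lintegral_of_nonneg_ae (Eventually.of_forall h0) hκm.aestronglyMeasurable]
  have hc : μ (reach a x)ᶜ = 0 := by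
    rw [hμ, withDensity_apply _ (measurableSet_reach a x).compl,
      Measure.restrict_restrict (measurableSet_reach a x).compl]
    simp
  have key := lintegral_exp_reach_le μ a x hc
  have hem : Measurable fun y => ENNReal.ofReal (Real.exp (2 * μ.real (reach a y))) := by
    have : Measurable fun y => μ.real (reach a y) :=
      (measurable_measure_prodMk_left (measurableSet_reach_prod a)).ennreal_toReal
    fun_prop
  rw [hreal x subset_rfl, hμ, lintegral_withDensity_eq_lintegral_mul _ hκm.ennreal_ofReal hem]
    at key
  have e : ∫⁻ y in reach a x, ENNReal.ofReal (κ y * Real.exp (2 * reachIntegral ν κ a y)) ∂ν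
      ≤ ENNReal.ofReal (Real.exp (2 * reachIntegral ν κ a x) / 2) := by
    refine le_trans (le_of_eq (setLIntegral_congr_fun (measurableSet_reach a x) fun y hy => ?_)) key
    simp only [Pi.mul_apply]
    rw [ENNReal.ofReal_mul (h0 y), hreal y (reach_subset hy)]
  have hm2 : Measurable fun y => κ y * Real.exp (2 * reachIntegral ν κ a y) := by
    have : Measurable (reachIntegral ν κ a) :=
      (stronglyMeasurable_setIntegral_reach hκm.stronglyMeasurable a).measurable
    fun_prop
  have hnn : ∀ y, 0 ≤ κ y * Real.exp (2 * reachIntegral ν κ a y) := fun y =>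
    mul_nonneg (h0 y) (Real.exp_pos _).le
  have hint : IntegrableOn (fun y => κ y * Real.exp (2 * reachIntegral ν κ a y)) (reach a x) ν :=
    (lintegral_ofReal_ne_top_iff_integrable hm2.aestronglyMeasurable
      (Eventually.of_forall hnn)).1 (ne_top_of_le_ne_top ENNReal.ofReal_ne_top e)
  refine ⟨hint, ?_⟩
  rw [integral_eq_lintegral_of_nonneg_ae (Eventually.of_forall hnn) hm2.aestronglyMeasurable]
  exact ENNReal.toReal_le_of_le_ofReal (by positivity) e

/-- The Picard iterates of the Volterra equation. -/
def picard (ν : Measure ℝ) (A : ℝ → Matrix (Fin 2) (Fin 2) ℂ) (a : ℝ) (h : ℝ → Fin 2 → ℂ) :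
    ℕ → ℝ → Fin 2 → ℂ
  | 0 => h
  | n + 1 => fun x => ∫ t in reach a x, A t *ᵥ picard ν A a h n t ∂ν

lemma measurable_mulVec {A : ℝ → Matrix (Fin 2) (Fin 2) ℂ} (hA : ∀ i j, Measurable fun x => A x i j)
    {u : ℝ → Fin 2 → ℂ} (hu : Measurable u) : Measurable fun x => A x *ᵥ u x := by
  refine measurable_pi_iff.2 fun i => ?_
  simp only [Matrix.mulVec, dotProduct]
  exact Finset.measurable_sum _ fun j _ => (hA i j).mul ((measurable_pi_apply j).comp hu)

variable {A : ℝ → Matrix (Fin 2) (Fin 2) ℂ} {a : ℝ} {h : ℝ → Fin 2 → ℂ} {M : ℝ → ℝ}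

lemma measurable_picard [SFinite ν] (hA : ∀ i j, Measurable fun x => A x i j) (hh : Measurable h)
    (n : ℕ) : Measurable (picard ν A a h n) := by
  induction n with
  | zero => exact hh
  | succ n ih =>
    exact (stronglyMeasurable_setIntegral_reach (measurable_mulVec hA ih).stronglyMeasurable a).measurable

/-- In the norm weighted by `exp (2 ∫ κ)` every iteration gains a factor `1/2`, however large `κ`
is. The bound `M` need not be constant, only nondecreasing away from `a`. -/
lemma norm_picard_le [IsLocallyFiniteMeasure ν] (hκ : LocallyIntegrable κ ν) (hκm : Measurable κ)
    (h0 : ∀ x, 0 ≤ κ x) (hAκ : ∀ x v, ‖A x *ᵥ v‖ ≤ κ x * ‖v‖) (hM : ∀ x, ‖h x‖ ≤ M x)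
    (hMm : ∀ x, ∀ y ∈ reach a x, M y ≤ M x) (n : ℕ) (x : ℝ) :
    ‖picard ν A a h n x‖ ≤ M x * (1 / 2) ^ n * Real.exp (2 * reachIntegral ν κ a x) := by
  have hM0 : ∀ x, 0 ≤ M x := fun x => (norm_nonneg _).trans (hM x)
  induction n generalizing x with
  | zero =>
    have : 1 ≤ Real.exp (2 * reachIntegral ν κ a x) := by
      refine Real.one_le_exp (mul_nonneg zero_le_two ?_)
      exact integral_nonneg h0
    simp only [picard, pow_zero, mul_one]
    nlinarith [hM x, hM0 x]
  | succ n ih =>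
    obtain ⟨hi, hle⟩ := setIntegral_exp_reach_le hκ hκm h0 a x
    calc ‖picard ν A a h (n + 1) x‖
        ≤ ∫ t in reach a x, M x * (1 / 2) ^ n * (κ t * Real.exp (2 * reachIntegral ν κ a t)) ∂ν := by
          refine norm_integral_le_of_norm_le (hi.const_mul _) ?_
          refine (ae_restrict_iff' (measurableSet_reach a x)).2 (Eventually.of_forall fun t ht => ?_)
          refine (hAκ t _).trans ?_
          calc κ t * ‖picard ν A a h n t‖
              ≤ κ t * (M t * (1 / 2) ^ n * Real.exp (2 * reachIntegral ν κ a t)) :=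
                mul_le_mul_of_nonneg_left (ih t) (h0 t)
            _ ≤ κ t * (M x * (1 / 2) ^ n * Real.exp (2 * reachIntegral ν κ a t)) := by
                have := hMm x t ht
                have := h0 t
                gcongr
            _ = _ := by ring
      _ ≤ M x * (1 / 2) ^ n * (Real.exp (2 * reachIntegral ν κ a x) / 2) := by
          rw [integral_const_mul]
          have := hM0 x
          gcongr
      _ = _ := by rw [pow_succ]; ring

/-- The solution is the sum of the Picard iterates. Their geometric majorant is integrable after
multiplication by `κ`, so the series may be integrated term by term. -/
lemma exists_volterra [IsLocallyFiniteMeasure ν] (hA : ∀ i j, Measurable fun x => A x i j)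
    (hκ : LocallyIntegrable κ ν) (hκm : Measurable κ)
    (h0 : ∀ x, 0 ≤ κ x) (hAκ : ∀ x v, ‖A x *ᵥ v‖ ≤ κ x * ‖v‖) (hh : Measurable h)
    (hM : ∀ x, ‖h x‖ ≤ M x) (hMm : ∀ x, ∀ y ∈ reach a x, M y ≤ M x) :
    ∃ p : ℝ → Fin 2 → ℂ, Measurable p ∧
      (∀ x, ‖p x‖ ≤ 2 * M x * Real.exp (2 * reachIntegral ν κ a x)) ∧
      ∀ x, IntegrableOn (fun t => A t *ᵥ p t) (reach a x) ν ∧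
        p x = h x + ∫ t in reach a x, A t *ᵥ p t ∂ν := by
  have hM0 : ∀ x, 0 ≤ M x := fun x => (norm_nonneg _).trans (hM x)
  have hb := norm_picard_le hκ hκm h0 hAκ hM hMm
  have hgeo : ∀ x, HasSum (fun n : ℕ => M x * (1 / 2) ^ n * Real.exp (2 * reachIntegral ν κ a x))
      (2 * M x * Real.exp (2 * reachIntegral ν κ a x)) := by
    intro x
    have := (hasSum_geometric_two.mul_left (M x)).mul_right (Real.exp (2 * reachIntegral ν κ a x))
    rwa [mul_comm (M x) 2] at this
  have hs : ∀ x, Summable fun n => picard ν A a h n x := fun x =>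
    Summable.of_norm_bounded (hgeo x).summable fun n => hb n x
  set p : ℝ → Fin 2 → ℂ := fun x => ∑' n, picard ν A a h n x with hp
  have hpm : Measurable p := by
    have hlim := tendsto_pi_nhds.2 fun x => (hs x).hasSum.tendsto_sum_nat
    refine measurable_of_tendsto_metrizable (fun N => ?_) hlim
    exact Finset.measurable_sum _ fun n _ => measurable_picard hA hh n
  have hpb : ∀ x, ‖p x‖ ≤ 2 * M x * Real.exp (2 * reachIntegral ν κ a x) := fun x =>
    tsum_of_norm_bounded (hgeo x) fun n => hb n x
  refine ⟨p, hpm, hpb, fun x => ?_⟩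
  obtain ⟨hi, -⟩ := setIntegral_exp_reach_le hκ hκm h0 a x
  have hterm : ∀ n, ∀ t ∈ reach a x, ‖A t *ᵥ picard ν A a h n t‖
      ≤ M x * (1 / 2) ^ n * (κ t * Real.exp (2 * reachIntegral ν κ a t)) := by
    intro n t ht
    calc ‖A t *ᵥ picard ν A a h n t‖ ≤ κ t * ‖picard ν A a h n t‖ := hAκ t _
      _ ≤ κ t * (M t * (1 / 2) ^ n * Real.exp (2 * reachIntegral ν κ a t)) :=
          mul_le_mul_of_nonneg_left (hb n t) (h0 t)
      _ ≤ κ t * (M x * (1 / 2) ^ n * Real.exp (2 * reachIntegral ν κ a t)) := by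
          have := hMm x t ht
          have := h0 t
          gcongr
      _ = _ := by ring
  have hAp : ∀ t, HasSum (fun n => A t *ᵥ picard ν A a h n t) (A t *ᵥ p t) := fun t =>
    (hs t).hasSum.map (A t).mulVecLin (LinearMap.continuous_of_finiteDimensional _)
  have hsum := hasSum_integral_of_dominated_convergence (μ := ν.restrict (reach a x))
    (F := fun n t => A t *ᵥ picard ν A a h n t) (f := fun t => A t *ᵥ p t)
    (fun n t => M x * (1 / 2) ^ n * (κ t * Real.exp (2 * reachIntegral ν κ a t)))
    (fun n => (measurable_mulVec hA (measurable_picard hA hh n)).aestronglyMeasurable)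
    (fun n => (ae_restrict_iff' (measurableSet_reach a x)).2 (Eventually.of_forall (hterm n)))
    (Eventually.of_forall fun t =>
      ((hasSum_geometric_two.mul_left (M x)).mul_right _).summable)
    (by
      have e : ∀ t, ∑' n : ℕ, M x * (1 / 2) ^ n * (κ t * Real.exp (2 * reachIntegral ν κ a t))
          = M x * 2 * (κ t * Real.exp (2 * reachIntegral ν κ a t)) := fun t =>
        ((hasSum_geometric_two.mul_left (M x)).mul_right _).tsum_eq
      simp only [e]
      exact hi.const_mul _)
    (Eventually.of_forall hAp)
  constructor
  · refine (hi.const_mul (2 * M x)).mono' (measurable_mulVec hA hpm).aestronglyMeasurable ?_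
    refine (ae_restrict_iff' (measurableSet_reach a x)).2 (Eventually.of_forall fun t ht => ?_)
    calc ‖A t *ᵥ p t‖ ≤ κ t * ‖p t‖ := hAκ t _
      _ ≤ κ t * (2 * M t * Real.exp (2 * reachIntegral ν κ a t)) :=
          mul_le_mul_of_nonneg_left (hpb t) (h0 t)
      _ ≤ κ t * (2 * M x * Real.exp (2 * reachIntegral ν κ a t)) := by
          have := hMm x t ht
          have := h0 t
          gcongr
      _ = _ := by ring
  · rw [hp]
    simp only
    rw [(hs x).tsum_eq_zero_add]
    congr 1
    exact hsum.tsum_eq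

/-- A Gronwall argument: inserting a bound into the integral inequality halves it in the weighted
norm. Only `reach a b` and its end point `b` are involved, and no measurability of `d` is needed. -/
lemma eq_zero_of_norm_le_setIntegral [IsLocallyFiniteMeasure ν] (hκ : LocallyIntegrable κ ν)
    (hκm : Measurable κ) (h0 : ∀ x, 0 ≤ κ x) {d : ℝ → Fin 2 → ℂ} {b C : ℝ}
    (hC : ∀ x ∈ reach a b, ‖d x‖ ≤ C)
    (hd : ∀ x, x ∈ reach a b ∨ x = b → ‖d x‖ ≤ ∫ t in reach a x, κ t * ‖d t‖ ∂ν) :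
    d b = 0 := by
  have step : ∀ n : ℕ, (∀ x ∈ reach a b,
      ‖d x‖ ≤ |C| * (1 / 2) ^ n * Real.exp (2 * reachIntegral ν κ a x)) → ∀ x, x ∈ reach a b ∨ x = b →
      ‖d x‖ ≤ |C| * (1 / 2) ^ (n + 1) * Real.exp (2 * reachIntegral ν κ a x) := by
    intro n ih x hx
    have hsub : reach a x ⊆ reach a b := by
      rcases hx with hx | rfl
      · exact reach_subset hx
      · exact subset_rfl
    obtain ⟨hi, hle⟩ := setIntegral_exp_reach_le hκ hκm h0 a x
    calc ‖d x‖ ≤ ∫ t in reach a x, κ t * ‖d t‖ ∂ν := hd x hx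
      _ ≤ ∫ t in reach a x, |C| * (1 / 2) ^ n * (κ t * Real.exp (2 * reachIntegral ν κ a t)) ∂ν := by
          refine integral_mono_of_nonneg (Eventually.of_forall fun t =>
            mul_nonneg (h0 t) (norm_nonneg _)) (hi.const_mul _) ?_
          refine (ae_restrict_iff' (measurableSet_reach a x)).2 (Eventually.of_forall fun t ht => ?_)
          refine (mul_le_mul_of_nonneg_left (ih t (hsub ht)) (h0 t)).trans_eq ?_
          ring
      _ ≤ |C| * (1 / 2) ^ n * (Real.exp (2 * reachIntegral ν κ a x) / 2) := by
          rw [integral_const_mul]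
          gcongr
      _ = _ := by rw [pow_succ]; ring
  have hb : ∀ n : ℕ, ∀ x ∈ reach a b,
      ‖d x‖ ≤ |C| * (1 / 2) ^ n * Real.exp (2 * reachIntegral ν κ a x) := by
    intro n
    induction n with
    | zero =>
      intro x hx
      have : 1 ≤ Real.exp (2 * reachIntegral ν κ a x) :=
        Real.one_le_exp (mul_nonneg zero_le_two (integral_nonneg h0))
      rw [pow_zero, mul_one]
      exact ((hC x hx).trans (le_abs_self C)).trans (le_mul_of_one_le_right (abs_nonneg C) this)
    | succ n ih => exact fun x hx => step n ih x (Or.inl hx)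
  have hlim : Tendsto (fun n : ℕ => |C| * (1 / 2 : ℝ) ^ (n + 1) *
      Real.exp (2 * reachIntegral ν κ a b)) atTop (𝓝 0) := by
    have h1 := (tendsto_pow_atTop_nhds_zero_of_lt_one (r := (1 / 2 : ℝ)) (by norm_num)
      (by norm_num)).comp (tendsto_add_atTop_nat 1)
    simpa using (h1.const_mul |C|).mul_const (Real.exp (2 * reachIntegral ν κ a b))
  have := ge_of_tendsto' hlim fun n => step n (hb n) b (Or.inr rfl)
  exact norm_eq_zero.1 (le_antisymm this (norm_nonneg _))

end Volterra

/-! Linear systems `u' = (A u + g) ν` -/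

section System

/-- The sum of the absolute values of the entries. -/
def entrySum (A : Matrix (Fin 2) (Fin 2) ℂ) : ℝ := ∑ i, ∑ j, ‖A i j‖

lemma entrySum_nonneg (A : Matrix (Fin 2) (Fin 2) ℂ) : 0 ≤ entrySum A :=
  Finset.sum_nonneg fun _ _ => Finset.sum_nonneg fun _ _ => norm_nonneg _

lemma norm_mulVec_le_entrySum (A : Matrix (Fin 2) (Fin 2) ℂ) (v : Fin 2 → ℂ) :
    ‖A *ᵥ v‖ ≤ entrySum A * ‖v‖ := by
  refine (pi_norm_le_iff_of_nonneg (mul_nonneg (entrySum_nonneg A) (norm_nonneg v))).2 fun i => ?_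
  have h1 : ‖(A *ᵥ v) i‖ ≤ ∑ j, ‖A i j‖ * ‖v‖ := by
    refine (norm_sum_le (Finset.univ) fun j => A i j * v j).trans (Finset.sum_le_sum fun j _ => ?_)
    rw [norm_mul]
    exact mul_le_mul_of_nonneg_left (norm_le_pi_norm v j) (norm_nonneg _)
  refine h1.trans ?_
  rw [← Finset.sum_mul]
  refine mul_le_mul_of_nonneg_right ?_ (norm_nonneg v)
  exact Finset.single_le_sum (f := fun i => ∑ j, ‖A i j‖)
    (fun _ _ => Finset.sum_nonneg fun _ _ => norm_nonneg _) (Finset.mem_univ i)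

lemma norm_entry_le_of_mulVec_le {A : Matrix (Fin 2) (Fin 2) ℂ} {C : ℝ}
    (h : ∀ v, ‖A *ᵥ v‖ ≤ C * ‖v‖) (i j : Fin 2) : ‖A i j‖ ≤ C := by
  have h1 := (norm_le_pi_norm (A *ᵥ Pi.single j 1) i).trans (h (Pi.single j 1))
  have h2 : ‖(Pi.single j 1 : Fin 2 → ℂ)‖ = 1 := by rw [Pi.norm_single]; simp
  simpa [h2] using h1

/-- `1 - (s ν{x} / 2) A(x)`; for `s = 1` it maps the value at `x` of a solution of `u' = A u ν` to
its left-hand limit, for `s = -1` to its right-hand limit. -/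
def stepMatrix (ν : Measure ℝ) (A : ℝ → Matrix (Fin 2) (Fin 2) ℂ) (s : ℂ) (x : ℝ) :
    Matrix (Fin 2) (Fin 2) ℂ :=
  1 - (s * ((ν.real {x} / 2 : ℝ) : ℂ)) • A x

/-- Coefficients for which initial value problems are uniquely solvable in both directions. -/
structure IsRegular (ν : Measure ℝ) (A : ℝ → Matrix (Fin 2) (Fin 2) ℂ) : Prop where
  measurable : ∀ i j, Measurable fun x => A x i j
  locallyIntegrable : ∀ i j, LocallyIntegrable (fun x => A x i j) ν
  isUnit_left : ∀ x, IsUnit (stepMatrix ν A 1 x).det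
  isUnit_right : ∀ x, IsUnit (stepMatrix ν A (-1) x).det

/-- Balanced solutions of `u' = (A u + g) ν`. -/
def IsSolution (ν : Measure ℝ) (A : ℝ → Matrix (Fin 2) (Fin 2) ℂ) (g u : ℝ → Fin 2 → ℂ) : Prop :=
  IsBalancedPrimitive ν (fun x => A x *ᵥ u x + g x) u

/-- The sign of `x - a`. -/
def side (a x : ℝ) : ℂ := if a ≤ x then 1 else -1

lemma norm_side (a x : ℝ) : ‖side a x‖ = 1 := by
  unfold side
  split_ifs <;> simp

lemma measurable_side (a : ℝ) : Measurable (side a) :=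
  Measurable.ite measurableSet_Ici measurable_const measurable_const

lemma side_eq_of_mem_reach {a x y : ℝ} (h : y ∈ reach a x) : side a y = side a x := by
  rw [mem_reach] at h
  unfold side
  grind

variable {ν : Measure ℝ} [IsLocallyFiniteMeasure ν] {A : ℝ → Matrix (Fin 2) (Fin 2) ℂ}

lemma measurable_real_singleton (ν : Measure ℝ) [SFinite ν] : Measurable fun x => ν.real {x} := by
  have h : MeasurableSet {p : ℝ × ℝ | p.2 = p.1} := measurableSet_eq_fun measurable_snd measurable_fst
  exact (measurable_measure_prodMk_left (ν := ν) h).ennreal_toReal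

lemma measurable_stepMatrix_inv (hA : ∀ i j, Measurable fun x => A x i j) {s : ℝ → ℂ}
    (hs : Measurable s) (i j : Fin 2) :
    Measurable fun x => (stepMatrix ν A (s x) x)⁻¹ i j := by
  have hm : ∀ i j, Measurable fun x => stepMatrix ν A (s x) x i j := by
    intro i j
    simp only [stepMatrix, Matrix.sub_apply, Matrix.smul_apply, smul_eq_mul]
    exact measurable_const.sub ((hs.mul (Complex.measurable_ofReal.comp
      ((measurable_real_singleton ν).div_const 2))).mul (hA i j))
  have hdet : Measurable fun x => (stepMatrix ν A (s x) x).det := by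
    simp only [Matrix.det_fin_two]
    exact ((hm 0 0).mul (hm 1 1)).sub ((hm 0 1).mul (hm 1 0))
  simp only [Matrix.inv_def, Ring.inverse_eq_inv', Matrix.smul_apply, smul_eq_mul]
  refine hdet.inv.mul ?_
  fin_cases i <;> fin_cases j <;> simp only [Matrix.adjugate_fin_two] <;> simp
  · exact hm 1 1
  · exact hm 0 1
  · exact hm 1 0
  · exact hm 0 0

lemma locallyIntegrable_entrySum (hA : ∀ i j, LocallyIntegrable (fun x => A x i j) ν) :
    LocallyIntegrable (fun x => entrySum (A x)) ν := by
  refine locallyIntegrable_iff.2 fun K hK => ?_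
  exact integrable_finsetSum _ fun i _ => integrable_finsetSum _ fun j _ =>
    ((hA i j).integrableOn_isCompact hK).norm

lemma measurable_entrySum (hA : ∀ i j, Measurable fun x => A x i j) :
    Measurable fun x => entrySum (A x) :=
  Finset.measurable_sum _ fun i _ => Finset.measurable_sum _ fun j _ => (hA i j).norm

/-- Each of these points has mass at least one for the finite measure with density `entrySum (A x)`
on `s`. -/
lemma finite_large_atoms (hA : ∀ i j, LocallyIntegrable (fun x => A x i j) ν) {s : Set ℝ}
    (hs : Bornology.IsBounded s) :
    {x ∈ s | 1 ≤ ν.real {x} * entrySum (A x)}.Finite := by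
  have hi := integrableOn_of_isBounded (locallyIntegrable_entrySum hA) hs
  set μ := (ν.restrict s).withDensity fun x => ENNReal.ofReal (entrySum (A x)) with hμ
  have : IsFiniteMeasure μ := isFiniteMeasure_withDensity_ofReal hi.2
  have hf := Measure.finite_const_le_meas_of_disjoint_iUnion μ (ε := 1) zero_lt_one
    (As := fun x : ℝ => ({x} : Set ℝ)) (fun x => measurableSet_singleton x)
    (fun x y h => by simpa using h) (measure_ne_top μ _)
  refine hf.subset fun x hx => ?_
  have hx1 : ({x} : Set ℝ) ∩ s = {x} := inter_eq_left.2 (singleton_subset_iff.2 hx.1)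
  simp only [mem_ofPred_eq]
  rw [hμ, withDensity_apply _ (measurableSet_singleton x), Measure.restrict_restrict
    (measurableSet_singleton x), hx1, lintegral_singleton, ← ENNReal.ofReal_toReal
    (measure_singleton_lt_top (μ := ν) (a := x)).ne, ← ENNReal.ofReal_mul (entrySum_nonneg _),
    ← ENNReal.ofReal_one]
  refine ENNReal.ofReal_le_ofReal ?_
  rw [mul_comm]
  exact hx.2

/-- Where `ν{x} ‖A x‖ < 1` the matrix differs from the identity by less than `1/2`, so its inverse
is bounded by `2`. The finitely many remaining points contribute a maximum. -/
lemma exists_stepMatrix_inv_bound (hA : ∀ i j, LocallyIntegrable (fun x => A x i j) ν) {s : ℝ → ℂ}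
    (hs : ∀ x, ‖s x‖ = 1) (hu : ∀ x, IsUnit (stepMatrix ν A (s x) x).det) {t : Set ℝ}
    (ht : Bornology.IsBounded t)  :
    ∃ C, 0 ≤ C ∧ ∀ x ∈ t, ∀ v, ‖(stepMatrix ν A (s x) x)⁻¹ *ᵥ v‖ ≤ C * ‖v‖ := by
  have hf := finite_large_atoms hA ht
  obtain ⟨C, hC⟩ := (hf.image fun x => entrySum (stepMatrix ν A (s x) x)⁻¹).bddAbove
  refine ⟨max C 2, le_max_of_le_right zero_le_two, fun x hx v => ?_⟩
  by_cases h : 1 ≤ ν.real {x} * entrySum (A x)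
  · refine (norm_mulVec_le_entrySum _ v).trans ?_
    gcongr
    exact (hC (mem_image_of_mem _ ⟨hx, h⟩)).trans (le_max_left _ _)
  · set w := (stepMatrix ν A (s x) x)⁻¹ *ᵥ v with hw
    have h1 : stepMatrix ν A (s x) x *ᵥ w = v := by
      rw [hw, Matrix.mulVec_mulVec, Matrix.mul_nonsing_inv _ (hu x), Matrix.one_mulVec]
    have h2 : w = v + (s x * ((ν.real {x} / 2 : ℝ) : ℂ)) • (A x *ᵥ w) := by
      rw [← h1, stepMatrix, Matrix.sub_mulVec, Matrix.one_mulVec, Matrix.smul_mulVec]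
      abel
    have h3 : ‖w‖ ≤ ‖v‖ + ν.real {x} / 2 * (entrySum (A x) * ‖w‖) := by
      nth_rw 1 [h2]
      refine (norm_add_le _ _).trans ?_
      rw [norm_smul, norm_mul, hs, one_mul, Complex.norm_real, Real.norm_of_nonneg (by positivity)]
      gcongr
      exact norm_mulVec_le_entrySum _ _
    have h4 : ‖w‖ ≤ 2 * ‖v‖ := by
      have := norm_nonneg w
      push Not at h
      nlinarith
    exact h4.trans (mul_le_mul_of_nonneg_right (le_max_right _ _) (norm_nonneg v))

lemma stepMatrix_mulVec_eq_leftValue {F u : ℝ → Fin 2 → ℂ} {x : ℝ}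
    (h : ν.real {x} • F x = ν.real {x} • (A x *ᵥ u x)) :
    stepMatrix ν A 1 x *ᵥ u x = leftValue ν F u x := by
  have h' : (ν.real {x} / 2) • F x = (ν.real {x} / 2) • (A x *ᵥ u x) := by
    rw [div_eq_inv_mul, mul_smul, h, ← mul_smul]
  rw [leftValue, h', stepMatrix, Matrix.sub_mulVec, Matrix.one_mulVec, Matrix.smul_mulVec, one_mul,
    Complex.coe_smul]

lemma stepMatrix_mulVec_eq_rightValue {F u : ℝ → Fin 2 → ℂ} {x : ℝ}
    (h : ν.real {x} • F x = ν.real {x} • (A x *ᵥ u x)) :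
    stepMatrix ν A (-1) x *ᵥ u x = leftValue ν F u x + ν.real {x} • F x := by
  have h' : (ν.real {x} / 2) • F x = (ν.real {x} / 2) • (A x *ᵥ u x) := by
    rw [div_eq_inv_mul, mul_smul, h, ← mul_smul]
  rw [leftValue, stepMatrix, Matrix.sub_mulVec, Matrix.one_mulVec, Matrix.smul_mulVec, neg_one_mul,
    neg_smul, Complex.coe_smul, ← h']
  module

lemma LocallyIntegrable.mul_bounded {f g : ℝ → ℂ} (hf : LocallyIntegrable f ν) (hg : Measurable g)
    (hb : ∀ K : Set ℝ, IsCompact K → ∃ C, ∀ x ∈ K, ‖g x‖ ≤ C) :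
    LocallyIntegrable (fun x => f x * g x) ν := by
  refine locallyIntegrable_iff.2 fun K hK => ?_
  obtain ⟨C, hC⟩ := hb K hK
  refine (hf.integrableOn_isCompact hK).mul_bdd (c := C) hg.aestronglyMeasurable ?_
  exact (ae_restrict_iff' hK.measurableSet).2 (Eventually.of_forall hC)

lemma locallyIntegrable_pi {f : ℝ → Fin 2 → ℂ} (h : ∀ i, LocallyIntegrable (fun x => f x i) ν) :
    LocallyIntegrable f ν :=
  locallyIntegrable_iff.2 fun _ hK => Integrable.of_eval fun i => (h i).integrableOn_isCompact hK

lemma locallyIntegrable_apply {f : ℝ → Fin 2 → ℂ} (h : LocallyIntegrable f ν) (i : Fin 2) :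
    LocallyIntegrable (fun x => f x i) ν :=
  LocallyIntegrable.clm (ContinuousLinearMap.proj (R := ℝ) (φ := fun _ : Fin 2 => ℂ) i) h

lemma LocallyIntegrable.finset_sum {ι : Type*} {s : Finset ι} {f : ι → ℝ → ℂ}
    (h : ∀ i ∈ s, LocallyIntegrable (f i) ν) : LocallyIntegrable (fun x => ∑ i ∈ s, f i x) ν :=
  locallyIntegrable_iff.2 fun _ hK =>
    integrable_finsetSum _ fun i hi => (h i hi).integrableOn_isCompact hK

lemma locallyIntegrable_mulVec (hA : ∀ i j, LocallyIntegrable (fun x => A x i j) ν)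
    {u : ℝ → Fin 2 → ℂ} (hu : Measurable u)
    (hb : ∀ K : Set ℝ, IsCompact K → ∃ C, ∀ x ∈ K, ‖u x‖ ≤ C) :
    LocallyIntegrable (fun x => A x *ᵥ u x) ν := by
  refine locallyIntegrable_pi fun i => ?_
  simp only [Matrix.mulVec, dotProduct]
  refine LocallyIntegrable.finset_sum fun j _ => ?_
  refine LocallyIntegrable.mul_bounded (hA i j) ((measurable_pi_apply j).comp hu) fun K hK => ?_
  obtain ⟨C, hC⟩ := hb K hK
  exact ⟨C, fun x hx => (norm_le_pi_norm _ _).trans (hC x hx)⟩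

lemma IsRegular.isUnit_side (hA : IsRegular ν A) (a x : ℝ) : IsUnit (stepMatrix ν A (side a x) x).det := by
  unfold side
  split_ifs
  · exact hA.isUnit_left x
  · exact hA.isUnit_right x

/-- The kernel of the Volterra equation for the values on the side of the base point. -/
def volterraKernel (ν : Measure ℝ) (A : ℝ → Matrix (Fin 2) (Fin 2) ℂ) (a x : ℝ) :
    Matrix (Fin 2) (Fin 2) ℂ :=
  side a x • (A x * (stepMatrix ν A (side a x) x)⁻¹)

lemma IsRegular.measurable_volterraKernel (hA : IsRegular ν A) (a : ℝ) (i j : Fin 2) :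
    Measurable fun x => volterraKernel ν A a x i j := by
  simp only [volterraKernel, Matrix.smul_apply, Matrix.mul_apply, smul_eq_mul]
  exact (measurable_side a).mul (Finset.measurable_sum _ fun k _ => (hA.measurable i k).mul
    (measurable_stepMatrix_inv hA.measurable (measurable_side a) k j))

lemma IsRegular.exists_inv_bound (hA : IsRegular ν A) (a : ℝ) {t : Set ℝ}
    (ht : Bornology.IsBounded t)  :
    ∃ C, 0 ≤ C ∧ ∀ x ∈ t, ∀ v, ‖(stepMatrix ν A (side a x) x)⁻¹ *ᵥ v‖ ≤ C * ‖v‖ :=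
  exists_stepMatrix_inv_bound hA.locallyIntegrable (norm_side a) (hA.isUnit_side a) ht

lemma IsRegular.locallyIntegrable_volterraKernel (hA : IsRegular ν A) (a : ℝ) (i j : Fin 2) :
    LocallyIntegrable (fun x => volterraKernel ν A a x i j) ν := by
  simp only [volterraKernel, Matrix.smul_apply, Matrix.mul_apply, smul_eq_mul, Finset.mul_sum]
  refine LocallyIntegrable.finset_sum fun k _ => ?_
  simp only [mul_left_comm (side a _)]
  refine LocallyIntegrable.mul_bounded (hA.locallyIntegrable i k) ((measurable_side a).mul
    (measurable_stepMatrix_inv hA.measurable (measurable_side a) k j)) fun K hK => ?_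
  obtain ⟨C, -, hC⟩ := hA.exists_inv_bound a hK.isBounded
  refine ⟨C, fun x hx => ?_⟩
  rw [norm_mul, norm_side, one_mul]
  exact norm_entry_le_of_mulVec_le (hC x hx) k j

end System

section Existence

variable {ν : Measure ℝ} [IsLocallyFiniteMeasure ν] {A : ℝ → Matrix (Fin 2) (Fin 2) ℂ}

lemma IsBalancedPrimitive.of_leftValue {E : Type*} [NormedAddCommGroup E] [NormedSpace ℝ E]
    {F u : ℝ → E} (hF : LocallyIntegrable F ν) {a : ℝ} {c : E}
    (h : ∀ x, leftValue ν F u x = c + signedIntegral ν F a x) : IsBalancedPrimitive ν F u :=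
  ⟨hF, fun x y hxy => by rw [h, h, add_sub_add_left_eq_sub, signedIntegral_sub hF a hxy]⟩

lemma reach_subset_closedBall {a x R : ℝ} (hx : x ∈ Metric.closedBall a R) :
    reach a x ⊆ Metric.closedBall a R := by
  intro y hy
  rw [mem_reach] at hy
  rw [Real.closedBall_eq_Icc, mem_Icc] at *
  constructor <;> rcases hy with hy | hy <;> linarith [hy.1, hy.2, hx.1, hx.2]

lemma setIntegral_reach_le {f : ℝ → ℝ} (hf : LocallyIntegrable f ν) (h0 : ∀ x, 0 ≤ f x)
    {a x R : ℝ} (hx : x ∈ Metric.closedBall a R) :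
    ∫ t in reach a x, f t ∂ν ≤ ∫ t in Metric.closedBall a R, f t ∂ν :=
  setIntegral_mono_set (integrableOn_of_isBounded hf Metric.isBounded_closedBall)
    (Eventually.of_forall h0) (reach_subset_closedBall hx).eventuallyLE

lemma measureReal_singleton_mul_norm_le {E : Type*} [NormedAddCommGroup E] [NormedSpace ℝ E]
    {f : ℝ → E} (hf : LocallyIntegrable f ν) {x : ℝ} {s : Set ℝ} (hs : Bornology.IsBounded s)
    (hx : x ∈ s) : ν.real {x} * ‖f x‖ ≤ ∫ t in s, ‖f t‖ ∂ν := by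
  have h := setIntegral_mono_set (integrableOn_of_isBounded (locallyIntegrable_norm hf) hs)
    (Eventually.of_forall fun t => norm_nonneg (f t)) (singleton_subset_iff.2 hx).eventuallyLE
  rwa [setIntegral_singleton', smul_eq_mul] at h

lemma side_mul_side (a x : ℝ) : side a x * side a x = 1 := by
  unfold side
  split_ifs <;> simp

/-- Here `p x` is the limit of `u` at `x` from the side of `a`: the left-hand limit for `a ≤ x` and
the right-hand limit for `x < a`. Half of the atom at `x`, with the sign of the side, leads from it
to the balanced value. -/
lemma signedIntegral_eq_setIntegral_reach {F : ℝ → Fin 2 → ℂ} (hF : LocallyIntegrable F ν)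
    {u p : ℝ → Fin 2 → ℂ} {a : ℝ} {c : Fin 2 → ℂ} (x : ℝ)
    (hp : p x = c + side a x • ∫ t in reach a x, F t ∂ν)
    (hu : u x = p x + (side a x * ((ν.real {x} / 2 : ℝ) : ℂ)) • F x) :
    leftValue ν F u x = c + signedIntegral ν F a x := by
  rw [leftValue, hu, hp]
  unfold side signedIntegral reach
  split_ifs with h
  · rw [one_mul, one_smul, Complex.coe_smul]
    abel
  · push Not at h
    rw [setIntegral_Ico_eq_singleton_add hF h, neg_one_mul, neg_one_smul, neg_smul, Complex.coe_smul]
    module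

/-- The unknown is `p`, the limit from the side of `a`. Inverting the step matrix expresses the
balanced value `u x` by `p x` and `g x`, and substituting this into the integral gives a Volterra
equation for `p` over `reach a x`, which does not contain `x`. The bound is uniform in `g` and `c`,
as the solution operators below require. -/
lemma IsRegular.exists_solution_of_measurable (hA : IsRegular ν A) (a R : ℝ) :
    ∃ C, 0 ≤ C ∧ ∀ g : ℝ → Fin 2 → ℂ, Measurable g → LocallyIntegrable g ν → ∀ c : Fin 2 → ℂ,
      ∃ u, IsSolution ν A g u ∧ leftValue ν (fun x => A x *ᵥ u x + g x) u a = c ∧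
        ∀ x ∈ Metric.closedBall a R,
          ‖u x‖ ≤ C * (‖c‖ + ∫ t in Metric.closedBall a R, ‖g t‖ ∂ν) := by
  set N : ℝ → Matrix (Fin 2) (Fin 2) ℂ := fun x => (stepMatrix ν A (side a x) x)⁻¹ with hN
  have hNm : ∀ i j, Measurable fun x => N x i j := fun i j =>
    measurable_stepMatrix_inv hA.measurable (measurable_side a) i j
  have hNb : ∀ R', ∃ C, 0 ≤ C ∧ ∀ x ∈ Metric.closedBall a R', ∀ v, ‖N x *ᵥ v‖ ≤ C * ‖v‖ :=
    fun R' => hA.exists_inv_bound a Metric.isBounded_closedBall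
  set V := volterraKernel ν A a with hV
  have hκ : LocallyIntegrable (fun x => entrySum (V x)) ν :=
    locallyIntegrable_entrySum (hA.locallyIntegrable_volterraKernel a)
  have hκm : Measurable fun x => entrySum (V x) :=
    measurable_entrySum (hA.measurable_volterraKernel a)
  obtain ⟨CN, hCN0, hCN⟩ := hNb R
  refine ⟨CN * (2 * (1 + CN) * Real.exp (2 * ∫ t in Metric.closedBall a R, entrySum (V t) ∂ν) + 1),
    by positivity, fun g hgm hg c => ?_⟩
  set G : ℝ → Fin 2 → ℂ := fun x => side a x • (N x *ᵥ g x) with hG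
  have hGm : Measurable G := (measurable_side a).smul (measurable_mulVec hNm hgm)
  have hGn : ∀ R' C, (∀ x ∈ Metric.closedBall a R', ∀ v, ‖N x *ᵥ v‖ ≤ C * ‖v‖) →
      ∀ x ∈ Metric.closedBall a R', ‖G x‖ ≤ C * ‖g x‖ := by
    intro R' C hC x hx
    rw [hG, norm_smul, norm_side, one_mul]
    exact hC x hx _
  have hGi : LocallyIntegrable G ν := by
    refine locallyIntegrable_iff.2 fun K hK => ?_
    obtain ⟨R', hR'⟩ := hK.isBounded.subset_closedBall a
    obtain ⟨C, -, hC⟩ := hNb R'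
    refine ((hg.integrableOn_isCompact hK).norm.const_mul C).mono' hGm.aestronglyMeasurable ?_
    exact (ae_restrict_iff' hK.measurableSet).2
      (Eventually.of_forall fun x hx => hGn R' C hC x (hR' hx))
  obtain ⟨p, hpm, hpb, hp⟩ := exists_volterra (ν := ν) (κ := fun x => entrySum (V x)) (A := V)
    (a := a) (h := fun x => c + ∫ t in reach a x, G t ∂ν)
    (M := fun x => ‖c‖ + ∫ t in reach a x, ‖G t‖ ∂ν)
    (hA.measurable_volterraKernel a) hκ hκm (fun x => entrySum_nonneg _)
    (fun x v => norm_mulVec_le_entrySum _ v)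
    (measurable_const.add (stronglyMeasurable_setIntegral_reach hGm.stronglyMeasurable a).measurable)
    (fun x => (norm_add_le _ _).trans (by gcongr; exact norm_integral_le_integral_norm _))
    (fun x y hy => add_le_add le_rfl
      (setIntegral_mono_set (integrableOn_reach (locallyIntegrable_norm hGi) a x)
        (Eventually.of_forall fun t => norm_nonneg (G t)) (reach_subset hy).eventuallyLE))
  have hpR : ∀ R', ∀ x ∈ Metric.closedBall a R', ‖p x‖ ≤
      2 * (‖c‖ + ∫ t in Metric.closedBall a R', ‖G t‖ ∂ν) *
        Real.exp (2 * ∫ t in Metric.closedBall a R', entrySum (V t) ∂ν) := by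
    intro R' x hx
    refine (hpb x).trans ?_
    have h1 := setIntegral_reach_le (locallyIntegrable_norm hGi) (fun t => norm_nonneg (G t)) hx
    have h2 := setIntegral_reach_le hκ (fun t => entrySum_nonneg (V t)) hx
    have h3 : 0 ≤ ∫ t in reach a x, ‖G t‖ ∂ν := integral_nonneg fun t => norm_nonneg _
    have h4 : reachIntegral ν (fun x => entrySum (V x)) a x
      ≤ ∫ t in Metric.closedBall a R', entrySum (V t) ∂ν := h2
    gcongr
  set u : ℝ → Fin 2 → ℂ := fun x =>
    N x *ᵥ (p x + (side a x * ((ν.real {x} / 2 : ℝ) : ℂ)) • g x) with hu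
  set F : ℝ → Fin 2 → ℂ := fun x => A x *ᵥ u x + g x with hF
  -- The definition of the inverse step matrix `N`, written as a fixed point identity.
  have hinv : ∀ x v, N x *ᵥ v = v + (side a x * ((ν.real {x} / 2 : ℝ) : ℂ)) • (A x *ᵥ N x *ᵥ v) := by
    intro x v
    have h : stepMatrix ν A (side a x) x *ᵥ N x *ᵥ v = v := by
      rw [Matrix.mulVec_mulVec, Matrix.mul_nonsing_inv _ (hA.isUnit_side a x), Matrix.one_mulVec]
    rw [stepMatrix, Matrix.sub_mulVec, Matrix.one_mulVec, Matrix.smul_mulVec, sub_eq_iff_eq_add] at h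
    exact h
  -- The density `A u + g` in terms of `p`; its integral over `reach a x` is exactly the right-hand
  -- side of the Volterra equation.
  have hsF : ∀ x, side a x • F x = V x *ᵥ p x + G x := by
    intro x
    have e : V x *ᵥ p x = side a x • (A x *ᵥ N x *ᵥ p x) := by
      rw [hV, volterraKernel, Matrix.smul_mulVec, ← Matrix.mulVec_mulVec]
    rw [e, hG, hF, hu]
    simp only
    rw [← smul_add]
    congr 1
    rw [hinv x (g x), Matrix.mulVec_add, Matrix.mulVec_add, Matrix.mulVec_smul, Matrix.mulVec_smul]
    abel
  have hFeq : ∀ x, F x = side a x • (V x *ᵥ p x + G x) := by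
    intro x
    rw [← hsF, smul_smul, side_mul_side, one_smul]
  have hVp : LocallyIntegrable (fun x => V x *ᵥ p x) ν := by
    refine locallyIntegrable_mulVec (hA.locallyIntegrable_volterraKernel a) hpm fun K hK => ?_
    obtain ⟨R', hR'⟩ := hK.isBounded.subset_closedBall a
    exact ⟨_, fun x hx => hpR R' x (hR' hx)⟩
  have hFi : LocallyIntegrable F ν := by
    refine locallyIntegrable_iff.2 fun K hK => ?_
    have h1 : IntegrableOn (fun x => V x *ᵥ p x + G x) K ν :=
      (hVp.integrableOn_isCompact hK).add (hGi.integrableOn_isCompact hK)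
    refine (Integrable.bdd_smul h1 1 (measurable_side a).aestronglyMeasurable
      (Eventually.of_forall fun x => (norm_side a x).le)).congr ?_
    exact Eventually.of_forall fun x => (hFeq x).symm
  have hpF : ∀ x, p x = c + side a x • ∫ t in reach a x, F t ∂ν := by
    intro x
    obtain ⟨hi, hpx⟩ := hp x
    rw [hpx, add_assoc, ← integral_add (integrableOn_reach hGi a x) hi, ← integral_smul]
    congr 1
    refine setIntegral_congr_fun (measurableSet_reach a x) fun t ht => ?_
    rw [← side_eq_of_mem_reach ht, hsF, add_comm]
  have hupF : ∀ x, u x = p x + (side a x * ((ν.real {x} / 2 : ℝ) : ℂ)) • F x := by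
    intro x
    have := hinv x (p x + (side a x * ((ν.real {x} / 2 : ℝ) : ℂ)) • g x)
    change u x = p x + (side a x * ((ν.real {x} / 2 : ℝ) : ℂ)) • g x
      + (side a x * ((ν.real {x} / 2 : ℝ) : ℂ)) • (A x *ᵥ u x) at this
    rw [hF]
    simp only
    rw [smul_add, add_comm (_ • _), ← add_assoc]
    exact this
  have hleft : ∀ x, leftValue ν F u x = c + signedIntegral ν F a x := fun x =>
    signedIntegral_eq_setIntegral_reach hFi x (hpF x) (hupF x)
  refine ⟨u, IsBalancedPrimitive.of_leftValue hFi hleft, ?_, fun x hx => ?_⟩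
  · rw [hleft, signedIntegral_self, add_zero]
  · have hS : ∫ t in Metric.closedBall a R, ‖G t‖ ∂ν
        ≤ CN * ∫ t in Metric.closedBall a R, ‖g t‖ ∂ν := by
      rw [← integral_const_mul]
      refine setIntegral_mono_on
        (integrableOn_of_isBounded (locallyIntegrable_norm hGi) Metric.isBounded_closedBall)
        ((integrableOn_of_isBounded (locallyIntegrable_norm hg)
          Metric.isBounded_closedBall).const_mul _) measurableSet_closedBall fun t ht =>
        hGn R CN hCN t ht
    have hS0 : 0 ≤ ∫ t in Metric.closedBall a R, ‖g t‖ ∂ν := integral_nonneg fun t => norm_nonneg _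
    have h1 := hpR R x hx
    have h2 : ‖(side a x * ((ν.real {x} / 2 : ℝ) : ℂ)) • g x‖
        ≤ ∫ t in Metric.closedBall a R, ‖g t‖ ∂ν := by
      rw [norm_smul, norm_mul, norm_side, one_mul, Complex.norm_real,
        Real.norm_of_nonneg (by positivity)]
      have h3 := measureReal_singleton_mul_norm_le hg Metric.isBounded_closedBall hx
      have h4 : 0 ≤ ν.real {x} * ‖g x‖ := by positivity
      linarith
    set S := ∫ t in Metric.closedBall a R, ‖g t‖ ∂ν
    set X := Real.exp (2 * ∫ t in Metric.closedBall a R, entrySum (V t) ∂ν)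
    have hX : 0 < X := Real.exp_pos _
    calc ‖u x‖ ≤ CN * ‖p x + (side a x * ((ν.real {x} / 2 : ℝ) : ℂ)) • g x‖ := hCN x hx _
      _ ≤ CN * (2 * (‖c‖ + CN * S) * X + S) := by
          gcongr
          refine (norm_add_le _ _).trans (add_le_add (h1.trans ?_) h2)
          gcongr
      _ ≤ CN * (2 * ((1 + CN) * (‖c‖ + S)) * X + (‖c‖ + S)) := by
          have := norm_nonneg c
          gcongr
          · nlinarith [mul_nonneg hCN0 this]
          · linarith
      _ = _ := by ring

lemma IsSolution.congr {g g' u : ℝ → Fin 2 → ℂ} (hu : IsSolution ν A g u) (h : g =ᵐ[ν] g') :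
    IsSolution ν A g' u :=
  IsBalancedPrimitive.congr hu (by filter_upwards [h] with x hx; rw [hx])

lemma IsRegular.exists_solution (hA : IsRegular ν A) (a R : ℝ) :
    ∃ C, 0 ≤ C ∧ ∀ g : ℝ → Fin 2 → ℂ, LocallyIntegrable g ν → ∀ c : Fin 2 → ℂ,
      ∃ u, IsSolution ν A g u ∧ leftValue ν (fun x => A x *ᵥ u x + g x) u a = c ∧
        ∀ x ∈ Metric.closedBall a R,
          ‖u x‖ ≤ C * (‖c‖ + ∫ t in Metric.closedBall a R, ‖g t‖ ∂ν) := by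
  obtain ⟨C, hC0, hC⟩ := hA.exists_solution_of_measurable a R
  refine ⟨C, hC0, fun g hg c => ?_⟩
  have hm : AEStronglyMeasurable g ν := hg.aestronglyMeasurable
  have hae : g =ᵐ[ν] hm.mk g := hm.ae_eq_mk
  obtain ⟨u, hu, hua, hub⟩ := hC (hm.mk g) hm.stronglyMeasurable_mk.measurable (hg.congr hae) c
  refine ⟨u, hu.congr hae.symm, ?_, fun x hx => ?_⟩
  · rw [← hua]
    exact leftValue_congr (by filter_upwards [hae] with x hx; rw [hx]) u a
  · refine (hub x hx).trans_eq ?_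
    congr 2
    refine integral_congr_ae (ae_restrict_of_ae ?_)
    filter_upwards [hae] with t ht
    rw [ht]

/-- Uniqueness for the homogeneous system, on one side of the base point. -/
lemma IsRegular.eq_zero_of_reach (hA : IsRegular ν A) {F u : ℝ → Fin 2 → ℂ}
    (hu : IsBalancedPrimitive ν F u) {a b : ℝ} (ha : leftValue ν F u a = 0)
    (hF : ∀ x ∈ reach a b, ν.real {x} • F x = ν.real {x} • (A x *ᵥ u x))
    (hF' : ∀ᵐ x ∂ν, x ∈ reach a b → F x = A x *ᵥ u x) :
    side a b • (∫ t in reach a b, F t ∂ν) = 0 ∧ ∀ x ∈ reach a b, u x = 0 := by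
  set p : ℝ → Fin 2 → ℂ := fun x => side a x • ∫ t in reach a x, F t ∂ν with hp
  have hup : ∀ x, u x = p x + (side a x * ((ν.real {x} / 2 : ℝ) : ℂ)) • F x := by
    intro x
    have h1 := hu.leftValue_eq a x
    rw [ha, zero_add] at h1
    have h2 : leftValue ν F (fun x => p x + (side a x * ((ν.real {x} / 2 : ℝ) : ℂ)) • F x) x
        = 0 + signedIntegral ν F a x :=
      signedIntegral_eq_setIntegral_reach hu.1 x (p := p) (by rw [zero_add]) rfl
    rw [zero_add, ← h1] at h2
    simp only [leftValue, sub_left_inj] at h2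
    exact h2.symm
  -- The equation at `x` recovers `u x` from `p x`, so `p` solves the homogeneous Volterra equation
  -- and the Gronwall argument applies to it.
  have hinv : ∀ x ∈ reach a b, u x = (stepMatrix ν A (side a x) x)⁻¹ *ᵥ p x := by
    intro x hx
    have h1 : stepMatrix ν A (side a x) x *ᵥ u x = p x := by
      have h := hF x hx
      rw [stepMatrix, Matrix.sub_mulVec, Matrix.one_mulVec, Matrix.smul_mulVec, mul_smul,
        Complex.coe_smul, div_eq_inv_mul, mul_smul, ← h]
      nth_rw 1 [hup x]
      rw [mul_smul, Complex.coe_smul, div_eq_inv_mul, mul_smul]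
      abel
    rw [← h1, Matrix.mulVec_mulVec, Matrix.nonsing_inv_mul _ (hA.isUnit_side a x),
      Matrix.one_mulVec]
  set V := volterraKernel ν A a with hV
  have hκ : LocallyIntegrable (fun x => entrySum (V x)) ν :=
    locallyIntegrable_entrySum (hA.locallyIntegrable_volterraKernel a)
  have hκm : Measurable fun x => entrySum (V x) :=
    measurable_entrySum (hA.measurable_volterraKernel a)
  have hpb : ∀ x, ‖p x‖ ≤ ∫ t in reach a x, ‖F t‖ ∂ν := by
    intro x
    rw [hp, norm_smul, norm_side, one_mul]
    exact norm_integral_le_integral_norm _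
  have hmain : ∀ x, x ∈ reach a b ∨ x = b → p x = 0 := by
    intro x hx
    have hsub : reach a x ⊆ reach a b := by
      rcases hx with hx | rfl
      · exact reach_subset hx
      · exact subset_rfl
    refine eq_zero_of_norm_le_setIntegral (a := a) (C := ∫ t in reach a x, ‖F t‖ ∂ν) hκ hκm
      (fun x => entrySum_nonneg _) (fun y hy => (hpb y).trans ?_) fun y hy => ?_
    · exact setIntegral_mono_set (integrableOn_reach (locallyIntegrable_norm hu.1) a x)
        (Eventually.of_forall fun t => norm_nonneg (F t)) (reach_subset hy).eventuallyLE
    · have hsub' : reach a y ⊆ reach a b := by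
        rcases hy with hy | rfl
        · exact (reach_subset hy).trans hsub
        · exact hsub
      have h1 : p y = ∫ t in reach a y, V t *ᵥ p t ∂ν := by
        change side a y • ∫ t in reach a y, F t ∂ν = _
        rw [← integral_smul]
        refine integral_congr_ae ((ae_restrict_iff' (measurableSet_reach a y)).2 ?_)
        filter_upwards [hF'] with t ht hty
        rw [ht (hsub' hty), hinv t (hsub' hty), hV, volterraKernel, Matrix.smul_mulVec,
          Matrix.mulVec_mulVec, side_eq_of_mem_reach hty]
      rw [h1]
      refine (norm_integral_le_integral_norm _).trans ?_
      refine integral_mono_of_nonneg (Eventually.of_forall fun t => norm_nonneg _) ?_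
        (Eventually.of_forall fun t => norm_mulVec_le_entrySum _ _)
      -- `F` is only almost everywhere measurable, but `p` sees it through integrals, so a
      -- measurable representative yields the same `p`.
      have hpm : AEStronglyMeasurable p (ν.restrict (reach a y)) := by
        have hFm := hu.1.aestronglyMeasurable
        have e : p = fun x => side a x • ∫ t in reach a x, hFm.mk F t ∂ν := by
          rw [hp]
          ext1 x
          congr 1
          exact integral_congr_ae (ae_restrict_of_ae hFm.ae_eq_mk)
        rw [e]
        exact ((measurable_side a).smul (stronglyMeasurable_setIntegral_reach
          hFm.stronglyMeasurable_mk a).measurable).aestronglyMeasurable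
      refine (integrableOn_reach hκ a y).mul_bdd (c := ∫ t in reach a y, ‖F t‖ ∂ν) hpm.norm ?_
      refine (ae_restrict_iff' (measurableSet_reach a y)).2 (Eventually.of_forall fun t ht => ?_)
      rw [norm_norm]
      exact (hpb t).trans (setIntegral_mono_set
        (integrableOn_reach (locallyIntegrable_norm hu.1) a y)
        (Eventually.of_forall fun t => norm_nonneg (F t)) (reach_subset ht).eventuallyLE)
  refine ⟨hmain b (Or.inr rfl), fun x hx => ?_⟩
  rw [hinv x hx, hmain x (Or.inl hx), Matrix.mulVec_zero]

lemma smul_eq_of_ae_imp_eq {E : Type*} [NormedAddCommGroup E] [NormedSpace ℝ E] {F G : ℝ → E}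
    {s : Set ℝ} (h : ∀ᵐ x ∂ν, x ∈ s → F x = G x) {x : ℝ} (hx : x ∈ s) :
    ν.real {x} • F x = ν.real {x} • G x := by
  by_cases h0 : ν {x} = 0
  · simp [Measure.real, h0]
  · congr 1
    by_contra hne
    exact h0 (measure_mono_null (singleton_subset_iff.2
      (show x ∈ {x | x ∈ s → F x = G x}ᶜ from fun h' => hne (h' hx))) h)

lemma IsRegular.eq_zero_forward (hA : IsRegular ν A) {F u : ℝ → Fin 2 → ℂ}
    (hu : IsBalancedPrimitive ν F u) {a b : ℝ} (hab : a ≤ b) (ha : leftValue ν F u a = 0)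
    (hF : ∀ᵐ x ∂ν, x ∈ Ico a b → F x = A x *ᵥ u x) :
    leftValue ν F u b = 0 ∧ ∀ x ∈ Ico a b, u x = 0 := by
  have hr : reach a b = Ico a b := if_pos hab
  obtain ⟨h1, h2⟩ := hA.eq_zero_of_reach (a := a) (b := b) hu ha
    (fun x hx => smul_eq_of_ae_imp_eq hF (hr ▸ hx)) (by rwa [hr])
  rw [hr] at h1 h2
  refine ⟨?_, h2⟩
  rw [hu.leftValue_eq a b, ha, signedIntegral, if_pos hab, zero_add]
  simpa [side, hab] using h1

/-- To the left of `a` the Volterra argument covers the open interval and gives the right-hand limit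
at `b`. The two step matrices at `b` lead from there to the value and on to the left-hand limit. -/
lemma IsRegular.eq_zero_backward (hA : IsRegular ν A) {F u : ℝ → Fin 2 → ℂ}
    (hu : IsBalancedPrimitive ν F u) {a b : ℝ} (hba : b ≤ a) (ha : leftValue ν F u a = 0)
    (hF : ∀ᵐ x ∂ν, x ∈ Ico b a → F x = A x *ᵥ u x) :
    leftValue ν F u b = 0 ∧ ∀ x ∈ Ico b a, u x = 0 := by
  rcases hba.eq_or_lt with rfl | hba
  · exact ⟨ha, by simp⟩
  have hr : reach a b = Ioo b a := if_neg (not_le.2 hba)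
  have hs : Ioo b a ⊆ Ico b a := Ioo_subset_Ico_self
  obtain ⟨h1, h2⟩ := hA.eq_zero_of_reach (a := a) (b := b) hu ha
    (fun x hx => smul_eq_of_ae_imp_eq hF (hs (hr ▸ hx)))
    (by rw [hr]; filter_upwards [hF] with x hx h using hx (hs h))
  rw [hr] at h1 h2
  have h3 : leftValue ν F u b + ν.real {b} • F b = 0 := by
    have h4 := hu.2 b a hba.le
    rw [setIntegral_Ico_eq_singleton_add hu.1 hba, ha] at h4
    have h5 : ∫ t in Ioo b a, F t ∂ν = 0 := by simpa [side, not_le.2 hba] using h1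
    rw [h5, add_zero, zero_sub] at h4
    rw [← h4]
    simp
  have hb : b ∈ Ico b a := ⟨le_rfl, hba⟩
  have hFb := smul_eq_of_ae_imp_eq hF hb
  have hub : u b = 0 := by
    rw [← stepMatrix_mulVec_eq_rightValue hFb] at h3
    have h6 := congrArg (fun v => (stepMatrix ν A (-1) b)⁻¹ *ᵥ v) h3
    rwa [Matrix.mulVec_mulVec, Matrix.nonsing_inv_mul _ (hA.isUnit_right b), Matrix.one_mulVec,
      Matrix.mulVec_zero] at h6
  refine ⟨?_, fun x hx => ?_⟩
  · rw [← stepMatrix_mulVec_eq_leftValue hFb, hub, Matrix.mulVec_zero]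
  · rcases hx.1.eq_or_lt with rfl | h
    · exact hub
    · exact h2 x ⟨h, hx.2⟩

end Existence

/-! Distributions of order zero: uniqueness, densities and periods -/

section OrderZero

/-- The distribution `-r`. -/
def OrderZero.negate (r : OrderZero) : OrderZero :=
  ⟨r.neg, r.pos, r.neg_locallyFinite, r.pos_locallyFinite, r.mutuallySingular.symm⟩

lemma OrderZero.value_negate (r : OrderZero) (E : Set ℝ) : r.negate.value E = -r.value E := by
  simp [OrderZero.value, OrderZero.negate]

/-- On a set that carries `r.pos` and is null for `r.neg`, the values of `r` are those of `r.pos`,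
while the values of `s` are at most those of `s.pos`. -/
lemma OrderZero.pos_le_of_value {r s : OrderZero}
    (h : ∀ E, MeasurableSet E → Bornology.IsBounded E → r.value E = s.value E) {E : Set ℝ}
    (hE : MeasurableSet E) (hb : Bornology.IsBounded E) : r.pos.real E ≤ s.pos.real E := by
  obtain ⟨S, hS, hpS, hnS⟩ := r.mutuallySingular
  have hb' : Bornology.IsBounded (E ∩ Sᶜ) := hb.subset inter_subset_left
  have h1 := h (E ∩ Sᶜ) (hE.inter hS.compl) hb'
  have h2 : r.pos.real E = r.pos.real (E ∩ Sᶜ) := by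
    refine measureReal_congr ?_
    rw [← sdiff_eq]
    exact (sdiff_null_ae_eq_self hpS).symm
  have h3 : r.neg.real (E ∩ Sᶜ) = 0 := by
    rw [Measure.real, measure_mono_null inter_subset_right hnS]
    rfl
  simp only [OrderZero.value, h3, sub_zero] at h1
  rw [h2, h1]
  have h4 : s.pos.real (E ∩ Sᶜ) ≤ s.pos.real E :=
    measureReal_mono inter_subset_left hb.measure_lt_top.ne
  have h5 : 0 ≤ s.neg.real (E ∩ Sᶜ) := measureReal_nonneg
  linarith

lemma OrderZero.pos_eq_of_value {r s : OrderZero}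
    (h : ∀ E, MeasurableSet E → Bornology.IsBounded E → r.value E = s.value E) : r.pos = s.pos := by
  refine Measure.ext_of_Ico _ _ fun a b _ => ?_
  have hb := Metric.isBounded_Ico a b
  have h1 := le_antisymm (OrderZero.pos_le_of_value h measurableSet_Ico hb)
    (OrderZero.pos_le_of_value (fun E hE hb => (h E hE hb).symm) measurableSet_Ico hb)
  exact (ENNReal.toReal_eq_toReal_iff' hb.measure_lt_top.ne hb.measure_lt_top.ne).1 h1

/-- Uniqueness of the Jordan decomposition; the negative parts are compared by passing to `-r` and
`-s`. Through it, periodicity of values becomes periodicity of both parts. -/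
lemma OrderZero.ext_of_value {r s : OrderZero}
    (h : ∀ E, MeasurableSet E → Bornology.IsBounded E → r.value E = s.value E) : r = s := by
  have h1 := OrderZero.pos_eq_of_value h
  have h2 := OrderZero.pos_eq_of_value (r := r.negate) (s := s.negate) fun E hE hb => by
    rw [OrderZero.value_negate, OrderZero.value_negate, h E hE hb]
  cases r
  cases s
  simp only [OrderZero.negate] at h1 h2
  subst h1 h2
  rfl

lemma measurable_shift (ω : ℝ) : Measurable fun x : ℝ => x + ω := measurable_id.add_const ω

lemma measurableEmbedding_shift (ω : ℝ) : MeasurableEmbedding fun x : ℝ => x + ω :=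
  (MeasurableEquiv.addRight ω).measurableEmbedding

lemma isBounded_preimage_shift (ω : ℝ) {E : Set ℝ} (hE : Bornology.IsBounded E) :
    Bornology.IsBounded ((fun x => x + ω) ⁻¹' E) := by
  obtain ⟨R, hR⟩ := hE.subset_closedBall (-0 + ω)
  refine (Metric.isBounded_closedBall (x := (0 : ℝ)) (r := R)).subset fun x hx => ?_
  have := hR hx
  simpa [Real.dist_eq] using this

instance isLocallyFiniteMeasure_map_shift (μ : Measure ℝ) [IsLocallyFiniteMeasure μ] (ω : ℝ) :
    IsLocallyFiniteMeasure (μ.map fun x => x + ω) := by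
  refine ⟨fun x => ⟨Ioo (x - 1) (x + 1), Ioo_mem_nhds (by linarith) (by linarith), ?_⟩⟩
  rw [Measure.map_apply (measurable_shift ω) measurableSet_Ioo]
  exact (isBounded_preimage_shift ω (Metric.isBounded_Ioo _ _)).measure_lt_top

/-- The translate of `r`. -/
def OrderZero.shift (r : OrderZero) (ω : ℝ) : OrderZero where
  pos := r.pos.map fun x => x + ω
  neg := r.neg.map fun x => x + ω
  pos_locallyFinite := inferInstance
  neg_locallyFinite := inferInstance
  mutuallySingular := by
    obtain ⟨S, hS, hpS, hnS⟩ := r.mutuallySingular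
    have hm : MeasurableSet ((fun x : ℝ => x - ω) ⁻¹' S) := (measurable_id.sub_const ω) hS
    refine ⟨(fun x => x - ω) ⁻¹' S, hm, ?_, ?_⟩
    · rw [Measure.map_apply (measurable_shift ω) hm]
      simpa [preimage_preimage] using hpS
    · rw [Measure.map_apply (measurable_shift ω) hm.compl]
      simpa [preimage_preimage] using hnS

lemma OrderZero.IsPeriod.shift_eq {r : OrderZero} {ω : ℝ} (h : r.IsPeriod ω) : r.shift ω = r := by
  refine OrderZero.ext_of_value fun E hE hb => ?_
  rw [← h E hE hb]
  simp only [OrderZero.value, OrderZero.shift, Measure.real]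
  rw [Measure.map_apply (measurable_shift ω) hE, Measure.map_apply (measurable_shift ω) hE]

lemma OrderZero.IsPeriod.map_pos {r : OrderZero} {ω : ℝ} (h : r.IsPeriod ω) :
    (r.pos.map fun x => x + ω) = r.pos :=
  congrArg OrderZero.pos h.shift_eq

lemma OrderZero.IsPeriod.map_neg {r : OrderZero} {ω : ℝ} (h : r.IsPeriod ω) :
    (r.neg.map fun x => x + ω) = r.neg :=
  congrArg OrderZero.neg h.shift_eq

/-- The density of `r` with respect to a dominating measure. -/
def OrderZero.density (r : OrderZero) (ν : Measure ℝ) (x : ℝ) : ℝ :=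
  (r.pos.rnDeriv ν x).toReal - (r.neg.rnDeriv ν x).toReal

variable {r : OrderZero} {ν : Measure ℝ} [IsLocallyFiniteMeasure ν]

lemma OrderZero.measurable_density : Measurable (r.density ν) :=
  (Measure.measurable_rnDeriv _ _).ennreal_toReal.sub
    (Measure.measurable_rnDeriv _ _).ennreal_toReal

lemma OrderZero.integrableOn_density {E : Set ℝ} (hE : Bornology.IsBounded E) :
    IntegrableOn (r.density ν) E ν :=
  (integrableOn_rnDeriv _ _ hE.measure_lt_top.ne).sub
    (integrableOn_rnDeriv _ _ hE.measure_lt_top.ne)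

lemma OrderZero.locallyIntegrable_density : LocallyIntegrable (fun x => (r.density ν x : ℂ)) ν :=
  locallyIntegrable_iff.2 fun _ hK => (OrderZero.integrableOn_density hK.isBounded).ofReal

lemma OrderZero.setIntegral_density (hp : r.pos ≪ ν) (hn : r.neg ≪ ν) {E : Set ℝ}
    (hE : Bornology.IsBounded E) : ∫ x in E, r.density ν x ∂ν = r.value E := by
  simp only [OrderZero.density]
  rw [integral_sub (integrableOn_rnDeriv _ _ hE.measure_lt_top.ne)
    (integrableOn_rnDeriv _ _ hE.measure_lt_top.ne),
    Measure.setIntegral_toReal_rnDeriv hp, Measure.setIntegral_toReal_rnDeriv hn, OrderZero.value]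

lemma OrderZero.value_singleton (hp : r.pos ≪ ν) (hn : r.neg ≪ ν) (x : ℝ) :
    r.value {x} = ν.real {x} * r.density ν x := by
  rw [← OrderZero.setIntegral_density hp hn Bornology.isBounded_singleton, setIntegral_singleton',
    smul_eq_mul]

lemma OrderZero.integral_eq (hp : r.pos ≪ ν) (hn : r.neg ≪ ν) {g : ℝ → ℂ}
    (hgp : Integrable g r.pos) (hgn : Integrable g r.neg) :
    Integrable (fun x => (r.density ν x : ℂ) * g x) ν ∧
      r.integral g = ∫ x, (r.density ν x : ℂ) * g x ∂ν := by
  have i1 := (integrable_rnDeriv_smul_iff hp (f := g)).2 hgp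
  have i2 := (integrable_rnDeriv_smul_iff hn (f := g)).2 hgn
  have e : ∀ x, (r.density ν x : ℂ) * g x
      = (r.pos.rnDeriv ν x).toReal • g x - (r.neg.rnDeriv ν x).toReal • g x := by
    intro x
    simp only [OrderZero.density, Complex.real_smul]
    push_cast
    ring
  simp only [e]
  refine ⟨i1.sub i2, ?_⟩
  rw [integral_sub i1 i2, integral_rnDeriv_smul hp, integral_rnDeriv_smul hn, OrderZero.integral]

/-- Radon–Nikodym derivatives are transported by translation, and translation leaves all measures
involved unchanged. -/
lemma OrderZero.IsPeriod.density_shift {ω : ℝ} (h : r.IsPeriod ω)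
    (hν : (ν.map fun x => x + ω) = ν) : ∀ᵐ x ∂ν, r.density ν (x + ω) = r.density ν x := by
  have h1 := (measurableEmbedding_shift ω).rnDeriv_map r.pos ν
  have h2 := (measurableEmbedding_shift ω).rnDeriv_map r.neg ν
  rw [h.map_pos, hν] at h1
  rw [h.map_neg, hν] at h2
  filter_upwards [h1, h2] with x hx1 hx2
  simp only [OrderZero.density]
  rw [hx1, hx2]

end OrderZero

/-! Translations -/

section Shift

variable {ν : Measure ℝ} {ω : ℝ} {E : Type*} [NormedAddCommGroup E] [NormedSpace ℝ E]

lemma measure_singleton_shift (hν : (ν.map fun x => x + ω) = ν) (x : ℝ) :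
    ν.real {x + ω} = ν.real {x} := by
  nth_rw 1 [← hν]
  rw [Measure.real, Measure.map_apply (measurable_shift ω) (measurableSet_singleton _)]
  have : (fun x => x + ω) ⁻¹' {x + ω} = {x} := by
    ext y
    simp
  rw [this, Measure.real]

lemma leftValue_shift (hν : (ν.map fun x => x + ω) = ν) (F u : ℝ → E) (x : ℝ) :
    leftValue ν (fun x => F (x + ω)) (fun x => u (x + ω)) x = leftValue ν F u (x + ω) := by
  simp only [leftValue, measure_singleton_shift hν]

lemma setIntegral_Ico_shift (hν : (ν.map fun x => x + ω) = ν) (F : ℝ → E) (x y : ℝ) :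
    ∫ t in Ico x y, F (t + ω) ∂ν = ∫ t in Ico (x + ω) (y + ω), F t ∂ν := by
  nth_rw 2 [← hν]
  rw [(measurableEmbedding_shift ω).setIntegral_map]
  simp

lemma IsBalancedPrimitive.shift (hν : (ν.map fun x => x + ω) = ν) {F u : ℝ → E}
    (hu : IsBalancedPrimitive ν F u) :
    IsBalancedPrimitive ν (fun x => F (x + ω)) (fun x => u (x + ω)) := by
  have hF : LocallyIntegrable (fun x => F (x + ω)) ν := by
    refine locallyIntegrable_iff.2 fun K hK => ?_
    obtain ⟨R, hR⟩ := hK.isBounded.subset_closedBall (0 - ω)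
    have h1 : IntegrableOn F (Metric.closedBall 0 R) ν :=
      integrableOn_of_isBounded hu.1 Metric.isBounded_closedBall
    rw [← hν, (measurableEmbedding_shift ω).integrableOn_map_iff] at h1
    refine h1.mono_set fun x hx => ?_
    have := hR hx
    simpa [Real.dist_eq] using this
  refine ⟨hF, fun x y hxy => ?_⟩
  rw [leftValue_shift hν, leftValue_shift hν, hu.2 _ _ (by linarith), setIntegral_Ico_shift hν]

end Shift

/-! The equation in terms of densities with respect to a common measure -/

instance isLocallyFiniteMeasure_add (μ ν : Measure ℝ) [IsLocallyFiniteMeasure μ]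
    [IsLocallyFiniteMeasure ν] : IsLocallyFiniteMeasure (μ + ν) := by
  refine ⟨fun x => ?_⟩
  obtain ⟨s, hs, hs'⟩ := μ.finiteAt_nhds x
  obtain ⟨t, ht, ht'⟩ := ν.finiteAt_nhds x
  refine ⟨s ∩ t, inter_mem hs ht, ?_⟩
  rw [Measure.add_apply]
  exact ENNReal.add_lt_top.2 ⟨(measure_mono inter_subset_left).trans_lt hs',
    (measure_mono inter_subset_right).trans_lt ht'⟩

/-- The total variation of `r`. -/
def OrderZero.total (r : OrderZero) : Measure ℝ := r.pos + r.neg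

instance (r : OrderZero) : IsLocallyFiniteMeasure r.total :=
  inferInstanceAs (IsLocallyFiniteMeasure (r.pos + r.neg))

/-- The sum of the total variations of the entries of a matrix of distributions. -/
def totalSum (r : Matrix (Fin 2) (Fin 2) OrderZero) : Measure ℝ :=
  (r 0 0).total + (r 0 1).total + (r 1 0).total + (r 1 1).total

instance (r : Matrix (Fin 2) (Fin 2) OrderZero) : IsLocallyFiniteMeasure (totalSum r) :=
  inferInstanceAs (IsLocallyFiniteMeasure
    ((r 0 0).total + (r 0 1).total + (r 1 0).total + (r 1 1).total))

/-- A measure dominating all coefficients. -/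
def baseMeasure (q : Matrix (Fin 2) (Fin 2) OrderZero) (w : Weight) : Measure ℝ :=
  totalSum q + totalSum w.entry

instance (q : Matrix (Fin 2) (Fin 2) OrderZero) (w : Weight) :
    IsLocallyFiniteMeasure (baseMeasure q w) :=
  inferInstanceAs (IsLocallyFiniteMeasure (totalSum q + totalSum w.entry))

lemma absolutelyContinuous_totalSum (r : Matrix (Fin 2) (Fin 2) OrderZero) (i j : Fin 2) :
    (r i j).pos ≪ totalSum r ∧ (r i j).neg ≪ totalSum r := by
  constructor <;> intro s hs <;> simp [totalSum, OrderZero.total] at hs <;>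
    fin_cases i <;> fin_cases j <;> simp <;> tauto

lemma map_shift_total {r : OrderZero} {ω : ℝ} (h : r.IsPeriod ω) :
    (r.total.map fun x => x + ω) = r.total := by
  rw [OrderZero.total, Measure.map_add _ _ (measurable_shift ω), h.map_pos, h.map_neg]

lemma map_shift_totalSum {r : Matrix (Fin 2) (Fin 2) OrderZero} {ω : ℝ}
    (h : ∀ i j, (r i j).IsPeriod ω) : ((totalSum r).map fun x => x + ω) = totalSum r := by
  simp only [totalSum, Measure.map_add _ _ (measurable_shift ω), map_shift_total (h _ _)]

section Coefficients

variable (q : Matrix (Fin 2) (Fin 2) OrderZero) (w : Weight)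

lemma absolutelyContinuous_base_q (i j : Fin 2) :
    (q i j).pos ≪ baseMeasure q w ∧ (q i j).neg ≪ baseMeasure q w := by
  have h : totalSum q ≪ baseMeasure q w := Measure.absolutelyContinuous_of_le (Measure.le_add_right le_rfl)
  exact ⟨(absolutelyContinuous_totalSum q i j).1.trans h, (absolutelyContinuous_totalSum q i j).2.trans h⟩

lemma absolutelyContinuous_base_w (i j : Fin 2) :
    (w.entry i j).pos ≪ baseMeasure q w ∧ (w.entry i j).neg ≪ baseMeasure q w := by
  have h : totalSum w.entry ≪ baseMeasure q w :=
    Measure.absolutelyContinuous_of_le (Measure.le_add_left le_rfl)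
  exact ⟨(absolutelyContinuous_totalSum _ i j).1.trans h, (absolutelyContinuous_totalSum _ i j).2.trans h⟩

lemma tr_absolutelyContinuous_base : w.tr ≪ baseMeasure q w := by
  intro s hs
  have h1 := (absolutelyContinuous_base_w q w 0 0).1 hs
  have h2 := (absolutelyContinuous_base_w q w 1 1).1 hs
  simp [Weight.tr, h1, h2]

lemma map_shift_base {ω : ℝ} (hq : ∀ i j, (q i j).IsPeriod ω)
    (hw : ∀ i j, (w.entry i j).IsPeriod ω) :
    ((baseMeasure q w).map fun x => x + ω) = baseMeasure q w := by
  rw [baseMeasure, Measure.map_add _ _ (measurable_shift ω), map_shift_totalSum hq,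
    map_shift_totalSum hw]

/-- The density of `q`. -/
def qMat (x : ℝ) : Matrix (Fin 2) (Fin 2) ℂ :=
  Matrix.of fun i j => ((q i j).density (baseMeasure q w) x : ℂ)

/-- The density of `w`. -/
def wMat (x : ℝ) : Matrix (Fin 2) (Fin 2) ℂ :=
  Matrix.of fun i j => ((w.entry i j).density (baseMeasure q w) x : ℂ)

lemma measurable_qMat (i j : Fin 2) : Measurable fun x => qMat q w x i j :=
  Complex.measurable_ofReal.comp OrderZero.measurable_density

lemma measurable_wMat (i j : Fin 2) : Measurable fun x => wMat q w x i j :=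
  Complex.measurable_ofReal.comp OrderZero.measurable_density

lemma locallyIntegrable_qMat (i j : Fin 2) :
    LocallyIntegrable (fun x => qMat q w x i j) (baseMeasure q w) :=
  OrderZero.locallyIntegrable_density

lemma locallyIntegrable_wMat (i j : Fin 2) :
    LocallyIntegrable (fun x => wMat q w x i j) (baseMeasure q w) :=
  OrderZero.locallyIntegrable_density

lemma jump_q (x : ℝ) : (jump q x).map (fun t : ℝ => (t : ℂ))
    = ((baseMeasure q w).real {x} : ℂ) • qMat q w x := by
  ext i j
  have h := OrderZero.value_singleton (absolutelyContinuous_base_q q w i j).1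
    (absolutelyContinuous_base_q q w i j).2 x
  simp [jump, qMat, h]

lemma jump_w (x : ℝ) : (jump w.entry x).map (fun t : ℝ => (t : ℂ))
    = ((baseMeasure q w).real {x} : ℂ) • wMat q w x := by
  ext i j
  have h := OrderZero.value_singleton (absolutelyContinuous_base_w q w i j).1
    (absolutelyContinuous_base_w q w i j).2 x
  simp [jump, wMat, h]

lemma entry_symm (i j : Fin 2) : w.entry i j = w.entry j i := by
  refine OrderZero.ext_of_value fun E hE hb => ?_
  have := (w.nonneg E hE hb).1.apply j i
  simpa using this

lemma wMat_transpose (x : ℝ) : (wMat q w x)ᵀ = wMat q w x := by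
  ext i j
  simp [wMat, entry_symm w i j]

lemma qMat_transpose (hq : q.IsSymm) (x : ℝ) : (qMat q w x)ᵀ = qMat q w x := by
  ext i j
  have : q j i = q i j := by rw [← Matrix.transpose_apply q, hq.eq]
  simp [qMat, this]

lemma star_wMat (x : ℝ) (i j : Fin 2) : star (wMat q w x i j) = wMat q w x i j := by
  simp [wMat]

lemma star_qMat (x : ℝ) (i j : Fin 2) : star (qMat q w x i j) = qMat q w x i j := by
  simp [qMat]

/-- The chain rule for Radon–Nikodym derivatives, through the intermediate measure `w.tr`. -/
lemma wMat_eq : ∀ᵐ x ∂baseMeasure q w, ∀ i j, wMat q w x i j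
    = ((w.density x i j * (w.tr.rnDeriv (baseMeasure q w) x).toReal : ℝ) : ℂ) := by
  refine ae_all_iff.2 fun i => ae_all_iff.2 fun j => ?_
  have h1 := Measure.rnDeriv_mul_rnDeriv (κ := baseMeasure q w) (w.absolutelyContinuous i j).1
  have h2 := Measure.rnDeriv_mul_rnDeriv (κ := baseMeasure q w) (w.absolutelyContinuous i j).2
  filter_upwards [h1, h2] with x hx1 hx2
  simp only [wMat, Matrix.of_apply, OrderZero.density, ← hx1, ← hx2, Weight.density, Pi.mul_apply,
    ENNReal.toReal_mul]
  push_cast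
  ring

lemma apply_eq (f : ℝ → Fin 2 → ℂ) (φ : ℝ → ℂ) (i : Fin 2) :
    w.apply f φ i = ∫ x, φ x * (wMat q w x *ᵥ f x) i ∂baseMeasure q w := by
  rw [Weight.apply, ← integral_rnDeriv_smul (tr_absolutelyContinuous_base q w)]
  refine integral_congr_ae ?_
  filter_upwards [wMat_eq q w] with x hx
  simp only [Matrix.mulVec, dotProduct, hx, Fin.sum_univ_two, Complex.real_smul]
  push_cast
  ring

/-- The quadratic form of the density of `w`. -/
def wQuad (x : ℝ) (v : Fin 2 → ℂ) : ℝ := (star v ⬝ᵥ wMat q w x *ᵥ v).re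

lemma quad_eq : ∀ᵐ x ∂baseMeasure q w, ∀ f : ℝ → Fin 2 → ℂ, wQuad q w x (f x)
    = (w.tr.rnDeriv (baseMeasure q w) x).toReal * w.quad f x := by
  filter_upwards [wMat_eq q w] with x hx f
  simp [wQuad, Weight.quad, Matrix.mulVec, dotProduct, hx, Fin.sum_univ_two]
  ring

lemma normSq_eq (f : ℝ → Fin 2 → ℂ) (hf : AEStronglyMeasurable f w.tr) :
    w.normSq f = ∫⁻ x, ENNReal.ofReal (wQuad q w x (f x)) ∂baseMeasure q w := by
  set ν := baseMeasure q w
  have h := tr_absolutelyContinuous_base q w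
  have hq : AEMeasurable (fun x => ENNReal.ofReal (w.quad f x)) w.tr :=
    (w.aemeasurable_quad hf).ennreal_ofReal
  have hr := Measure.measurable_rnDeriv w.tr ν
  obtain ⟨g, hg, hmk⟩ := hq
  rw [Weight.normSq, lintegral_congr_ae hmk, ← lintegral_rnDeriv_mul h hg.aemeasurable]
  -- Equality almost everywhere for `w.tr` gives no information where the derivative of `w.tr`
  -- vanishes, but there the factor zero makes the integrands equal.
  rw [EventuallyEq, ← Measure.withDensity_rnDeriv_eq _ _ h, ae_withDensity_iff hr] at hmk
  refine lintegral_congr_ae ?_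
  filter_upwards [quad_eq q w, Measure.rnDeriv_lt_top w.tr ν, hmk] with x hx hlt hxm
  rw [hx, ENNReal.ofReal_mul ENNReal.toReal_nonneg, ENNReal.ofReal_toReal hlt.ne]
  by_cases h0 : w.tr.rnDeriv ν x = 0
  · simp [h0, show w.tr.rnDeriv (baseMeasure q w) x = 0 from h0]
  · rw [hxm h0]

lemma wMat_posSemidef : ∀ᵐ x ∂baseMeasure q w, ∀ a : Fin 2 → ℝ,
    0 ≤ ∑ i, ∑ j, a i * (w.entry i j).density (baseMeasure q w) x * a j := by
  set ν := baseMeasure q w with hν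
  have h1 := w.density_ae_posSemidef
  rw [← Measure.withDensity_rnDeriv_eq _ _ (tr_absolutelyContinuous_base q w),
    ae_withDensity_iff (Measure.measurable_rnDeriv _ _)] at h1
  filter_upwards [h1, wMat_eq q w] with x hx hx2 a
  have e : ∀ i j, (w.entry i j).density ν x = w.density x i j * (w.tr.rnDeriv ν x).toReal := by
    intro i j
    have := hx2 i j
    simp only [wMat, Matrix.of_apply] at this
    exact_mod_cast this
  by_cases h0 : w.tr.rnDeriv ν x = 0
  · simp [e, h0]
  · have h2 := mul_nonneg (hx h0 a) (ENNReal.toReal_nonneg (a := w.tr.rnDeriv ν x))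
    refine h2.trans_eq ?_
    simp only [e, Fin.sum_univ_two]
    ring

lemma wQuad_nonneg : ∀ᵐ x ∂baseMeasure q w, ∀ v, 0 ≤ wQuad q w x v := by
  filter_upwards [wMat_posSemidef q w] with x hx v
  have h1 := hx fun i => (v i).re
  have h2 := hx fun i => (v i).im
  simp [wQuad, Matrix.mulVec, dotProduct, Fin.sum_univ_two, wMat] at h1 h2 ⊢
  linarith

lemma qMat_shift {ω : ℝ} (hq : ∀ i j, (q i j).IsPeriod ω) (hw : ∀ i j, (w.entry i j).IsPeriod ω) :
    ∀ᵐ x ∂baseMeasure q w, qMat q w (x + ω) = qMat q w x := by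
  have h : ∀ᵐ x ∂baseMeasure q w, ∀ i j, (q i j).density (baseMeasure q w) (x + ω)
      = (q i j).density (baseMeasure q w) x :=
    ae_all_iff.2 fun i => ae_all_iff.2 fun j => (hq i j).density_shift (map_shift_base q w hq hw)
  filter_upwards [h] with x hx
  ext i j
  simp [qMat, hx]

lemma wMat_shift {ω : ℝ} (hq : ∀ i j, (q i j).IsPeriod ω) (hw : ∀ i j, (w.entry i j).IsPeriod ω) :
    ∀ᵐ x ∂baseMeasure q w, wMat q w (x + ω) = wMat q w x := by
  have h : ∀ᵐ x ∂baseMeasure q w, ∀ i j, (w.entry i j).density (baseMeasure q w) (x + ω)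
      = (w.entry i j).density (baseMeasure q w) x :=
    ae_all_iff.2 fun i => ae_all_iff.2 fun j => (hw i j).density_shift (map_shift_base q w hq hw)
  filter_upwards [h] with x hx
  ext i j
  simp [wMat, hx]

end Coefficients

section Equation

variable (J : Matrix (Fin 2) (Fin 2) ℝ) (q : Matrix (Fin 2) (Fin 2) OrderZero) (w : Weight)

/-- `J` as a complex matrix. -/
def complexify : Matrix (Fin 2) (Fin 2) ℂ := J.map fun t : ℝ => (t : ℂ)

/-- The coefficient matrix of `u' = J⁻¹ (lam w - q) u`. -/
def sysMatrix (lam : ℂ) (x : ℝ) : Matrix (Fin 2) (Fin 2) ℂ :=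
  (complexify J)⁻¹ * (lam • wMat q w x - qMat q w x)

variable {J q w}

lemma isUnit_det_complexify (hJ : IsUnit J) : IsUnit (complexify J).det := by
  have h1 : (complexify J).det = ((J.det : ℝ) : ℂ) := by
    simp [complexify, Matrix.det_fin_two]
  rw [h1, isUnit_iff_ne_zero, Complex.ofReal_ne_zero]
  exact ((Matrix.isUnit_iff_isUnit_det J).1 hJ).ne_zero

/-- This is how the exceptional set enters: initial value problems can be continued across an atom
in both directions when `B₊` and `B₋` are invertible there. -/
lemma stepMatrix_sysMatrix (hJ : IsUnit J) (s lam : ℂ) (x : ℝ) :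
    stepMatrix (baseMeasure q w) (sysMatrix J q w lam) s x
      = (complexify J)⁻¹ * B J q w s x lam := by
  rw [B, jump_q q w, jump_w q w, stepMatrix, sysMatrix]
  change _ = (complexify J)⁻¹ * (complexify J + _)
  rw [Matrix.mul_add, Matrix.nonsing_inv_mul _ (isUnit_det_complexify hJ), sub_eq_add_neg]
  congr 1
  rw [← Matrix.mul_smul, ← Matrix.mul_neg]
  congr 1
  push_cast
  module

lemma isRegular_sysMatrix (hJ : IsUnit J) {lam : ℂ} (h : lam ∉ exceptionalSet J q w) :
    IsRegular (baseMeasure q w) (sysMatrix J q w lam) := by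
  have hdet : IsUnit ((complexify J)⁻¹).det :=
    (Matrix.isUnit_nonsing_inv_det _ (isUnit_det_complexify hJ))
  have hB : ∀ x, IsUnit (B J q w 1 x lam) ∧ IsUnit (B J q w (-1) x lam) := by
    intro x
    by_contra hx
    exact h ⟨x, by tauto⟩
  have e : ∀ i j, (fun x => sysMatrix J q w lam x i j) = fun x => ∑ k, (complexify J)⁻¹ i k *
      (lam * wMat q w x k j - qMat q w x k j) := by
    intro i j
    ext x
    simp [sysMatrix, Matrix.mul_apply]
  refine ⟨fun i j => ?_, fun i j => ?_, fun x => ?_, fun x => ?_⟩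
  · rw [e]
    exact Finset.measurable_sum _ fun k _ => measurable_const.mul
      ((measurable_const.mul (measurable_wMat q w k j)).sub (measurable_qMat q w k j))
  · rw [e]
    refine LocallyIntegrable.finset_sum fun k _ => locallyIntegrable_iff.2 fun K hK => ?_
    exact ((((locallyIntegrable_wMat q w k j).integrableOn_isCompact hK).const_mul _).sub
      ((locallyIntegrable_qMat q w k j).integrableOn_isCompact hK)).const_mul _
  · rw [stepMatrix_sysMatrix hJ, Matrix.det_mul]
    exact hdet.mul ((Matrix.isUnit_iff_isUnit_det _).1 (hB x).1)
  · rw [stepMatrix_sysMatrix hJ, Matrix.det_mul]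
    exact hdet.mul ((Matrix.isUnit_iff_isUnit_det _).1 (hB x).2)

lemma IsBalancedBV.locallyIntegrable_mulVec {ν : Measure ℝ} [IsLocallyFiniteMeasure ν]
    {A : ℝ → Matrix (Fin 2) (Fin 2) ℂ}
    (hA : ∀ i j, LocallyIntegrable (fun x => A x i j) ν) {u : ℝ → Fin 2 → ℂ} (hu : IsBalancedBV u) :
    LocallyIntegrable (fun x => A x *ᵥ u x) ν := by
  refine Floquet.locallyIntegrable_mulVec hA hu.measurable fun K hK => ?_
  obtain ⟨C, hC⟩ := hu.exists_bound hK
  exact ⟨max C 0, fun x hx => (pi_norm_le_iff_of_nonneg (le_max_right _ _)).2 fun i =>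
    (hC x hx i).trans (le_max_left _ _)⟩

lemma lhs_eq {u : ℝ → Fin 2 → ℂ} (hu : IsBalancedBV u) {φ : ℝ → ℂ} (hφ : IsTest φ) (i : Fin 2) :
    lhs J q u φ i = (complexify J *ᵥ fun j => -∫ x, u x j * deriv φ x) i
      + ∫ x, φ x * (qMat q w x *ᵥ u x) i ∂baseMeasure q w := by
  have h : ∀ j, Integrable (fun x => ((q i j).density (baseMeasure q w) x : ℂ) * (φ x * u x j))
        (baseMeasure q w) ∧ (q i j).integral (fun x => φ x * u x j)
        = ∫ x, ((q i j).density (baseMeasure q w) x : ℂ) * (φ x * u x j) ∂baseMeasure q w :=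
    fun j => OrderZero.integral_eq (absolutelyContinuous_base_q q w i j).1
      (absolutelyContinuous_base_q q w i j).2 (hu.integrable_mul' j hφ.1.continuous hφ.2 _)
      (hu.integrable_mul' j hφ.1.continuous hφ.2 _)
  simp only [lhs, Finset.sum_add_distrib, (h _).2]
  rw [← integral_finsetSum _ fun j _ => (h j).1]
  congr 1
  refine integral_congr_ae (Eventually.of_forall fun x => ?_)
  simp only [Matrix.mulVec, dotProduct, qMat, Matrix.of_apply, Finset.mul_sum]
  refine Finset.sum_congr rfl fun j _ => ?_
  ring

lemma integrable_test_mul {ν : Measure ℝ} [IsLocallyFiniteMeasure ν] {φ : ℝ → ℂ} (hφ : IsTest φ)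
    {f : ℝ → ℂ} (hf : LocallyIntegrable f ν) : Integrable (fun x => φ x * f x) ν :=
  hf.integrable_smul_left_of_hasCompactSupport hφ.1.continuous hφ.2

lemma locallyIntegrable_const_mulVec {ν : Measure ℝ} (M : Matrix (Fin 2) (Fin 2) ℂ)
    {f : ℝ → Fin 2 → ℂ} (hf : LocallyIntegrable f ν) : LocallyIntegrable (fun x => M *ᵥ f x) ν := by
  have := LocallyIntegrable.clm (M.mulVecLin.toContinuousLinearMap.restrictScalars ℝ) hf
  simpa using this

lemma integral_test_mulVec {ν : Measure ℝ} [IsLocallyFiniteMeasure ν] {φ : ℝ → ℂ} (hφ : IsTest φ)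
    (M : Matrix (Fin 2) (Fin 2) ℂ) {f : ℝ → Fin 2 → ℂ} (hf : LocallyIntegrable f ν) (i : Fin 2) :
    ∫ x, φ x * (M *ᵥ f x) i ∂ν = (M *ᵥ fun j => ∫ x, φ x * f x j ∂ν) i := by
  have hi : ∀ j, Integrable (fun x => φ x * f x j) ν := fun j =>
    integrable_test_mul hφ (locallyIntegrable_apply hf j)
  simp only [Matrix.mulVec, dotProduct, Finset.mul_sum]
  simp only [mul_left_comm (φ _)]
  rw [integral_finsetSum _ fun j _ => (hi j).const_mul _]
  refine Finset.sum_congr rfl fun j _ => integral_const_mul _ _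

/-- The distributional equation `J u' + q u = w f` in terms of balanced primitives. -/
lemma solves_iff (hJ : IsUnit J) {u f : ℝ → Fin 2 → ℂ}
    (hf : LocallyIntegrable (fun x => wMat q w x *ᵥ f x) (baseMeasure q w)) :
    (IsBalancedBV u ∧ Solves J q w u f) ↔ IsBalancedPrimitive (baseMeasure q w)
      (fun x => (complexify J)⁻¹ *ᵥ (wMat q w x *ᵥ f x - qMat q w x *ᵥ u x)) u := by
  have hinv := isUnit_det_complexify hJ
  have hloc : ∀ u, IsBalancedBV u → LocallyIntegrable
      (fun x => wMat q w x *ᵥ f x - qMat q w x *ᵥ u x) (baseMeasure q w) := fun u hu =>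
    hf.sub (hu.locallyIntegrable_mulVec (locallyIntegrable_qMat q w))
  have key : ∀ u, IsBalancedBV u → ∀ φ, IsTest φ → ((∀ i, lhs J q u φ i = w.apply f φ i) ↔
      ∀ i, ∫ x, u x i * deriv φ x = -∫ x, φ x *
        ((complexify J)⁻¹ *ᵥ (wMat q w x *ᵥ f x - qMat q w x *ᵥ u x)) i ∂baseMeasure q w) := by
    intro u hu φ hφ
    have hq := hu.locallyIntegrable_mulVec (locallyIntegrable_qMat q w)
    set X : Fin 2 → ℂ := fun j => -∫ x, u x j * deriv φ x with hX
    set Y : Fin 2 → ℂ := fun j => ∫ x, φ x * (wMat q w x *ᵥ f x - qMat q w x *ᵥ u x) j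
      ∂baseMeasure q w with hY
    -- For a fixed test function the equation is the linear system `J X = Y` in `ℂ²`.
    have e1 : (∀ i, lhs J q u φ i = w.apply f φ i) ↔ complexify J *ᵥ X = Y := by
      rw [funext_iff]
      refine forall_congr' fun i => ?_
      rw [lhs_eq (w := w) hu hφ, apply_eq q w, hY]
      simp only [Pi.sub_apply, mul_sub]
      rw [integral_sub (integrable_test_mul hφ (locallyIntegrable_apply hf i))
        (integrable_test_mul hφ (locallyIntegrable_apply hq i)), eq_sub_iff_add_eq]
    have e2 : (∀ i, ∫ x, u x i * deriv φ x = -∫ x, φ x *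
        ((complexify J)⁻¹ *ᵥ (wMat q w x *ᵥ f x - qMat q w x *ᵥ u x)) i ∂baseMeasure q w)
        ↔ X = (complexify J)⁻¹ *ᵥ Y := by
      rw [funext_iff]
      refine forall_congr' fun i => ?_
      rw [integral_test_mulVec hφ _ (hloc u hu), hX, neg_eq_iff_eq_neg]
    rw [e1, e2]
    constructor
    · intro h
      rw [← h, Matrix.mulVec_mulVec, Matrix.nonsing_inv_mul _ hinv, Matrix.one_mulVec]
    · intro h
      rw [h, Matrix.mulVec_mulVec, Matrix.mul_nonsing_inv _ hinv, Matrix.one_mulVec]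
  constructor
  · rintro ⟨hu, hs⟩
    exact hu.isBalancedPrimitive (locallyIntegrable_const_mulVec _ (hloc u hu)) fun φ hφ =>
      (key u hu φ hφ).1 (hs φ hφ)
  · intro hu
    refine ⟨hu.isBalancedBV, fun φ hφ => (key u hu.isBalancedBV φ hφ).2 fun i => ?_⟩
    exact (hu.apply i).integral_mul_deriv hφ

/-- Solutions of `J u' + q u = lam w u`. -/
lemma mem_solutions_iff (hJ : IsUnit J) {lam : ℂ} {u : ℝ → Fin 2 → ℂ} :
    u ∈ solutions J q w lam ↔
      IsBalancedPrimitive (baseMeasure q w) (fun x => sysMatrix J q w lam x *ᵥ u x) u := by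
  have e : ∀ u : ℝ → Fin 2 → ℂ, (fun x => (complexify J)⁻¹ *ᵥ
      (wMat q w x *ᵥ (lam • u) x - qMat q w x *ᵥ u x)) = fun x => sysMatrix J q w lam x *ᵥ u x := by
    intro u
    ext1 x
    rw [sysMatrix, ← Matrix.mulVec_mulVec, Matrix.sub_mulVec, Matrix.smul_mulVec, Pi.smul_apply,
      Matrix.mulVec_smul]
  have hw : IsBalancedBV u → LocallyIntegrable (fun x => wMat q w x *ᵥ (lam • u) x)
      (baseMeasure q w) := fun hu =>
    (hu.smul lam).locallyIntegrable_mulVec (locallyIntegrable_wMat q w)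
  rw [← e]
  constructor
  · intro hu
    exact (solves_iff hJ (hw hu.1)).1 hu
  · intro hu
    exact (solves_iff hJ (hw hu.isBalancedBV)).2 hu

end Equation

/-- `leftValue` refers to the density, whereas `leftLim` depends on the function alone. Initial and
boundary conditions are therefore stated with `leftLim`. -/
lemma IsBalancedPrimitive.leftLim_eq {E : Type*} [NormedAddCommGroup E] [NormedSpace ℝ E]
    [CompleteSpace E] {ν : Measure ℝ} {F u : ℝ → E} (hu : IsBalancedPrimitive ν F u) (x : ℝ) :
    leftLim u x = leftValue ν F u x :=
  leftLim_eq_of_tendsto (hu.tendsto_left x)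

/-! ### Equations with a source, the Lagrange identity and initial value problems. -/

section Source

variable (J : Matrix (Fin 2) (Fin 2) ℝ) (q : Matrix (Fin 2) (Fin 2) OrderZero) (w : Weight)

/-- The density of `u'` when `J u' + q u = h`. -/
def derivDensity (u h : ℝ → Fin 2 → ℂ) (x : ℝ) : Fin 2 → ℂ :=
  (complexify J)⁻¹ *ᵥ (h x - qMat q w x *ᵥ u x)

/-- `u` is a balanced solution of `J u' + q u = h ν`, with `ν` the base measure. -/
def HasSource (u h : ℝ → Fin 2 → ℂ) : Prop :=
  IsBalancedPrimitive (baseMeasure q w) (derivDensity J q w u h) u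

variable {J q w} {u v h k : ℝ → Fin 2 → ℂ}

lemma derivDensity_add : derivDensity J q w (u + v) (h + k)
    = derivDensity J q w u h + derivDensity J q w v k := by
  ext1 x
  simp only [derivDensity, Pi.add_apply, ← Matrix.mulVec_add]
  congr 1
  rw [Matrix.mulVec_add]
  abel

lemma derivDensity_smul (c : ℂ) : derivDensity J q w (c • u) (c • h)
    = c • derivDensity J q w u h := by
  ext1 x
  simp only [derivDensity, Pi.smul_apply, Matrix.mulVec_smul, ← smul_sub]

lemma HasSource.add (hu : HasSource J q w u h) (hv : HasSource J q w v k) :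
    HasSource J q w (u + v) (h + k) := by
  rw [HasSource, derivDensity_add]
  exact IsBalancedPrimitive.add hu hv

lemma HasSource.smul (c : ℂ) (hu : HasSource J q w u h) : HasSource J q w (c • u) (c • h) := by
  rw [HasSource, derivDensity_smul]
  exact IsBalancedPrimitive.smul c hu

lemma HasSource.sub (hu : HasSource J q w u h) (hv : HasSource J q w v k) :
    HasSource J q w (u - v) (h - k) := by
  have := hu.add (hv.smul (-1))
  simpa [sub_eq_add_neg] using this

lemma HasSource.congr (hu : HasSource J q w u h) (e : h =ᵐ[baseMeasure q w] k) :
    HasSource J q w u k :=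
  IsBalancedPrimitive.congr hu (by
    filter_upwards [e] with x hx
    simp only [derivDensity, hx])

lemma HasSource.isBalancedBV (hu : HasSource J q w u h) : IsBalancedBV u :=
  IsBalancedPrimitive.isBalancedBV hu

lemma HasSource.measurable (hu : HasSource J q w u h) : Measurable u :=
  hu.isBalancedBV.measurable

lemma HasSource.leftLim_eq (hu : HasSource J q w u h) (x : ℝ) :
    leftLim u x = leftValue (baseMeasure q w) (derivDensity J q w u h) u x :=
  IsBalancedPrimitive.leftLim_eq hu x

lemma HasSource.tendsto_leftLim (hu : HasSource J q w u h) (x : ℝ) :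
    Tendsto u (𝓝[<] x) (𝓝 (leftLim u x)) :=
  hu.leftLim_eq x ▸ IsBalancedPrimitive.tendsto_left hu x

lemma leftLim_add (hu : HasSource J q w u h) (hv : HasSource J q w v k) (x : ℝ) :
    leftLim (u + v) x = leftLim u x + leftLim v x :=
  leftLim_eq_of_tendsto
    ((hu.tendsto_leftLim x).add (hv.tendsto_leftLim x))

lemma leftLim_smul (hu : HasSource J q w u h) (c : ℂ) (x : ℝ) :
    leftLim (c • u) x = c • leftLim u x :=
  leftLim_eq_of_tendsto ((hu.tendsto_leftLim x).const_smul c)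

lemma leftLim_sub (hu : HasSource J q w u h) (hv : HasSource J q w v k) (x : ℝ) :
    leftLim (u - v) x = leftLim u x - leftLim v x :=
  leftLim_eq_of_tendsto
    ((hu.tendsto_leftLim x).sub (hv.tendsto_leftLim x))

lemma leftLim_star (hu : HasSource J q w u h) (x : ℝ) :
    leftLim (star u) x = star (leftLim u x) :=
  leftLim_eq_of_tendsto ((hu.tendsto_leftLim x).star)

lemma leftLim_shift (ω : ℝ) (hu : HasSource J q w u h) (x : ℝ) :
    leftLim (fun t => u (t + ω)) x = leftLim u (x + ω) := by
  refine leftLim_eq_of_tendsto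
    ((hu.tendsto_leftLim (x + ω)).comp (tendsto_nhdsWithin_iff.2 ⟨?_, ?_⟩))
  · exact ((continuous_id.add continuous_const).tendsto x).mono_left nhdsWithin_le_nhds
  · filter_upwards [self_mem_nhdsWithin] with t ht
    exact add_lt_add_left ht ω

lemma complexify_inv (hJ : IsUnit J) : (complexify J)⁻¹ = complexify J⁻¹ := by
  refine Matrix.inv_eq_right_inv ?_
  have h := Matrix.mul_nonsing_inv J ((Matrix.isUnit_iff_isUnit_det J).1 hJ)
  have := congrArg complexify h
  ext i j
  have := congrFun (congrFun this i) j
  simp only [complexify, Matrix.mul_apply, Matrix.map_apply, Matrix.one_apply] at this ⊢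
  split_ifs at this ⊢ <;> exact_mod_cast this

lemma star_mulVec_of_real {M : Matrix (Fin 2) (Fin 2) ℂ} (hM : ∀ i j, star (M i j) = M i j)
    (v : Fin 2 → ℂ) : star (M *ᵥ v) = M *ᵥ star v := by
  ext i
  simp only [Matrix.mulVec, dotProduct, Pi.star_apply, Fin.sum_univ_two, star_add, star_mul', hM]

lemma star_complexify_inv (hJ : IsUnit J) (i j : Fin 2) :
    star ((complexify J)⁻¹ i j) = (complexify J)⁻¹ i j := by
  rw [complexify_inv hJ]
  simp [complexify]

lemma HasSource.star (hJ : IsUnit J) (hu : HasSource J q w u h) :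
    HasSource J q w (star u) (star h) := by
  have e : derivDensity J q w (Star.star u) (Star.star h)
      = fun x => Star.star (derivDensity J q w u h x) := by
    ext1 x
    simp only [derivDensity, Pi.star_apply]
    rw [star_mulVec_of_real (star_complexify_inv hJ), star_sub,
      star_mulVec_of_real (star_qMat q w x)]
  rw [HasSource, e]
  exact IsBalancedPrimitive.of_apply fun i => (IsBalancedPrimitive.apply hu i).star

lemma HasSource.shift {ω : ℝ} (hq : ∀ i j, (q i j).IsPeriod ω)
    (hw : ∀ i j, (w.entry i j).IsPeriod ω) (hu : HasSource J q w u h) :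
    HasSource J q w (fun x => u (x + ω)) fun x => h (x + ω) := by
  refine (IsBalancedPrimitive.shift (map_shift_base q w hq hw) hu).congr ?_
  filter_upwards [qMat_shift q w hq hw] with x hx
  simp only [derivDensity, hx]

/-- The Lagrange identity. -/
lemma HasSource.lagrange (hJ : IsUnit J) (hJs : Jᵀ = -J) (hq : q.IsSymm)
    (hu : HasSource J q w u h) (hv : HasSource J q w v k) {x y : ℝ} (hxy : x ≤ y) :
    leftLim u y ⬝ᵥ complexify J *ᵥ leftLim v y - leftLim u x ⬝ᵥ complexify J *ᵥ leftLim v x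
      = ∫ t in Ico x y, (u t ⬝ᵥ k t - h t ⬝ᵥ v t) ∂baseMeasure q w := by
  rw [hu.leftLim_eq, hu.leftLim_eq, hv.leftLim_eq, hv.leftLim_eq,
    IsBalancedPrimitive.dotProduct_sub hu hv _ hxy]
  congr 1
  ext1 t
  have hinv := isUnit_det_complexify hJ
  have hs : (complexify J)ᵀ = -complexify J := by
    ext i j
    have := congrFun (congrFun hJs i) j
    simp only [Matrix.transpose_apply, Matrix.neg_apply] at this
    simp [complexify, this]
  -- Skew-symmetry of `J` turns the two derivative terms into a difference, in which the
  -- contributions of the symmetric `q` cancel.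
  have h1 : ∀ a b : Fin 2 → ℂ, ((complexify J)⁻¹ *ᵥ a) ⬝ᵥ complexify J *ᵥ b = -(a ⬝ᵥ b) := by
    intro a b
    rw [Matrix.dotProduct_mulVec, ← Matrix.mulVec_transpose, hs, Matrix.neg_mulVec,
      Matrix.mulVec_mulVec, Matrix.mul_nonsing_inv _ hinv, Matrix.one_mulVec, neg_dotProduct]
  have h2 : (qMat q w t *ᵥ u t) ⬝ᵥ v t = u t ⬝ᵥ qMat q w t *ᵥ v t := by
    rw [Matrix.dotProduct_mulVec, ← Matrix.mulVec_transpose, qMat_transpose q w hq]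
  simp only [derivDensity]
  rw [h1, Matrix.mulVec_mulVec, Matrix.mul_nonsing_inv _ hinv, Matrix.one_mulVec, sub_dotProduct,
    dotProduct_sub, h2]
  ring

/-! Initial value problems -/

lemma sysMatrix_mulVec (lam : ℂ) (x : ℝ) (a b : Fin 2 → ℂ) :
    (complexify J)⁻¹ *ᵥ (lam • wMat q w x *ᵥ a + b - qMat q w x *ᵥ a)
      = sysMatrix J q w lam x *ᵥ a + (complexify J)⁻¹ *ᵥ b := by
  rw [sysMatrix, ← Matrix.mulVec_mulVec, ← Matrix.mulVec_add, Matrix.sub_mulVec,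
    Matrix.smul_mulVec]
  congr 1
  abel

lemma hasSource_iff_isSolution (lam : ℂ) : HasSource J q w u (fun x => lam • wMat q w x *ᵥ u x + h x)
    ↔ IsSolution (baseMeasure q w) (sysMatrix J q w lam) (fun x => (complexify J)⁻¹ *ᵥ h x) u := by
  rw [HasSource, IsSolution]
  have : derivDensity J q w u (fun x => lam • wMat q w x *ᵥ u x + h x)
      = fun x => sysMatrix J q w lam x *ᵥ u x + (complexify J)⁻¹ *ᵥ h x := by
    ext1 x
    rw [derivDensity, sysMatrix_mulVec]
  rw [this]

lemma exists_hasSource (hJ : IsUnit J) {lam : ℂ} (hlam : lam ∉ exceptionalSet J q w) (a R : ℝ) :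
    ∃ C, 0 ≤ C ∧ ∀ h : ℝ → Fin 2 → ℂ, LocallyIntegrable h (baseMeasure q w) → ∀ c : Fin 2 → ℂ,
      ∃ u, HasSource J q w u (fun x => lam • wMat q w x *ᵥ u x + h x) ∧ leftLim u a = c ∧
        ∀ x ∈ Metric.closedBall a R,
          ‖u x‖ ≤ C * (‖c‖ + ∫ t in Metric.closedBall a R, ‖h t‖ ∂baseMeasure q w) := by
  obtain ⟨C, hC, H⟩ := (isRegular_sysMatrix hJ hlam).exists_solution a R
  set D := entrySum (complexify J)⁻¹
  have hD : 0 ≤ D := entrySum_nonneg _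
  refine ⟨C * (1 + D), by positivity, fun h hh c => ?_⟩
  have hh' := locallyIntegrable_const_mulVec (complexify J)⁻¹ hh
  obtain ⟨u, hu, hc, hb⟩ := H _ hh' c
  refine ⟨u, (hasSource_iff_isSolution lam).2 hu, ?_, fun x hx => (hb x hx).trans ?_⟩
  · rw [← hc]
    exact IsBalancedPrimitive.leftLim_eq hu a
  · rw [mul_assoc]
    refine mul_le_mul_of_nonneg_left ?_ hC
    have hi : ∫ t in Metric.closedBall a R, ‖(complexify J)⁻¹ *ᵥ h t‖ ∂baseMeasure q w
        ≤ D * ∫ t in Metric.closedBall a R, ‖h t‖ ∂baseMeasure q w := by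
      rw [← integral_const_mul]
      refine integral_mono (integrableOn_of_isBounded (locallyIntegrable_norm hh')
        Metric.isBounded_closedBall) ((integrableOn_of_isBounded (locallyIntegrable_norm hh)
        Metric.isBounded_closedBall).const_mul D) fun t => norm_mulVec_le_entrySum _ _
    have h0 : 0 ≤ ∫ t in Metric.closedBall a R, ‖h t‖ ∂baseMeasure q w :=
      integral_nonneg fun t => norm_nonneg _
    nlinarith [norm_nonneg c, mul_nonneg hD (norm_nonneg c)]

lemma derivDensity_eq_of_eq {lam : ℂ} {x : ℝ} (e : h x = lam • wMat q w x *ᵥ u x) :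
    derivDensity J q w u h x = sysMatrix J q w lam x *ᵥ u x := by
  have := sysMatrix_mulVec (J := J) (q := q) (w := w) lam x (u x) 0
  rw [add_zero, Matrix.mulVec_zero, add_zero] at this
  rw [derivDensity, e, this]

lemma HasSource.eq_zero_forward (hJ : IsUnit J) {lam : ℂ} (hlam : lam ∉ exceptionalSet J q w)
    (hu : HasSource J q w u h) {a b : ℝ} (hab : a ≤ b) (ha : leftLim u a = 0)
    (hh : ∀ᵐ x ∂baseMeasure q w, x ∈ Ico a b → h x = lam • wMat q w x *ᵥ u x) :
    leftLim u b = 0 ∧ ∀ x ∈ Ico a b, u x = 0 := by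
  rw [hu.leftLim_eq] at ha ⊢
  refine (isRegular_sysMatrix hJ hlam).eq_zero_forward hu hab ha ?_
  filter_upwards [hh] with x hx hm
  exact derivDensity_eq_of_eq (hx hm)

lemma HasSource.eq_zero_backward (hJ : IsUnit J) {lam : ℂ} (hlam : lam ∉ exceptionalSet J q w)
    (hu : HasSource J q w u h) {a b : ℝ} (hba : b ≤ a) (ha : leftLim u a = 0)
    (hh : ∀ᵐ x ∂baseMeasure q w, x ∈ Ico b a → h x = lam • wMat q w x *ᵥ u x) :
    leftLim u b = 0 ∧ ∀ x ∈ Ico b a, u x = 0 := by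
  rw [hu.leftLim_eq] at ha ⊢
  refine (isRegular_sysMatrix hJ hlam).eq_zero_backward hu hba ha ?_
  filter_upwards [hh] with x hx hm
  exact derivDensity_eq_of_eq (hx hm)

lemma HasSource.eq_zero (hJ : IsUnit J) {lam : ℂ} (hlam : lam ∉ exceptionalSet J q w)
    (hu : HasSource J q w u h) {a : ℝ} (ha : leftLim u a = 0)
    (hh : ∀ᵐ x ∂baseMeasure q w, h x = lam • wMat q w x *ᵥ u x) : u = 0 := by
  ext1 x
  rcases le_or_gt a x with hx | hx
  · exact (hu.eq_zero_forward hJ hlam (hx.trans (lt_add_one x).le) ha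
      (by filter_upwards [hh] with t ht _ using ht)).2 x ⟨hx, lt_add_one x⟩
  · exact (hu.eq_zero_backward hJ hlam hx.le ha
      (by filter_upwards [hh] with t ht _ using ht)).2 x ⟨le_rfl, hx⟩

lemma mem_solutions_iff_hasSource (hJ : IsUnit J) {lam : ℂ} :
    u ∈ solutions J q w lam ↔ HasSource J q w u fun x => lam • wMat q w x *ᵥ u x := by
  rw [mem_solutions_iff hJ, HasSource]
  have : derivDensity J q w u (fun x => lam • wMat q w x *ᵥ u x)
      = fun x => sysMatrix J q w lam x *ᵥ u x := by
    ext1 x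
    exact derivDensity_eq_of_eq rfl
  rw [this]

/-- Where `u` vanishes the density of `u'` vanishes as well, so there is no jump and the left-hand
limit is zero too. -/
lemma eq_zero_of_apply_eq_zero (hJ : IsUnit J) {lam : ℂ} (hlam : lam ∉ exceptionalSet J q w)
    (hu : u ∈ solutions J q w lam) {x : ℝ} (hx : u x = 0) : u = 0 := by
  have h := (mem_solutions_iff_hasSource hJ).1 hu
  refine h.eq_zero hJ hlam (a := x) ?_ (Eventually.of_forall fun _ => rfl)
  rw [h.leftLim_eq, leftValue, derivDensity_eq_of_eq rfl, hx]
  simp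

end Source

/-! ### The monodromy map, its determinant and the discriminant. -/

section Monodromy

variable {J : Matrix (Fin 2) (Fin 2) ℝ} {q : Matrix (Fin 2) (Fin 2) OrderZero} {w : Weight}
  {ω : ℝ} {lam : ℂ}

/-- Translation by `ω` of functions on the line. -/
def translate (ω : ℝ) : (ℝ → Fin 2 → ℂ) →ₗ[ℂ] (ℝ → Fin 2 → ℂ) :=
  LinearMap.funLeft ℂ (Fin 2 → ℂ) fun x => x + ω

lemma translate_apply (u : ℝ → Fin 2 → ℂ) (x : ℝ) : translate ω u x = u (x + ω) := rfl

lemma translate_mem_solutions (hJ : IsUnit J) (hq : ∀ i j, (q i j).IsPeriod ω)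
    (hw : ∀ i j, (w.entry i j).IsPeriod ω) {u : ℝ → Fin 2 → ℂ} (hu : u ∈ solutions J q w lam) :
    translate ω u ∈ solutions J q w lam := by
  rw [mem_solutions_iff_hasSource hJ] at hu ⊢
  refine (hu.shift hq hw).congr ?_
  filter_upwards [wMat_shift q w hq hw] with x hx
  rw [hx]
  rfl

/-- Translation by a period of the solutions. -/
def monodromyMap (hJ : IsUnit J) (hq : ∀ i j, (q i j).IsPeriod ω)
    (hw : ∀ i j, (w.entry i j).IsPeriod ω) (lam : ℂ) :
    solutions J q w lam →ₗ[ℂ] solutions J q w lam :=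
  (translate ω).restrict fun _ hu => translate_mem_solutions hJ hq hw hu

/-- The left-hand limit at `a` of solutions. -/
def leftLimMap (hJ : IsUnit J) (lam : ℂ) (a : ℝ) : solutions J q w lam →ₗ[ℂ] (Fin 2 → ℂ) where
  toFun u := leftLim (u : ℝ → Fin 2 → ℂ) a
  map_add' u v := leftLim_add ((mem_solutions_iff_hasSource hJ).1 u.2)
    ((mem_solutions_iff_hasSource hJ).1 v.2) a
  map_smul' c u := leftLim_smul ((mem_solutions_iff_hasSource hJ).1 u.2) c a

lemma leftLimMap_bijective (hJ : IsUnit J) (hlam : lam ∉ exceptionalSet J q w) (a : ℝ) :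
    Function.Bijective (leftLimMap (q := q) (w := w) hJ lam a) := by
  constructor
  · rw [← LinearMap.ker_eq_bot, LinearMap.ker_eq_bot']
    intro u hu
    exact Subtype.ext (((mem_solutions_iff_hasSource hJ).1 u.2).eq_zero hJ hlam hu
      (Eventually.of_forall fun _ => rfl))
  · intro c
    obtain ⟨C, -, H⟩ := exists_hasSource (q := q) (w := w) hJ hlam a 0
    obtain ⟨u, hu, hc, -⟩ := H 0 locallyIntegrable_zero c
    refine ⟨⟨u, (mem_solutions_iff_hasSource hJ).2 ?_⟩, hc⟩
    simpa only [Pi.zero_apply, add_zero] using hu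

/-- Solutions are determined by their left-hand limit at a point. -/
def leftLimEquiv (hJ : IsUnit J) (hlam : lam ∉ exceptionalSet J q w) (a : ℝ) :
    solutions J q w lam ≃ₗ[ℂ] (Fin 2 → ℂ) :=
  LinearEquiv.ofBijective (leftLimMap hJ lam a) (leftLimMap_bijective hJ hlam a)

lemma leftLimEquiv_apply (hJ : IsUnit J) (hlam : lam ∉ exceptionalSet J q w) (a : ℝ)
    (u : solutions J q w lam) : leftLimEquiv hJ hlam a u = leftLim (u : ℝ → Fin 2 → ℂ) a := rfl

/-- The fundamental system with the identity matrix as left-hand limit at `a`. -/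
def standardBasis (hJ : IsUnit J) (hlam : lam ∉ exceptionalSet J q w) (a : ℝ) :
    Module.Basis (Fin 2) ℂ (solutions J q w lam) :=
  (Pi.basisFun ℂ (Fin 2)).map (leftLimEquiv hJ hlam a).symm

lemma standardBasis_repr (hJ : IsUnit J) (hlam : lam ∉ exceptionalSet J q w) (a : ℝ)
    (u : solutions J q w lam) (i : Fin 2) :
    (standardBasis hJ hlam a).repr u i = leftLim (u : ℝ → Fin 2 → ℂ) a i := rfl

lemma leftLim_standardBasis (hJ : IsUnit J) (hlam : lam ∉ exceptionalSet J q w) (a : ℝ)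
    (i : Fin 2) :
    leftLim (standardBasis hJ hlam a i : ℝ → Fin 2 → ℂ) a = Pi.single i 1 := by
  rw [← leftLimEquiv_apply hJ hlam, standardBasis, Module.Basis.map_apply,
    LinearEquiv.apply_symm_apply, Pi.basisFun_apply]

/-- Read column by column, the relation says that `M` represents translation by the period in the
basis `b`. Hence all monodromy matrices are similar and the choice in `discriminant` does not
matter. -/
lemma isMonodromyMatrix_iff (hJ : IsUnit J) (hq : ∀ i j, (q i j).IsPeriod ω)
    (hw : ∀ i j, (w.entry i j).IsPeriod ω) (M : Matrix (Fin 2) (Fin 2) ℂ) :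
    IsMonodromyMatrix J q w ω lam M ↔ ∃ b : Module.Basis (Fin 2) ℂ (solutions J q w lam),
      LinearMap.toMatrix b b (monodromyMap hJ hq hw lam) = M := by
  refine exists_congr fun b => ?_
  have e : (∀ x, fundamentalMatrix b (x + ω) = fundamentalMatrix b x * M) ↔
      ∀ k, monodromyMap hJ hq hw lam (b k) = ∑ j, M j k • b j := by
    constructor
    · intro h k
      refine Subtype.ext (funext fun x => funext fun i => ?_)
      have := congrFun (congrFun (h x) i) k
      simp only [fundamentalMatrix, Matrix.mul_apply, Matrix.of_apply] at this
      simp only [Submodule.coe_sum, Submodule.coe_smul, Finset.sum_apply, Pi.smul_apply,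
        smul_eq_mul]
      simp only [mul_comm (M _ _)]
      exact this
    · intro h x
      ext i k
      have := congrFun (congrFun (congrArg Subtype.val (h k)) x) i
      simp only [Submodule.coe_sum, Submodule.coe_smul, Finset.sum_apply, Pi.smul_apply,
        smul_eq_mul] at this
      simp only [mul_comm (M _ _)] at this
      simp only [fundamentalMatrix, Matrix.mul_apply, Matrix.of_apply]
      exact this
  rw [e]
  constructor
  · intro h
    ext i k
    rw [LinearMap.toMatrix_apply, h]
    fin_cases i <;> simp
  · rintro rfl k
    simp only [LinearMap.toMatrix_apply]
    exact (b.sum_repr _).symm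

lemma discriminant_eq_trace (hJ : IsUnit J) (hq : ∀ i j, (q i j).IsPeriod ω)
    (hw : ∀ i j, (w.entry i j).IsPeriod ω) (hlam : lam ∉ exceptionalSet J q w) :
    discriminant J q w ω lam = LinearMap.trace ℂ _ (monodromyMap hJ hq hw lam) := by
  have h : ∃ M, IsMonodromyMatrix J q w ω lam M :=
    ⟨_, (isMonodromyMatrix_iff hJ hq hw _).2 ⟨standardBasis hJ hlam 0, rfl⟩⟩
  rw [discriminant, dif_pos h]
  obtain ⟨b, hb⟩ := (isMonodromyMatrix_iff hJ hq hw _).1 h.choose_spec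
  rw [← hb, LinearMap.trace_eq_matrix_trace ℂ b]

/-- In dimension two a skew-symmetric form is a multiple of the determinant. -/
lemma dotProduct_skew_mulVec (hJs : Jᵀ = -J) (a b : Fin 2 → ℂ) :
    a ⬝ᵥ complexify J *ᵥ b = (J 0 1 : ℂ) * (a 0 * b 1 - a 1 * b 0) := by
  have h : ∀ i j, J j i = -J i j := fun i j => congrFun (congrFun hJs i) j
  have h0 : J 0 0 = 0 := by linarith [h 0 0]
  have h1 : J 1 1 = 0 := by linarith [h 1 1]
  simp [complexify, dotProduct, Matrix.mulVec, Fin.sum_univ_two, h0, h1, h 0 1]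
  ring

lemma skew_entry_ne_zero (hJ : IsUnit J) (hJs : Jᵀ = -J) : (J 0 1 : ℂ) ≠ 0 := by
  have h : ∀ i j, J j i = -J i j := fun i j => congrFun (congrFun hJs i) j
  have h0 : J 0 0 = 0 := by linarith [h 0 0]
  have := ((Matrix.isUnit_iff_isUnit_det J).1 hJ).ne_zero
  rw [Matrix.det_fin_two, h0] at this
  intro h1
  exact this (by simp [Complex.ofReal_eq_zero.1 h1])

lemma wMat_mulVec_dotProduct (x : ℝ) (a b : Fin 2 → ℂ) :
    (wMat q w x *ᵥ a) ⬝ᵥ b = a ⬝ᵥ wMat q w x *ᵥ b := by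
  rw [Matrix.dotProduct_mulVec, ← Matrix.mulVec_transpose, wMat_transpose q w]

/-- Constancy of the Wronskian. -/
lemma wronskian_eq (hJ : IsUnit J) (hJs : Jᵀ = -J) (hqs : q.IsSymm)
    {u v : ℝ → Fin 2 → ℂ} (hu : u ∈ solutions J q w lam) (hv : v ∈ solutions J q w lam) {x y : ℝ}
    (hxy : x ≤ y) : leftLim u y ⬝ᵥ complexify J *ᵥ leftLim v y
      = leftLim u x ⬝ᵥ complexify J *ᵥ leftLim v x := by
  have h := ((mem_solutions_iff_hasSource hJ).1 hu).lagrange hJ hJs hqs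
    ((mem_solutions_iff_hasSource hJ).1 hv) hxy
  rw [← sub_eq_zero, h]
  refine integral_eq_zero_of_ae (Eventually.of_forall fun t => ?_)
  simp only [dotProduct_smul, smul_dotProduct, wMat_mulVec_dotProduct, sub_self, Pi.zero_apply]

/-- In the basis normalised to the identity at `0`, the monodromy matrix consists of the left-hand
limits at `ω`. Up to the factor `J 0 1` its determinant is a Wronskian, which does not change from
`0` to `ω`. -/
lemma det_monodromyMap (hJ : IsUnit J) (hJs : Jᵀ = -J) (hqs : q.IsSymm) (hω : 0 < ω)
    (hq : ∀ i j, (q i j).IsPeriod ω)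
    (hw : ∀ i j, (w.entry i j).IsPeriod ω) (hlam : lam ∉ exceptionalSet J q w) :
    LinearMap.det (monodromyMap hJ hq hw lam) = 1 := by
  set b := standardBasis hJ hlam 0 with hb
  rw [← LinearMap.det_toMatrix b, Matrix.det_fin_two]
  have e : ∀ i k, LinearMap.toMatrix b b (monodromyMap hJ hq hw lam) i k
      = leftLim (b k : ℝ → Fin 2 → ℂ) ω i := by
    intro i k
    rw [LinearMap.toMatrix_apply, hb, standardBasis_repr]
    have := leftLim_shift ω ((mem_solutions_iff_hasSource hJ).1 (b k).2) 0
    rw [zero_add] at this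
    exact congrFun this i
  have h := wronskian_eq hJ hJs hqs (b 0).2 (b 1).2 hω.le
  rw [dotProduct_skew_mulVec hJs, dotProduct_skew_mulVec hJs, hb, leftLim_standardBasis,
    leftLim_standardBasis, ← hb] at h
  have := mul_left_cancel₀ (skew_entry_ne_zero hJ hJs) h
  simp only [e]
  simp at this
  linear_combination this

/-- The Cayley–Hamilton identity for the monodromy. -/
lemma solution_recurrence (hJ : IsUnit J) (hJs : Jᵀ = -J) (hqs : q.IsSymm) (hω : 0 < ω)
    (hq : ∀ i j, (q i j).IsPeriod ω)
    (hw : ∀ i j, (w.entry i j).IsPeriod ω) (hlam : lam ∉ exceptionalSet J q w)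
    {u : ℝ → Fin 2 → ℂ} (hu : u ∈ solutions J q w lam) (x : ℝ) :
    u (x + ω + ω) + u x = discriminant J q w ω lam • u (x + ω) := by
  set b := standardBasis hJ hlam 0 with hb
  have : Module.Finite ℂ (solutions J q w lam) := Module.Finite.of_basis b
  set T := monodromyMap hJ hq hw lam with hT
  have h := LinearMap.aeval_self_charpoly T
  rw [← LinearMap.charpoly_toMatrix T b, Matrix.charpoly_fin_two,
    ← LinearMap.trace_eq_matrix_trace ℂ b, LinearMap.det_toMatrix,
    det_monodromyMap hJ hJs hqs hω hq hw hlam, hT, ← discriminant_eq_trace hJ hq hw hlam] at h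
  have h2 := congrFun (congrArg Subtype.val (LinearMap.congr_fun h ⟨u, hu⟩)) x
  simp [pow_two] at h2
  change u (x + ω + ω) - discriminant J q w ω lam • u (x + ω) + u x = 0 at h2
  rw [← sub_eq_zero, ← h2]
  abel

lemma discriminant_of_multiplier (hJ : IsUnit J) (hJs : Jᵀ = -J) (hqs : q.IsSymm) (hω : 0 < ω)
    (hq : ∀ i j, (q i j).IsPeriod ω)
    (hw : ∀ i j, (w.entry i j).IsPeriod ω) (hlam : lam ∉ exceptionalSet J q w)
    {u : ℝ → Fin 2 → ℂ} (hu : u ∈ solutions J q w lam) (h0 : u ≠ 0) {ρ : ℂ}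
    (hρ : ∀ x, u (x + ω) = ρ • u x) : ρ ^ 2 + 1 = discriminant J q w ω lam * ρ := by
  obtain ⟨x, hx⟩ := Function.ne_iff.1 h0
  have h := solution_recurrence hJ hJs hqs hω hq hw hlam hu x
  rw [hρ, hρ, smul_smul, smul_smul] at h
  have : (ρ * ρ + 1 - discriminant J q w ω lam * ρ) • u x = 0 := by
    rw [sub_smul, add_smul, one_smul, h, sub_self]
  rcases smul_eq_zero.1 this with h | h
  · linear_combination h
  · exact absurd h hx

/-- The recurrence at `x` and at `x + ω` reads `(z + 1) u(x) = D u(x + ω)` and `(z + 1) u(x + ω) = D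
z u(x)`. Eliminating `u(x + ω)` leaves the claim, even if `u` has no multiplier for a single period.
-/
lemma discriminant_of_multiplier_two (hJ : IsUnit J) (hJs : Jᵀ = -J) (hqs : q.IsSymm) (hω : 0 < ω)
    (hq : ∀ i j, (q i j).IsPeriod ω)
    (hw : ∀ i j, (w.entry i j).IsPeriod ω) (hlam : lam ∉ exceptionalSet J q w)
    {u : ℝ → Fin 2 → ℂ} (hu : u ∈ solutions J q w lam) (h0 : u ≠ 0) {z : ℂ}
    (hz : ∀ x, u (x + 2 * ω) = z • u x) : (z + 1) ^ 2 = discriminant J q w ω lam ^ 2 * z := by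
  obtain ⟨x, hx⟩ := Function.ne_iff.1 h0
  have hz' : ∀ x, u (x + ω + ω) = z • u x := fun x => by rw [← hz]; congr 1; ring
  have h := solution_recurrence hJ hJs hqs hω hq hw hlam hu
  have h1 := h x
  have h2 := h (x + ω)
  rw [hz'] at h1 h2
  rw [hz'] at h2
  set D := discriminant J q w ω lam
  have : ((z + 1) ^ 2 - D ^ 2 * z) • u x = 0 := by
    ext i
    have h1' := congrFun h1 i
    have h2' := congrFun h2 i
    simp only [Pi.add_apply, Pi.smul_apply, smul_eq_mul, Pi.zero_apply] at h1' h2' ⊢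
    linear_combination (z + 1) * h1' + D * h2'
  rcases smul_eq_zero.1 this with h | h
  · linear_combination h
  · exact absurd h hx

end Monodromy

/-! ### Solutions annihilated by the weight. -/

section Invisible

variable {J : Matrix (Fin 2) (Fin 2) ℝ} {q : Matrix (Fin 2) (Fin 2) OrderZero} {w : Weight}
  {ω : ℝ} {lam : ℂ}

lemma mem_L0_iff (hJ : IsUnit J) {u : ℝ → Fin 2 → ℂ} : u ∈ L0 J q w ↔
    HasSource J q w u 0 ∧ ∀ᵐ x ∂baseMeasure q w, wMat q w x *ᵥ u x = 0 := by
  have hz : LocallyIntegrable (fun x => wMat q w x *ᵥ (0 : ℝ → Fin 2 → ℂ) x) (baseMeasure q w) := by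
    simpa using locallyIntegrable_zero
  have e : (IsBalancedBV u ∧ ∀ φ, IsTest φ → ∀ i, lhs J q u φ i = 0) ↔ HasSource J q w u 0 := by
    have := solves_iff (u := u) hJ hz
    simp only [Solves, Weight.apply_zero] at this
    rw [this, HasSource]
    have e : derivDensity J q w u 0 = fun x => (complexify J)⁻¹ *ᵥ
        (wMat q w x *ᵥ (0 : ℝ → Fin 2 → ℂ) x - qMat q w x *ᵥ u x) := by
      ext1 x
      simp only [derivDensity, Pi.zero_apply, Matrix.mulVec_zero]
    rw [e]
  have hi : ∀ i j, LocallyIntegrable (fun x => wMat q w x i j) (baseMeasure q w) :=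
    locallyIntegrable_wMat q w
  constructor
  · rintro ⟨hu, h1, h2⟩
    refine ⟨e.1 ⟨hu, h1⟩, ?_⟩
    have hl := hu.locallyIntegrable_mulVec hi
    have : ∀ i, ∀ᵐ x ∂baseMeasure q w, (wMat q w x *ᵥ u x) i = 0 := by
      intro i
      refine ae_eq_zero_of_integral_contDiff_smul_eq_zero (locallyIntegrable_apply hl i) ?_
      intro g hg hc
      have hφ : IsTest fun x => (g x : ℂ) :=
        ⟨Complex.ofRealCLM.contDiff.comp hg, hc.comp_left (g := fun t : ℝ => (t : ℂ)) rfl⟩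
      have := h2 _ hφ i
      rw [apply_eq q w] at this
      simpa using this
    filter_upwards [ae_all_iff.2 this] with x hx
    exact funext hx
  · rintro ⟨h1, h2⟩
    obtain ⟨hu, h3⟩ := e.2 h1
    refine ⟨hu, h3, fun φ hφ i => ?_⟩
    rw [apply_eq q w]
    refine integral_eq_zero_of_ae ?_
    filter_upwards [h2] with x hx
    simp [hx]

/-- The term `lam w u` vanishes whatever `lam` is; this is the source of all constancy in `lam`. -/
lemma L0_le_solutions (hJ : IsUnit J) (lam : ℂ) : L0 J q w ≤ solutions J q w lam := by
  intro u hu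
  rw [mem_L0_iff hJ] at hu
  rw [mem_solutions_iff_hasSource hJ]
  refine hu.1.congr ?_
  filter_upwards [hu.2] with x hx
  simp [hx]

lemma translate_mem_L0 (hJ : IsUnit J) (hq : ∀ i j, (q i j).IsPeriod ω)
    (hw : ∀ i j, (w.entry i j).IsPeriod ω) {u : ℝ → Fin 2 → ℂ} (hu : u ∈ L0 J q w) :
    translate ω u ∈ L0 J q w := by
  rw [mem_L0_iff hJ] at hu ⊢
  refine ⟨HasSource.congr (h := fun x => (0 : ℝ → Fin 2 → ℂ) (x + ω)) (hu.1.shift hq hw)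
    (Eventually.of_forall fun _ => rfl), ?_⟩
  have h2 : ∀ᵐ x ∂(baseMeasure q w).map fun x => x + ω, wMat q w x *ᵥ u x = 0 := by
    rw [map_shift_base q w hq hw]
    exact hu.2
  have h3 : ∀ᵐ x ∂baseMeasure q w, wMat q w (x + ω) *ᵥ u (x + ω) = 0 :=
    ae_of_ae_map (measurable_shift ω).aemeasurable h2
  filter_upwards [wMat_shift q w hq hw, h3] with x hx h
  rw [translate_apply, ← hx, h]

lemma star_mem_L0 (hJ : IsUnit J) {u : ℝ → Fin 2 → ℂ} (hu : u ∈ L0 J q w) :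
    star u ∈ L0 J q w := by
  rw [mem_L0_iff hJ] at hu ⊢
  refine ⟨?_, ?_⟩
  · have := hu.1.star hJ
    rwa [star_zero] at this
  · filter_upwards [hu.2] with x hx
    rw [Pi.star_apply, ← star_mulVec_of_real (star_wMat q w x), hx, star_zero]

/-- The periodicity of the coefficients lets translation act on `L0`, which is finite-dimensional as
a subspace of the solutions for `lam = 0`. Over `ℂ` it has an eigenvector. -/
lemma exists_multiplier (hJ : IsUnit J) (hq : ∀ i j, (q i j).IsPeriod ω)
    (hw : ∀ i j, (w.entry i j).IsPeriod ω) (h0 : (0 : ℂ) ∉ exceptionalSet J q w)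
    (hL : L0 J q w ≠ ⊥) : ∃ v ∈ L0 J q w, v ≠ 0 ∧ ∃ ρ : ℂ, ∀ x, v (x + ω) = ρ • v x := by
  have : Module.Finite ℂ (solutions J q w 0) := Module.Finite.of_basis (standardBasis hJ h0 0)
  have : Module.Finite ℂ (L0 J q w) :=
    Module.Finite.of_injective (Submodule.inclusion (L0_le_solutions hJ 0))
      (Submodule.inclusion_injective _)
  have : Nontrivial (L0 J q w) := Submodule.nontrivial_iff_ne_bot.2 hL
  set T : Module.End ℂ (L0 J q w) :=
    (translate ω).restrict fun _ hu => translate_mem_L0 hJ hq hw hu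
  obtain ⟨ρ, hρ⟩ := Module.End.exists_eigenvalue T
  obtain ⟨v, hv⟩ := hρ.exists_hasEigenvector
  refine ⟨v, v.2, fun h => hv.2 (Subtype.ext h), ρ, fun x => ?_⟩
  exact congrFun (congrArg Subtype.val hv.apply_eq_smul) x

/-- The relation `ρ ^ 2 + 1 = D ρ` holds with the same `ρ` for every parameter, and it excludes `ρ =
0`. -/
lemma discriminant_const_of_L0 (hJ : IsUnit J) (hJs : Jᵀ = -J) (hqs : q.IsSymm) (hω : 0 < ω)
    (hq : ∀ i j, (q i j).IsPeriod ω) (hw : ∀ i j, (w.entry i j).IsPeriod ω)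
    (h0 : (0 : ℂ) ∉ exceptionalSet J q w) (hL : L0 J q w ≠ ⊥) :
    ∃ c : ℂ, ∀ lam ∉ exceptionalSet J q w, discriminant J q w ω lam = c := by
  obtain ⟨v, hv, hv0, ρ, hρ⟩ := exists_multiplier hJ hq hw h0 hL
  refine ⟨(ρ ^ 2 + 1) / ρ, fun lam hlam => ?_⟩
  have h := discriminant_of_multiplier hJ hJs hqs hω hq hw hlam (L0_le_solutions hJ lam hv) hv0 hρ
  have hne : ρ ≠ 0 := by
    rintro rfl
    norm_num at h
  rw [h, mul_div_cancel_right₀ _ hne]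

/-- The coefficients are real, so on a one-dimensional `L0` the conjugate of `v` is a multiple of
`v`, which makes `ρ` real. -/
lemma discriminant_ne_of_finrank_L0 (hJ : IsUnit J) (hJs : Jᵀ = -J) (hqs : q.IsSymm) (hω : 0 < ω)
    (hq : ∀ i j, (q i j).IsPeriod ω) (hw : ∀ i j, (w.entry i j).IsPeriod ω)
    (h0 : (0 : ℂ) ∉ exceptionalSet J q w) (hL : Module.finrank ℂ (L0 J q w) = 1)
    (hlam : lam ∉ exceptionalSet J q w) {t : ℝ} (ht : t ∈ Ioo (-2 : ℝ) 2) :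
    discriminant J q w ω lam ≠ t := by
  have hbot : L0 J q w ≠ ⊥ := by
    intro h
    rw [h, finrank_bot] at hL
    exact zero_ne_one hL
  obtain ⟨v, hv, hv0, ρ, hρ⟩ := exists_multiplier hJ hq hw h0 hbot
  have h := discriminant_of_multiplier hJ hJs hqs hω hq hw hlam (L0_le_solutions hJ lam hv) hv0 hρ
  intro hD
  rw [hD] at h
  have hreal : (starRingEnd ℂ) ρ = ρ := by
    obtain ⟨c, hc⟩ := (finrank_eq_one_iff_of_nonzero' (⟨v, hv⟩ : L0 J q w)
      (fun h => hv0 (congrArg Subtype.val h))).1 hL ⟨star v, star_mem_L0 hJ hv⟩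
    have hc' : c • v = star v := congrArg Subtype.val hc
    obtain ⟨x, hx⟩ := Function.ne_iff.1 hv0
    have e : ∀ x, c • v x = star (v x) := fun x => congrFun hc' x
    have e1 := e (x + ω)
    rw [hρ, star_smul, ← e, smul_smul, smul_smul] at e1
    have hc0 : c ≠ 0 := by
      rintro rfl
      have := e x
      rw [zero_smul] at this
      exact hx (star_eq_zero.1 this.symm)
    have e2 : (c * (ρ - star ρ)) • v x = 0 := by
      rw [mul_sub, sub_smul, e1, mul_comm, sub_self]
    rcases smul_eq_zero.1 e2 with h | h
    · exact (sub_eq_zero.1 ((mul_eq_zero.1 h).resolve_left hc0)).symm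
    · exact absurd h hx
  obtain ⟨r, rfl⟩ := Complex.conj_eq_iff_real.1 hreal
  have h' : r ^ 2 + 1 = t * r := by exact_mod_cast h
  -- The equation reads `(r - t / 2) ^ 2 + (1 - t ^ 2 / 4) = 0`, with a positive second summand.
  nlinarith [sq_nonneg (r - t / 2), ht.1, ht.2, mul_pos (sub_pos.2 ht.2) (sub_pos.2 ht.1)]

end Invisible

/-! ### Pointwise estimates for the density of the weight. -/

section WeightFacts

variable {q : Matrix (Fin 2) (Fin 2) OrderZero} {w : Weight}

lemma ae_base_of_ae_tr {p : ℝ → Prop} (h : ∀ᵐ x ∂w.tr, p x) :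
    ∀ᵐ x ∂baseMeasure q w, w.tr.rnDeriv (baseMeasure q w) x ≠ 0 → p x := by
  rwa [← Measure.withDensity_rnDeriv_eq _ _ (tr_absolutelyContinuous_base q w),
    ae_withDensity_iff (Measure.measurable_rnDeriv _ _)] at h

lemma wMat_eq_zero_of_rnDeriv : ∀ᵐ x ∂baseMeasure q w,
    w.tr.rnDeriv (baseMeasure q w) x = 0 → wMat q w x = 0 := by
  filter_upwards [wMat_eq q w] with x hx h0
  ext i j
  simp [hx, h0]

/-- Where the derivative of `w.tr` vanishes, the matrix is zero; elsewhere the functions agree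
almost everywhere. -/
lemma wMat_mulVec_congr {f g : ℝ → Fin 2 → ℂ} (h : f =ᵐ[w.tr] g) :
    ∀ᵐ x ∂baseMeasure q w, wMat q w x *ᵥ f x = wMat q w x *ᵥ g x := by
  filter_upwards [wMat_eq_zero_of_rnDeriv, ae_base_of_ae_tr (q := q) h] with x h1 h2
  by_cases h0 : w.tr.rnDeriv (baseMeasure q w) x = 0
  · simp [h1 h0]
  · rw [h2 h0]

/-- The trace of the density of `w`. -/
def wTrace (q : Matrix (Fin 2) (Fin 2) OrderZero) (w : Weight) (x : ℝ) : ℝ :=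
  (w.entry 0 0).density (baseMeasure q w) x + (w.entry 1 1).density (baseMeasure q w) x

lemma nonneg_of_form_nonneg {a b d : ℝ}
    (h : ∀ s t : ℝ, 0 ≤ a * s * s + 2 * b * s * t + d * t * t) : 0 ≤ a ∧ 0 ≤ d ∧ b ^ 2 ≤ a * d := by
  have ha : 0 ≤ a := by simpa using h 1 0
  have hd : 0 ≤ d := by simpa using h 0 1
  refine ⟨ha, hd, ?_⟩
  rcases ha.eq_or_lt with rfl | ha
  · rcases eq_or_ne b 0 with rfl | hb
    · simp
    -- With `a = 0` this choice gives the form the negative value `-d - 2`.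
    · have h1 := h (-(d + 1) / b) 1
      rw [mul_assoc 2 b, mul_div_cancel₀ _ hb] at h1
      linarith
  · have := h (-b) a
    have h3 : 0 ≤ a * (a * d - b ^ 2) := by nlinarith
    nlinarith [nonneg_of_mul_nonneg_right h3 ha]

/-- The difference between `a` times the form and the left side is `(a d - b²) |y|²`, and the
remaining `d` times the form is nonnegative. -/
lemma normSq_mulVec_le {a b d : ℝ} (h : ∀ s t : ℝ, 0 ≤ a * s * s + 2 * b * s * t + d * t * t)
    (z y : ℂ) : ‖(a : ℂ) * z + b * y‖ ^ 2 ≤ (a + d) *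
      (a * Complex.normSq z + 2 * b * (z.re * y.re + z.im * y.im) + d * Complex.normSq y) := by
  obtain ⟨ha, hd, hdet⟩ := nonneg_of_form_nonneg h
  have hz := h z.re y.re
  have hy := h z.im y.im
  have hq : 0 ≤ a * Complex.normSq z + 2 * b * (z.re * y.re + z.im * y.im)
      + d * Complex.normSq y := by
    simp only [Complex.normSq_apply]
    nlinarith
  have key : ‖(a : ℂ) * z + b * y‖ ^ 2 ≤ a * (a * Complex.normSq z
      + 2 * b * (z.re * y.re + z.im * y.im) + d * Complex.normSq y) := by
    rw [← Complex.normSq_eq_norm_sq]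
    simp only [Complex.normSq_apply, Complex.add_re, Complex.add_im, Complex.mul_re,
      Complex.mul_im, Complex.ofReal_re, Complex.ofReal_im]
    nlinarith [mul_nonneg (sub_nonneg.2 hdet) (add_nonneg (mul_self_nonneg y.re)
      (mul_self_nonneg y.im))]
  nlinarith [mul_nonneg hd hq]

lemma wMat_form_nonneg : ∀ᵐ x ∂baseMeasure q w, ∀ s t : ℝ,
    0 ≤ (w.entry 0 0).density (baseMeasure q w) x * s * s
      + 2 * (w.entry 0 1).density (baseMeasure q w) x * s * t
      + (w.entry 1 1).density (baseMeasure q w) x * t * t := by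
  filter_upwards [wMat_posSemidef q w] with x hx s t
  have hs : (w.entry 1 0).density (baseMeasure q w) x = (w.entry 0 1).density (baseMeasure q w) x := by
    rw [entry_symm w]
  have := hx ![s, t]
  simp [Fin.sum_univ_two, hs] at this
  linarith

lemma norm_wMat_mulVec_sq_le : ∀ᵐ x ∂baseMeasure q w, 0 ≤ wTrace q w x ∧
    ∀ v, ‖wMat q w x *ᵥ v‖ ^ 2 ≤ wTrace q w x * wQuad q w x v := by
  filter_upwards [wMat_form_nonneg (q := q) (w := w), wQuad_nonneg q w] with x h hn
  have hs : (w.entry 1 0).density (baseMeasure q w) x = (w.entry 0 1).density (baseMeasure q w) x := by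
    rw [entry_symm w]
  set a := (w.entry 0 0).density (baseMeasure q w) x with ha
  set b := (w.entry 0 1).density (baseMeasure q w) x with hb
  set d := (w.entry 1 1).density (baseMeasure q w) x with hd
  have h' : ∀ s t : ℝ, 0 ≤ d * s * s + 2 * b * s * t + a * t * t := fun s t => by
    linarith [h t s]
  have ht : wTrace q w x = a + d := rfl
  have ht0 : 0 ≤ wTrace q w x := by
    rw [ht]
    linarith [h 1 0, h 0 1]
  refine ⟨ht0, fun v => ?_⟩
  have hQ : wQuad q w x v = a * Complex.normSq (v 0)
      + 2 * b * ((v 0).re * (v 1).re + (v 0).im * (v 1).im) + d * Complex.normSq (v 1) := by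
    simp [wQuad, Matrix.mulVec, dotProduct, Fin.sum_univ_two, wMat, hs, Complex.normSq_apply]
    simp only [← ha, ← hb, ← hd]
    ring
  have hb0 : 0 ≤ wTrace q w x * wQuad q w x v := mul_nonneg ht0 (hn v)
  have : ‖wMat q w x *ᵥ v‖ ≤ Real.sqrt (wTrace q w x * wQuad q w x v) := by
    refine (pi_norm_le_iff_of_nonneg (Real.sqrt_nonneg _)).2 fun i => Real.le_sqrt_of_sq_le ?_
    fin_cases i
    · have := normSq_mulVec_le h (v 0) (v 1)
      rw [hQ, ht]
      simpa [Matrix.mulVec, dotProduct, Fin.sum_univ_two, wMat] using this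
    · have := normSq_mulVec_le h' (v 1) (v 0)
      rw [hQ, ht]
      simp [Matrix.mulVec, dotProduct, Fin.sum_univ_two, wMat, hs]
      rw [add_comm]
      refine this.trans_eq ?_
      ring
  calc ‖wMat q w x *ᵥ v‖ ^ 2 ≤ Real.sqrt (wTrace q w x * wQuad q w x v) ^ 2 := by gcongr
    _ = _ := Real.sq_sqrt hb0

lemma wMat_mulVec_eq_zero_iff : ∀ᵐ x ∂baseMeasure q w, ∀ v,
    wMat q w x *ᵥ v = 0 ↔ wQuad q w x v = 0 := by
  filter_upwards [norm_wMat_mulVec_sq_le (q := q) (w := w)] with x hx v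
  constructor
  · intro h
    simp [wQuad, h]
  · intro h
    have := hx.2 v
    rw [h, mul_zero] at this
    exact norm_eq_zero.1 (pow_eq_zero_iff two_ne_zero |>.1 (le_antisymm this (sq_nonneg _)))

/-- The inequality between the means applied to `norm_wMat_mulVec_sq_le`. It makes `w f` locally
integrable for `f` of finite norm. -/
lemma norm_wMat_mulVec_le : ∀ᵐ x ∂baseMeasure q w, ∀ v,
    ‖wMat q w x *ᵥ v‖ ≤ wTrace q w x + wQuad q w x v := by
  filter_upwards [norm_wMat_mulVec_sq_le (q := q) (w := w), wQuad_nonneg q w] with x hx hn v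
  have h1 := hx.2 v
  have h2 := hx.1
  have h3 := hn v
  refine abs_le_of_sq_le_sq' ?_ (by positivity) |>.2
  nlinarith

/-- The matrix is real and symmetric, so `W` may act on either factor of the form and the value
depends only on `W a`. -/
lemma wQuad_congr {x : ℝ} {a b : Fin 2 → ℂ} (h : wMat q w x *ᵥ a = wMat q w x *ᵥ b) :
    wQuad q w x a = wQuad q w x b := by
  have h1 : wMat q w x *ᵥ star a = wMat q w x *ᵥ star b := by
    rw [← star_mulVec_of_real (star_wMat q w x), ← star_mulVec_of_real (star_wMat q w x), h]
  rw [wQuad, wQuad, h, ← wMat_mulVec_dotProduct, h1, wMat_mulVec_dotProduct]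

lemma wQuad_smul (x : ℝ) (c : ℂ) (a : Fin 2 → ℂ) :
    wQuad q w x (c • a) = Complex.normSq c * wQuad q w x a := by
  simp only [wQuad, Matrix.mulVec_smul, star_smul, smul_dotProduct, dotProduct_smul, smul_eq_mul,
    ← mul_assoc]
  rw [Complex.star_def, Complex.mul_conj, Complex.re_ofReal_mul]

lemma measurable_wMat_mulVec {f : ℝ → Fin 2 → ℂ} (hf : Measurable f) :
    Measurable fun x => wMat q w x *ᵥ f x :=
  measurable_mulVec (measurable_wMat q w) hf

lemma measurable_wQuad {f : ℝ → Fin 2 → ℂ} (hf : Measurable f) :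
    Measurable fun x => wQuad q w x (f x) := by
  have h := measurable_wMat_mulVec (q := q) (w := w) hf
  simp only [wQuad, dotProduct]
  refine Complex.measurable_re.comp (Finset.measurable_sum _ fun i _ => ?_)
  exact (continuous_star.measurable.comp ((measurable_pi_apply i).comp hf)).mul
    ((measurable_pi_apply i).comp h)

lemma integrableOn_wTrace {s : Set ℝ} (hs : Bornology.IsBounded s) :
    IntegrableOn (wTrace q w) s (baseMeasure q w) :=
  (OrderZero.integrableOn_density hs).add (OrderZero.integrableOn_density hs)

lemma normSq_eq_zero_iff {f : ℝ → Fin 2 → ℂ} (hf : AEStronglyMeasurable f w.tr) :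
    w.normSq f = 0 ↔ ∀ᵐ x ∂baseMeasure q w, wMat q w x *ᵥ f x = 0 := by
  constructor
  · intro h
    rw [Weight.normSq, lintegral_eq_zero_iff' (w.aemeasurable_quad hf).ennreal_ofReal] at h
    filter_upwards [ae_base_of_ae_tr (q := q) h, quad_eq q w, wMat_mulVec_eq_zero_iff (q := q) (w := w),
      wQuad_nonneg q w] with x h1 h2 h3 h4
    rw [h3]
    refine le_antisymm ?_ (h4 _)
    rw [h2]
    by_cases h0 : w.tr.rnDeriv (baseMeasure q w) x = 0
    · simp [h0]
    · exact mul_nonpos_of_nonneg_of_nonpos ENNReal.toReal_nonneg (ENNReal.ofReal_eq_zero.1 (h1 h0))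
  · intro h
    rw [normSq_eq q w f hf]
    refine lintegral_eq_zero_of_ae_eq_zero ?_
    filter_upwards [h] with x hx
    simp [wQuad, hx]

lemma locallyIntegrable_wMat_mulVec {f : ℝ → Fin 2 → ℂ} (hf : f ∈ scriptL2 w) :
    LocallyIntegrable (fun x => wMat q w x *ᵥ f x) (baseMeasure q w) := by
  obtain ⟨hm, hlt⟩ := hf
  have hfin : w.normSq f ≠ ∞ := hlt.ne
  obtain ⟨g, hg, hfg⟩ := hm
  have hgm : AEStronglyMeasurable g w.tr := hg.aestronglyMeasurable
  have e := wMat_mulVec_congr (q := q) hfg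
  rw [normSq_eq q w f ⟨g, hg, hfg⟩] at hfin
  have e2 : ∫⁻ x, ENNReal.ofReal (wQuad q w x (f x)) ∂baseMeasure q w
      = ∫⁻ x, ENNReal.ofReal (wQuad q w x (g x)) ∂baseMeasure q w := by
    refine lintegral_congr_ae ?_
    filter_upwards [e] with x hx
    rw [wQuad_congr hx]
  rw [e2] at hfin
  have hi : Integrable (fun x => wQuad q w x (g x)) (baseMeasure q w) := by
    refine ⟨(measurable_wQuad hg.measurable).aestronglyMeasurable, ?_⟩
    rw [hasFiniteIntegral_iff_ofReal (by filter_upwards [wQuad_nonneg q w] with x hx using hx _)]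
    exact hfin.lt_top
  refine locallyIntegrable_iff.2 fun K hK => ?_
  refine Integrable.congr (f := fun x => wMat q w x *ᵥ g x) ?_ (ae_restrict_of_ae (by
    filter_upwards [e] with x hx using hx.symm))
  refine Integrable.mono' ((integrableOn_wTrace hK.isBounded).add hi.integrableOn)
    (measurable_wMat_mulVec hg.measurable).aestronglyMeasurable (ae_restrict_of_ae ?_)
  filter_upwards [norm_wMat_mulVec_le (q := q) (w := w)] with x hx using hx _

end WeightFacts

/-! ### Vanishing Wronskian with an invisible solution. -/

section Wronskian

/-- The two-dimensional algebra behind `HasSource.wMat_mulVec_eq_zero`. -/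
lemma mulVec_eq_zero_of_wronskian {c m a b d q0 q1 q2 v0 v1 u0 u1 f0 f1 : ℂ} (hc : c ≠ 0)
    (hv : v0 ≠ 0 ∨ v1 ≠ 0) (h1 : a * v0 + b * v1 = 0) (h2 : b * v0 + d * v1 = 0)
    (hrel : m ^ 2 * (q0 * d + q2 * a - 2 * q1 * b) = 0)
    (hdet : 4 * c ^ 2 + m ^ 2 * (q0 * q2 - q1 ^ 2) ≠ 0)
    (hL : (v0 - m / 2 * ((q1 * v0 + q2 * v1) / c)) *
        (u1 - m / 2 * ((a * f0 + b * f1 - (q0 * u0 + q1 * u1)) / c))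
      - (v1 + m / 2 * ((q0 * v0 + q1 * v1) / c)) *
        (u0 + m / 2 * ((b * f0 + d * f1 - (q1 * u0 + q2 * u1)) / c)) = 0) :
    a * u0 + b * u1 = 0 ∧ b * u0 + d * u1 = 0 := by
  -- The contribution of the source to the product of the two jump terms. Modulo `W v = 0` it is a
  -- multiple of the relation `hrel`.
  have hs : m ^ 2 * ((q0 * v0 + q1 * v1) * (b * f0 + d * f1)
      - (q1 * v0 + q2 * v1) * (a * f0 + b * f1)) = 0 := by
    linear_combination (-v1 * f0 + v0 * f1) * hrel + m ^ 2 * ((q0 * f0 + q1 * f1) * h2 +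
      (-(q1 * f0) - q2 * f1) * h1)
  -- In the Wronskian of the left-hand limits the terms of first order in `m` reduce to `v · W f =
  -- 0` by symmetry of `q`. Those of second order give `det q` times the determinant of the values.
  have hk : (4 * c ^ 2 + m ^ 2 * (q0 * q2 - q1 ^ 2)) * (v0 * u1 - v1 * u0) = 0 := by
    field_simp at hL
    linear_combination hL + hs + 2 * c * m * f0 * h1 + 2 * c * m * f1 * h2
  have hk := (mul_eq_zero.1 hk).resolve_left hdet
  -- The values of `u` and `v` are now parallel and `v ≠ 0`, so `W` annihilates `u` as well.
  rcases hv with hv | hv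
  · constructor
    · refine (mul_eq_zero.1 ?_).resolve_left hv
      linear_combination b * hk + u0 * h1
    · refine (mul_eq_zero.1 ?_).resolve_left hv
      linear_combination d * hk + u0 * h2
  · constructor
    · refine (mul_eq_zero.1 ?_).resolve_left hv
      linear_combination -a * hk + u1 * h1
    · refine (mul_eq_zero.1 ?_).resolve_left hv
      linear_combination -b * hk + u1 * h2

end Wronskian

section Wronskian

variable {J : Matrix (Fin 2) (Fin 2) ℝ} {q : Matrix (Fin 2) (Fin 2) OrderZero} {w : Weight}
  {ω : ℝ} {lam : ℂ}

lemma complexify_inv_mulVec (hJ : IsUnit J) (hJs : Jᵀ = -J) (a : Fin 2 → ℂ) :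
    (complexify J)⁻¹ *ᵥ a = ![-(a 1 / (J 0 1 : ℂ)), a 0 / (J 0 1 : ℂ)] := by
  have h : ∀ i j, J j i = -J i j := fun i j => congrFun (congrFun hJs i) j
  have h0 : J 0 0 = 0 := by linarith [h 0 0]
  have h1 : J 1 1 = 0 := by linarith [h 1 1]
  have hc := skew_entry_ne_zero hJ hJs
  have e : complexify J *ᵥ ![-(a 1 / (J 0 1 : ℂ)), a 0 / (J 0 1 : ℂ)] = a := by
    ext i
    fin_cases i <;>
      simp [complexify, Matrix.mulVec, dotProduct, Fin.sum_univ_two, h0, h1, h 0 1] <;> field_simp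
  rw [← Matrix.one_mulVec ![-(a 1 / (J 0 1 : ℂ)), a 0 / (J 0 1 : ℂ)],
    ← Matrix.nonsing_inv_mul _ (isUnit_det_complexify hJ), ← Matrix.mulVec_mulVec, e]

/-- Invertibility of `B₊(x, lam)` for real `lam` when `W(x)` is singular. -/
lemma jump_relations (hJs : Jᵀ = -J) (hqs : q.IsSymm) {x : ℝ}
    (hB : ∀ lam : ℝ, IsUnit (B J q w 1 x lam))
    (hW : wMat q w x 0 0 * wMat q w x 1 1 - wMat q w x 0 1 ^ 2 = 0) :
    ((baseMeasure q w).real {x} : ℂ) ^ 2 * (qMat q w x 0 0 * wMat q w x 1 1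
      + qMat q w x 1 1 * wMat q w x 0 0 - 2 * qMat q w x 0 1 * wMat q w x 0 1) = 0 ∧
    4 * (J 0 1 : ℂ) ^ 2 + ((baseMeasure q w).real {x} : ℂ) ^ 2 *
      (qMat q w x 0 0 * qMat q w x 1 1 - qMat q w x 0 1 ^ 2) ≠ 0 := by
  set m := (baseMeasure q w).real {x} with hm
  set Qd := fun i j => (q i j).density (baseMeasure q w) x with hQ
  set Wd := fun i j => (w.entry i j).density (baseMeasure q w) x with hWd
  have eQ : ∀ i j, qMat q w x i j = (Qd i j : ℂ) := fun i j => rfl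
  have eW : ∀ i j, wMat q w x i j = (Wd i j : ℂ) := fun i j => rfl
  have h : ∀ i j, J j i = -J i j := fun i j => congrFun (congrFun hJs i) j
  have h0 : J 0 0 = 0 := by linarith [h 0 0]
  have h1 : J 1 1 = 0 := by linarith [h 1 1]
  have sQ : Qd 1 0 = Qd 0 1 := by
    simp only [hQ]
    rw [← Matrix.transpose_apply q 0 1, hqs.eq]
  have sW : Wd 1 0 = Wd 0 1 := by simp only [hWd, entry_symm w 1 0]
  -- As `det W = 0`, the function `4 det B₊` is affine in the parameter. Having no real zero, it has
  -- slope zero and a nonzero constant term.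
  have hd : ∀ lam : ℝ, 4 * J 0 1 ^ 2 + m ^ 2 * (Qd 0 0 * Qd 1 1 - Qd 0 1 ^ 2)
      - lam * (m ^ 2 * (Qd 0 0 * Wd 1 1 + Qd 1 1 * Wd 0 0 - 2 * Qd 0 1 * Wd 0 1)) ≠ 0 := by
    intro lam hz
    have := ((Matrix.isUnit_iff_isUnit_det _).1 (hB lam)).ne_zero
    apply this
    have hW' : Wd 0 0 * Wd 1 1 - Wd 0 1 ^ 2 = 0 := by
      simp only [eW] at hW
      exact_mod_cast hW
    have hz' : J 0 1 ^ 2 + m ^ 2 / 4 * ((Qd 0 0 - lam * Wd 0 0) * (Qd 1 1 - lam * Wd 1 1)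
        - (Qd 0 1 - lam * Wd 0 1) ^ 2) = 0 := by
      linear_combination hz / 4 + m ^ 2 / 4 * lam ^ 2 * hW'
    rw [B, jump_q q w, jump_w q w, Matrix.det_fin_two]
    simp only [Matrix.add_apply, Matrix.smul_apply, Matrix.sub_apply, Matrix.map_apply, eQ, eW, sQ,
      sW, h0, h1, h 0 1, smul_eq_mul, ← hm]
    have hz'' := congrArg (fun t : ℝ => (t : ℂ)) hz'
    push_cast at hz'' ⊢
    linear_combination hz''
  constructor
  · simp only [eQ, eW]
    by_contra hne
    have hne' : m ^ 2 * (Qd 0 0 * Wd 1 1 + Qd 1 1 * Wd 0 0 - 2 * Qd 0 1 * Wd 0 1) ≠ 0 := by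
      intro h
      apply hne
      exact_mod_cast congrArg (fun t : ℝ => (t : ℂ)) h
    exact hd (_ / _) (by rw [div_mul_cancel₀ _ hne', sub_self])
  · simp only [eQ]
    have := hd 0
    rw [zero_mul, sub_zero] at this
    exact_mod_cast this

/-- A solution whose Wronskian with some `v ∈ 𝓛₀` vanishes is annihilated by `w`. -/
lemma HasSource.wMat_mulVec_eq_zero (hJ : IsUnit J) (hJs : Jᵀ = -J) (hqs : q.IsSymm)
    (hB : ∀ lam x : ℝ, IsUnit (B J q w 1 x lam)) (h0 : (0 : ℂ) ∉ exceptionalSet J q w)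
    {v u f : ℝ → Fin 2 → ℂ} (hv : v ∈ L0 J q w) (hv0 : v ≠ 0)
    (hu : HasSource J q w u fun x => wMat q w x *ᵥ f x) {a : ℝ}
    (ha : leftLim v a ⬝ᵥ complexify J *ᵥ leftLim u a = 0) :
    ∀ᵐ x ∂baseMeasure q w, wMat q w x *ᵥ u x = 0 := by
  have hvs := hv
  rw [mem_L0_iff hJ] at hv
  have hc := skew_entry_ne_zero hJ hJs
  -- The source of `u` enters the Lagrange identity as `v · W f = W v · f = 0`.
  have hdiff : ∀ x y, x ≤ y → leftLim v y ⬝ᵥ complexify J *ᵥ leftLim u y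
      = leftLim v x ⬝ᵥ complexify J *ᵥ leftLim u x := by
    intro x y hxy
    rw [← sub_eq_zero, hv.1.lagrange hJ hJs hqs hu hxy]
    refine integral_eq_zero_of_ae (ae_restrict_of_ae ?_)
    filter_upwards [hv.2] with t ht
    rw [← wMat_mulVec_dotProduct, ht]
    simp
  have hall : ∀ x, leftLim v x ⬝ᵥ complexify J *ᵥ leftLim u x = 0 := by
    intro x
    rcases le_total a x with h | h
    · rw [hdiff a x h, ha]
    · rw [← hdiff x a h, ha]
  filter_upwards [hv.2] with x hx
  have hvx : v x ≠ 0 := fun h =>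
    hv0 (eq_zero_of_apply_eq_zero hJ h0 (L0_le_solutions hJ 0 hvs) h)
  have hL := hall x
  rw [dotProduct_skew_mulVec hJs, hv.1.leftLim_eq, hu.leftLim_eq] at hL
  have hL := (mul_eq_zero.1 hL).resolve_left hc
  set m := (baseMeasure q w).real {x}
  have sW : wMat q w x 1 0 = wMat q w x 0 1 := congrFun (congrFun (wMat_transpose q w x) 0) 1
  have sQ : qMat q w x 1 0 = qMat q w x 0 1 := congrFun (congrFun (qMat_transpose q w hqs x) 0) 1
  have e1 : wMat q w x 0 0 * v x 0 + wMat q w x 0 1 * v x 1 = 0 := by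
    have := congrFun hx 0
    simpa [Matrix.mulVec, dotProduct, Fin.sum_univ_two] using this
  have e2 : wMat q w x 0 1 * v x 0 + wMat q w x 1 1 * v x 1 = 0 := by
    have := congrFun hx 1
    simpa [Matrix.mulVec, dotProduct, Fin.sum_univ_two, sW] using this
  have hv' : v x 0 ≠ 0 ∨ v x 1 ≠ 0 := by
    by_contra! h
    exact hvx (by ext i; fin_cases i <;> simp [h.1, h.2])
  -- `v x` is a nonzero vector in the kernel of `W(x)`.
  have hW : wMat q w x 0 0 * wMat q w x 1 1 - wMat q w x 0 1 ^ 2 = 0 := by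
    rcases hv' with h | h
    · refine (mul_eq_zero.1 ?_).resolve_left h
      linear_combination wMat q w x 1 1 * e1 - wMat q w x 0 1 * e2
    · refine (mul_eq_zero.1 ?_).resolve_left h
      linear_combination wMat q w x 0 0 * e2 - wMat q w x 0 1 * e1
  obtain ⟨hr, hd⟩ := jump_relations hJs hqs (fun lam => hB lam x) hW
  have key := mulVec_eq_zero_of_wronskian (u0 := u x 0) (u1 := u x 1) (f0 := f x 0) (f1 := f x 1)
    hc hv' e1 e2 hr hd (by
      rw [← hL]
      simp only [leftValue, derivDensity, complexify_inv_mulVec hJ hJs, Pi.sub_apply, Pi.smul_apply,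
        Complex.real_smul, Matrix.cons_val_zero, Matrix.cons_val_one, Matrix.mulVec, dotProduct,
        Fin.sum_univ_two, Pi.zero_apply, sW, sQ]
      push_cast
      ring)
  ext i
  fin_cases i
  · simpa [Matrix.mulVec, dotProduct, Fin.sum_univ_two] using key.1
  · simpa [Matrix.mulVec, dotProduct, Fin.sum_univ_two, sW] using key.2

end Wronskian

/-! ### Integrable functions that scale under translation. -/

section Recurrence

variable {ν : Measure ℝ} {ω : ℝ}

lemma setLIntegral_shift (hν : (ν.map fun x => x + ω) = ν) (g : ℝ → ℝ≥0∞) (s : Set ℝ) :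
    ∫⁻ x in (fun x => x + ω) ⁻¹' s, g (x + ω) ∂ν = ∫⁻ x in s, g x ∂ν := by
  nth_rw 2 [← hν]
  rw [(measurableEmbedding_shift ω).restrict_map, (measurableEmbedding_shift ω).lintegral_map]

/-- An integrable function which is multiplied by a constant under translation vanishes. -/
lemma lintegral_eq_zero_of_shift (hω : 0 < ω) (hν : (ν.map fun x => x + ω) = ν) {g : ℝ → ℝ≥0∞}
    {s : ℝ≥0∞} (hs : ∀ᵐ x ∂ν, g (x + ω) = s * g x) (hg : ∫⁻ x, g x ∂ν ≠ ∞)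
    (hm : Measurable g) : ∫⁻ x, g x ∂ν = 0 := by
  have h1 : ∀ t, MeasurableSet t → s * ∫⁻ x in (fun x => x + ω) ⁻¹' t, g x ∂ν = ∫⁻ x in t, g x ∂ν := by
    intro t ht
    rw [← lintegral_const_mul _ hm, ← setLIntegral_shift hν g t]
    exact lintegral_congr_ae (ae_restrict_of_ae (by filter_upwards [hs] with x hx using hx.symm))
  -- For `s = 1` a half-line and its translate have the same finite mass, so the period between them
  -- has none. For `s ≠ 1` the total `I` satisfies `s I = I`, which forces `I = 0`.
  by_cases hs1 : s = 1
  · subst hs1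
    have h2 : ∀ a, ∫⁻ x in Ico a (a + ω), g x ∂ν = 0 := by
      intro a
      have h := h1 (Ici (a + ω)) measurableSet_Ici
      have e : (fun x => x + ω) ⁻¹' Ici (a + ω) = Ici a := by ext x; simp
      rw [one_mul, e, ← Ico_union_Ici_eq_Ici (show a ≤ a + ω by linarith),
        lintegral_union measurableSet_Ici (by
          rw [Set.disjoint_left]
          exact fun x hx hx' => absurd hx.2 (not_lt.2 hx'))] at h
      have hf : ∫⁻ x in Ici (a + ω), g x ∂ν ≠ ∞ :=
        ((setLIntegral_le_lintegral _ _).trans_lt hg.lt_top).ne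
      have h' : ∫⁻ x in Ico a (a + ω), g x ∂ν + ∫⁻ x in Ici (a + ω), g x ∂ν
        = 0 + ∫⁻ x in Ici (a + ω), g x ∂ν := by rw [h, zero_add]
      exact (ENNReal.add_left_inj hf).1 h'
    have h3 : ∀ n : ℤ, ∫⁻ x in Ico (n • ω) ((n + 1) • ω), g x ∂ν = 0 := by
      intro n
      have := h2 (n • ω)
      rwa [add_smul, one_smul]
    rw [← setLIntegral_univ, ← iUnion_Ico_zsmul hω]
    refine nonpos_iff_eq_zero.1 ((lintegral_iUnion_le _ _).trans ?_)
    simp only [h3, tsum_zero, le_refl]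
  · have h := h1 univ MeasurableSet.univ
    rw [preimage_univ, setLIntegral_univ] at h
    by_contra h0
    exact hs1 ((ENNReal.mul_eq_right h0 hg).1 h)

end Recurrence

/-! ### Invisible solutions make the maximal relation degenerate. -/

section MaximalRelation

variable {J : Matrix (Fin 2) (Fin 2) ℝ} {q : Matrix (Fin 2) (Fin 2) OrderZero} {w : Weight}
  {ω : ℝ}

lemma exists_hasSource_zero (hJ : IsUnit J) (h0 : (0 : ℂ) ∉ exceptionalSet J q w) (a : ℝ)
    {h : ℝ → Fin 2 → ℂ} (hh : LocallyIntegrable h (baseMeasure q w)) (c : Fin 2 → ℂ) :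
    ∃ u, HasSource J q w u h ∧ leftLim u a = c := by
  obtain ⟨C, -, H⟩ := exists_hasSource (q := q) (w := w) hJ h0 a 0
  obtain ⟨u, hu, hc, -⟩ := H h hh c
  refine ⟨u, ?_, hc⟩
  simpa only [zero_smul, zero_add] using hu

lemma hasSource_iff (hJ : IsUnit J) {u f : ℝ → Fin 2 → ℂ} (hf : f ∈ scriptL2 w) :
    (IsBalancedBV u ∧ Solves J q w u f) ↔ HasSource J q w u fun x => wMat q w x *ᵥ f x :=
  solves_iff hJ (locallyIntegrable_wMat_mulVec hf)

/-- Homogeneous solutions of finite norm are annihilated by `w` if `𝓛₀ ≠ 0`. -/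
lemma wMat_mulVec_eq_zero_of_normSq_lt_top (hJ : IsUnit J) (hJs : Jᵀ = -J) (hqs : q.IsSymm)
    (hω : 0 < ω) (hq : ∀ i j, (q i j).IsPeriod ω) (hw : ∀ i j, (w.entry i j).IsPeriod ω)
    (hB : ∀ lam x : ℝ, IsUnit (B J q w 1 x lam)) (h0 : (0 : ℂ) ∉ exceptionalSet J q w)
    (hL : L0 J q w ≠ ⊥) {u : ℝ → Fin 2 → ℂ} (hu : HasSource J q w u 0) (hn : w.normSq u < ∞) :
    ∀ᵐ x ∂baseMeasure q w, wMat q w x *ᵥ u x = 0 := by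
  obtain ⟨v, hv, hv0, ρ, hρ⟩ := exists_multiplier hJ hq hw h0 hL
  have hvs := (mem_L0_iff hJ).1 hv
  have hρ0 : ρ ≠ 0 := by
    rintro rfl
    refine hv0 (funext fun x => ?_)
    have := hρ (x - ω)
    rwa [sub_add_cancel, zero_smul] at this
  have hl : ∀ x, leftLim v (x + ω) = ρ • leftLim v x := by
    intro x
    rw [← leftLim_shift ω hvs.1, ← leftLim_smul hvs.1]
    congr 1
    exact funext hρ
  have hus : HasSource J q w (fun x => u (x + ω)) 0 :=
    HasSource.congr (h := fun x => (0 : ℝ → Fin 2 → ℂ) (x + ω)) (hu.shift hq hw)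
      (Eventually.of_forall fun _ => rfl)
  have hz : ∀ {y : ℝ → Fin 2 → ℂ}, HasSource J q w y 0 →
      HasSource J q w y fun x => wMat q w x *ᵥ (0 : ℝ → Fin 2 → ℂ) x := fun hy => by
    simp only [Pi.zero_apply, Matrix.mulVec_zero]
    exact hy
  have hd : HasSource J q w ((fun x => u (x + ω)) - ρ⁻¹ • u) 0 := by
    have := hus.sub (hu.smul ρ⁻¹)
    rwa [smul_zero, sub_zero] at this
  have hwr : leftLim v ω ⬝ᵥ complexify J *ᵥ leftLim u ω
      = leftLim v 0 ⬝ᵥ complexify J *ᵥ leftLim u 0 := by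
    refine wronskian_eq (lam := 0) hJ hJs hqs (L0_le_solutions hJ 0 hv) ?_ hω.le
    rw [mem_solutions_iff_hasSource hJ]
    simp only [zero_smul]
    exact hu
  -- The Wronskian of `v` with the translate of `u` is `ρ⁻¹` times that with `u`, since it is
  -- constant and `v` has multiplier `ρ`. The difference therefore has Wronskian zero.
  have key := (hz hd).wMat_mulVec_eq_zero hJ hJs hqs hB h0 hv hv0 (a := 0) (by
    rw [leftLim_sub hus (hu.smul _), leftLim_smul hu, leftLim_shift ω hu]
    have := hl 0
    rw [zero_add] at this ⊢
    rw [Matrix.mulVec_sub, dotProduct_sub, Matrix.mulVec_smul, dotProduct_smul, ← hwr, this,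
      smul_dotProduct, smul_smul, inv_mul_cancel₀ hρ0, one_smul, sub_self])
  have hum := hu.measurable
  rw [normSq_eq q w u hum.aestronglyMeasurable] at hn
  -- The density of the norm of `u` is multiplied by `|ρ|⁻²` under translation, and its integral is
  -- finite.
  have hI := lintegral_eq_zero_of_shift hω (map_shift_base q w hq hw)
    (g := fun x => ENNReal.ofReal (wQuad q w x (u x)))
    (s := ENNReal.ofReal (Complex.normSq ρ⁻¹)) (by
      filter_upwards [key, wMat_shift q w hq hw] with x hx hs
      rw [← ENNReal.ofReal_mul (Complex.normSq_nonneg _), ← wQuad_smul]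
      have e : ∀ a, wQuad q w (x + ω) a = wQuad q w x a := fun a => by rw [wQuad, hs, wQuad]
      rw [e]
      congr 1
      refine wQuad_congr ?_
      rw [← sub_eq_zero, ← Matrix.mulVec_sub]
      exact hx) hn.ne (measurable_wQuad hum).ennreal_ofReal
  rw [lintegral_eq_zero_iff (measurable_wQuad hum).ennreal_ofReal] at hI
  filter_upwards [hI, wMat_mulVec_eq_zero_iff (q := q) (w := w), wQuad_nonneg q w] with x h1 h2 h3
  exact (h2 _).2 (le_antisymm (ENNReal.ofReal_eq_zero.1 h1) (h3 _))

/-- Subtract from `u` the homogeneous solution `y` with the same initial value. The difference has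
Wronskian zero with `v`, so `w` kills it; then `y` has the same finite norm as `u` and is killed
too. Conversely, for every `f` the solution with initial value zero is killed by `w`, which gives
all pairs `(0, f)`. -/
lemma Tmax_eq_of_L0 (hJ : IsUnit J) (hJs : Jᵀ = -J) (hqs : q.IsSymm)
    (hω : 0 < ω) (hq : ∀ i j, (q i j).IsPeriod ω) (hw : ∀ i j, (w.entry i j).IsPeriod ω)
    (hB : ∀ lam x : ℝ, IsUnit (B J q w 1 x lam)) (h0 : (0 : ℂ) ∉ exceptionalSet J q w)
    (hL : L0 J q w ≠ ⊥) : Tmax J q w = {(0 : L2 w)} ×ˢ (univ : Set (L2 w)) := by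
  obtain ⟨v, hv, hv0⟩ := Submodule.exists_mem_ne_zero_of_ne_bot hL
  ext ⟨a, b⟩
  simp only [mem_prod, mem_singleton_iff, mem_univ, and_true]
  constructor
  · rintro ⟨u, f, hu, hs, he⟩
    obtain ⟨rfl, rfl⟩ := Prod.ext_iff.1 he
    rw [Submodule.Quotient.mk_eq_zero]
    change w.normSq u = 0
    have hsrc := (hasSource_iff hJ f.2).1 ⟨hu, hs⟩
    obtain ⟨y, hy, hc⟩ := exists_hasSource_zero hJ h0 0 (h := 0) locallyIntegrable_zero
      (leftLim (u : ℝ → Fin 2 → ℂ) 0)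
    have hd := hsrc.sub hy
    rw [sub_zero] at hd
    have hW := hd.wMat_mulVec_eq_zero hJ hJs hqs hB h0 hv hv0 (a := 0) (by
      rw [leftLim_sub hsrc hy, hc, sub_self, Matrix.mulVec_zero, dotProduct_zero])
    have e : ∀ᵐ x ∂baseMeasure q w, wMat q w x *ᵥ (u : ℝ → Fin 2 → ℂ) x = wMat q w x *ᵥ y x := by
      filter_upwards [hW] with x hx
      rwa [Pi.sub_apply, Matrix.mulVec_sub, sub_eq_zero] at hx
    have hyn : w.normSq y < ∞ := by
      refine lt_of_eq_of_lt ?_ u.2.2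
      rw [normSq_eq q w y hy.measurable.aestronglyMeasurable, normSq_eq q w _ u.2.1]
      refine lintegral_congr_ae ?_
      filter_upwards [e] with x hx
      rw [wQuad_congr hx]
    rw [normSq_eq_zero_iff (q := q) u.2.1]
    filter_upwards [e, wMat_mulVec_eq_zero_of_normSq_lt_top hJ hJs hqs hω hq hw hB h0 hL hy hyn]
      with x h1 h2
    rw [h1, h2]
  · rintro rfl
    obtain ⟨f, rfl⟩ := Submodule.Quotient.mk_surjective _ b
    obtain ⟨u, hu, hc⟩ := exists_hasSource_zero hJ h0 0 (locallyIntegrable_wMat_mulVec f.2) 0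
    have hW := hu.wMat_mulVec_eq_zero hJ hJs hqs hB h0 hv hv0 (a := 0) (by
      rw [hc, Matrix.mulVec_zero, dotProduct_zero])
    have hum := hu.measurable.aestronglyMeasurable (μ := w.tr)
    have hn := (normSq_eq_zero_iff hum).2 hW
    obtain ⟨h1, h2⟩ := (hasSource_iff hJ f.2).2 hu
    refine ⟨⟨u, hum, hn.trans_lt ENNReal.zero_lt_top⟩, f, h1, h2, Prod.ext ?_ rfl⟩
    exact ((Submodule.Quotient.mk_eq_zero _).2 hn).symm

end MaximalRelation

/-! ### Uniqueness on two periods in the absence of invisible solutions. -/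

section Periods

variable {J : Matrix (Fin 2) (Fin 2) ℝ} {q : Matrix (Fin 2) (Fin 2) OrderZero} {w : Weight}
  {ω : ℝ}

lemma ae_shift_iff {ν : Measure ℝ} (hν : (ν.map fun x => x + ω) = ν) (p : ℝ → Prop) :
    (∀ᵐ x ∂ν, p (x + ω)) ↔ ∀ᵐ x ∂ν, p x := by
  nth_rw 2 [← hν]
  exact (measurableEmbedding_shift ω).ae_map_iff.symm

lemma leftLim_zero (x : ℝ) : leftLim (0 : ℝ → Fin 2 → ℂ) x = 0 :=
  leftLim_eq_of_tendsto tendsto_const_nhds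

/-- The subspace of the homogeneous solutions that are annihilated by `w` on `s`. -/
def annihilated (J : Matrix (Fin 2) (Fin 2) ℝ) (q : Matrix (Fin 2) (Fin 2) OrderZero) (w : Weight)
    (s : Set ℝ) : Submodule ℂ (solutions J q w 0) where
  carrier := {y | ∀ᵐ x ∂baseMeasure q w, x ∈ s → wMat q w x *ᵥ (y : ℝ → Fin 2 → ℂ) x = 0}
  zero_mem' := by
    rw [mem_ofPred_eq]
    refine Eventually.of_forall fun x _ => ?_
    rw [Submodule.coe_zero, Pi.zero_apply, Matrix.mulVec_zero]
  add_mem' := fun {y z} hy hz => by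
    rw [mem_ofPred_eq] at hy hz ⊢
    filter_upwards [hy, hz] with x h1 h2 hx
    rw [Submodule.coe_add, Pi.add_apply, Matrix.mulVec_add, h1 hx, h2 hx, add_zero]
  smul_mem' := fun c y hy => by
    rw [mem_ofPred_eq] at hy ⊢
    filter_upwards [hy] with x h1 hx
    rw [Submodule.coe_smul, Pi.smul_apply, Matrix.mulVec_smul, h1 hx, smul_zero]

lemma mem_annihilated {s : Set ℝ} {y : solutions J q w 0} : y ∈ annihilated J q w s ↔
    ∀ᵐ x ∂baseMeasure q w, x ∈ s → wMat q w x *ᵥ (y : ℝ → Fin 2 → ℂ) x = 0 := Iff.rfl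

/-- Since `ρ ≠ 0`, the multiplier carries the annihilation from one period to both neighbouring
ones. -/
lemma mem_L0_of_multiplier (hJ : IsUnit J) (hω : 0 < ω) (hq : ∀ i j, (q i j).IsPeriod ω)
    (hw : ∀ i j, (w.entry i j).IsPeriod ω) {y : ℝ → Fin 2 → ℂ} (hy : HasSource J q w y 0) {ρ : ℂ}
    (hρ0 : ρ ≠ 0) (hρ : ∀ x, y (x + ω) = ρ • y x) {a : ℝ}
    (ha : ∀ᵐ x ∂baseMeasure q w, x ∈ Ico a (a + ω) → wMat q w x *ᵥ y x = 0) :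
    y ∈ L0 J q w := by
  have step : ∀ b, (∀ᵐ x ∂baseMeasure q w, x ∈ Ico (b + ω) (b + ω + ω) → wMat q w x *ᵥ y x = 0) ↔
      ∀ᵐ x ∂baseMeasure q w, x ∈ Ico b (b + ω) → wMat q w x *ᵥ y x = 0 := by
    intro b
    rw [← ae_shift_iff (map_shift_base q w hq hw)]
    have hs := wMat_shift q w hq hw
    have e : ∀ x, x + ω ∈ Ico (b + ω) (b + ω + ω) ↔ x ∈ Ico b (b + ω) := fun x => by simp
    constructor
    · intro h
      filter_upwards [h, hs] with x h1 h2 hx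
      have := h1 ((e x).2 hx)
      rw [h2, hρ, Matrix.mulVec_smul] at this
      exact (smul_eq_zero.1 this).resolve_left hρ0
    · intro h
      filter_upwards [h, hs] with x h1 h2 hx
      rw [h2, hρ, Matrix.mulVec_smul, h1 ((e x).1 hx), smul_zero]
  have hall : ∀ n : ℤ, ∀ᵐ x ∂baseMeasure q w,
      x ∈ Ico (a + n • ω) (a + (n + 1) • ω) → wMat q w x *ᵥ y x = 0 := by
    intro n
    have e : ∀ n : ℤ, a + (n + 1) • ω = a + n • ω + ω := fun n => by rw [add_smul, one_smul, add_assoc]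
    rw [e]
    induction n using Int.induction_on with
    | zero => simpa using ha
    | succ n ih => rw [e, step]; exact ih
    | pred n ih =>
      rw [← step]
      have : a + (-(n : ℤ) - 1) • ω + ω = a + (-(n : ℤ)) • ω := by
        rw [sub_smul, one_smul]
        ring
      rw [this]
      exact ih
  rw [mem_L0_iff hJ]
  refine ⟨hy, ?_⟩
  filter_upwards [ae_all_iff.2 hall] with x hx
  have hx' : x ∈ ⋃ n : ℤ, Ico (a + n • ω) (a + (n + 1) • ω) := by
    rw [iUnion_Ico_add_zsmul hω]
    exact mem_univ x
  obtain ⟨n, hn⟩ := mem_iUnion.1 hx'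
  exact hx n hn

lemma ne_zero_of_multiplier {y : ℝ → Fin 2 → ℂ} (hy : y ≠ 0) {ρ : ℂ}
    (hρ : ∀ x, y (x + ω) = ρ • y x) : ρ ≠ 0 := by
  rintro rfl
  refine hy (funext fun x => ?_)
  have := hρ (x - ω)
  rwa [sub_add_cancel, zero_smul] at this

/-- If `𝓛₀ = 0`, a homogeneous solution annihilated by `w` on two periods vanishes. -/
lemma eq_zero_of_wMat_mulVec_eq_zero (hJ : IsUnit J) (hω : 0 < ω)
    (hq : ∀ i j, (q i j).IsPeriod ω) (hw : ∀ i j, (w.entry i j).IsPeriod ω)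
    (h0 : (0 : ℂ) ∉ exceptionalSet J q w) (hL : L0 J q w = ⊥) {y : ℝ → Fin 2 → ℂ}
    (hy : HasSource J q w y 0) {a : ℝ}
    (ha : ∀ᵐ x ∂baseMeasure q w, x ∈ Ico a (a + 2 * ω) → wMat q w x *ᵥ y x = 0) : y = 0 := by
  by_contra hy0
  have hmem : ∀ z : ℝ → Fin 2 → ℂ, z ∈ solutions J q w 0 ↔ HasSource J q w z 0 := fun z => by
    rw [mem_solutions_iff_hasSource hJ]
    simp only [zero_smul]
    rfl
  have : Module.Finite ℂ (solutions J q w 0) := Module.Finite.of_basis (standardBasis hJ h0 0)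
  have hdim : Module.finrank ℂ (solutions J q w 0) = 2 := by
    rw [Module.finrank_eq_card_basis (standardBasis hJ h0 0), Fintype.card_fin]
  set T := monodromyMap hJ hq hw (0 : ℂ)
  set Y : solutions J q w 0 := ⟨y, (hmem y).2 hy⟩
  have hY0 : Y ≠ 0 := fun h => hy0 (congrArg Subtype.val h)
  -- `N` concerns only the first of the two periods; the second one says that the translate of `Y`
  -- lies in `N` too.
  set N := annihilated J q w (Ico a (a + ω)) with hN
  have hYN : Y ∈ N := by
    rw [hN, mem_annihilated]
    filter_upwards [ha] with x h hx
    exact h ⟨hx.1, by linarith [hx.2]⟩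
  have hTYN : T Y ∈ N := by
    rw [hN, mem_annihilated]
    have h := (ae_shift_iff (map_shift_base q w hq hw) _).2 ha
    filter_upwards [h, wMat_shift q w hq hw] with x h hs hx
    have := h ⟨by linarith [hx.1], by linarith [hx.2]⟩
    rw [hs] at this
    exact this
  -- If `N` is everything, any eigenvector of the monodromy will do. Otherwise `N` is a line
  -- containing `Y ≠ 0` and `T Y`, so `Y` is an eigenvector itself. One period would not suffice for
  -- this.
  have key : ∃ z ∈ N, z ≠ 0 ∧ ∃ ρ : ℂ, T z = ρ • z := by
    by_cases hTop : N = ⊤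
    · have : Nontrivial (solutions J q w 0) := ⟨Y, 0, hY0⟩
      obtain ⟨ρ, hρ⟩ := Module.End.exists_eigenvalue T
      obtain ⟨z, hz⟩ := hρ.exists_hasEigenvector
      exact ⟨z, hTop ▸ Submodule.mem_top, hz.2, ρ, hz.apply_eq_smul⟩
    · have h1 := Submodule.finrank_lt hTop
      rw [hdim] at h1
      have h2 : Module.finrank ℂ N ≤ 1 := by omega
      have : Module.Free ℂ N := Module.Free.of_divisionRing ℂ N
      obtain ⟨v, hv⟩ := (finrank_le_one_iff (K := ℂ) (V := N)).1 h2
      obtain ⟨c, hc⟩ := hv ⟨Y, hYN⟩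
      obtain ⟨d, hd⟩ := hv ⟨T Y, hTYN⟩
      have hc' : c • (v : solutions J q w 0) = Y := congrArg Subtype.val hc
      have hd' : d • (v : solutions J q w 0) = T Y := congrArg Subtype.val hd
      have hc0 : c ≠ 0 := by
        rintro rfl
        rw [zero_smul] at hc'
        exact hY0 hc'.symm
      exact ⟨Y, hYN, hY0, d / c, by rw [← hd', ← hc', smul_smul, div_mul_cancel₀ _ hc0]⟩
  obtain ⟨z, hzN, hz0, ρ, hz⟩ := key
  have hz0' : (z : ℝ → Fin 2 → ℂ) ≠ 0 := fun h => hz0 (Subtype.ext h)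
  have hρ : ∀ x, (z : ℝ → Fin 2 → ℂ) (x + ω) = ρ • (z : ℝ → Fin 2 → ℂ) x := fun x =>
    congrFun (congrArg Subtype.val hz) x
  have := mem_L0_of_multiplier hJ hω hq hw ((hmem z).1 z.2) (ne_zero_of_multiplier hz0' hρ) hρ hzN
  rw [hL, Submodule.mem_bot] at this
  exact hz0' this

/-- On the two periods `u` agrees with the homogeneous solution `y` of the same initial value, and
`y` vanishes by `eq_zero_of_wMat_mulVec_eq_zero`. -/
lemma leftLim_eq_zero_of_wMat_mulVec_eq_zero (hJ : IsUnit J) (hω : 0 < ω)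
    (hq : ∀ i j, (q i j).IsPeriod ω) (hw : ∀ i j, (w.entry i j).IsPeriod ω)
    (h0 : (0 : ℂ) ∉ exceptionalSet J q w) (hL : L0 J q w = ⊥) {u h : ℝ → Fin 2 → ℂ}
    (hu : HasSource J q w u h) {a : ℝ}
    (hh : ∀ᵐ x ∂baseMeasure q w, x ∈ Ico a (a + 2 * ω) → h x = 0)
    (ha : ∀ᵐ x ∂baseMeasure q w, x ∈ Ico a (a + 2 * ω) → wMat q w x *ᵥ u x = 0) :
    leftLim u a = 0 ∧ leftLim u (a + 2 * ω) = 0 := by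
  obtain ⟨y, hy, hc⟩ := exists_hasSource_zero hJ h0 a (h := 0) locallyIntegrable_zero (leftLim u a)
  have hd := hu.sub hy
  have h1 := hd.eq_zero_forward hJ h0 (show a ≤ a + 2 * ω by linarith)
    (by rw [leftLim_sub hu hy, hc, sub_self]) (by
      filter_upwards [hh] with x hx hm
      rw [Pi.sub_apply, hx hm, Pi.zero_apply, sub_zero, zero_smul])
  have hy0 : y = 0 := by
    refine eq_zero_of_wMat_mulVec_eq_zero hJ hω hq hw h0 hL hy (a := a) ?_
    filter_upwards [ha] with x hx hm
    have := h1.2 x hm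
    rw [Pi.sub_apply, sub_eq_zero] at this
    rw [← this]
    exact hx hm
  have h2 := h1.1
  rw [leftLim_sub hu hy] at h2
  subst hy0
  rw [leftLim_zero, sub_zero] at h2
  rw [leftLim_zero] at hc
  exact ⟨hc.symm, h2⟩

lemma IsBalancedBV.locallyIntegrable_quad {y : ℝ → Fin 2 → ℂ} (hy : IsBalancedBV y) :
    LocallyIntegrable (fun x => star (y x) ⬝ᵥ wMat q w x *ᵥ y x) (baseMeasure q w) := by
  have h1 := hy.locallyIntegrable_mulVec (locallyIntegrable_wMat q w)
  simp only [dotProduct, mul_comm (star (y _) _)]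
  refine LocallyIntegrable.finset_sum fun i _ => ?_
  refine LocallyIntegrable.mul_bounded (locallyIntegrable_apply h1 i)
    (continuous_star.measurable.comp ((measurable_pi_apply i).comp hy.measurable)) fun K hK => ?_
  obtain ⟨C, hC⟩ := hy.exists_bound hK
  exact ⟨C, fun x hx => by
    rw [Pi.star_apply, norm_star]
    exact hC x hx i⟩

/-- Lagrange's identity for `y` and `u` has no boundary terms, so the integral of the form of `w` at
`ȳ` over two periods is zero. Then `w y = 0` there, as `w` is real, and `y = 0`; but homogeneous
solutions have arbitrary initial values. -/
lemma false_of_forall_exists_compactly_supported (hJ : IsUnit J) (hJs : Jᵀ = -J) (hqs : q.IsSymm)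
    (hω : 0 < ω) (hq : ∀ i j, (q i j).IsPeriod ω) (hw : ∀ i j, (w.entry i j).IsPeriod ω)
    (h0 : (0 : ℂ) ∉ exceptionalSet J q w) (hL : L0 J q w = ⊥)
    (H : ∀ y, HasSource J q w y 0 → ∃ u h, HasSource J q w u h ∧
      (∀ᵐ x ∂baseMeasure q w, x ∈ Ico 0 (2 * ω) → h x = wMat q w x *ᵥ star (y x)) ∧
      leftLim u 0 = 0 ∧ leftLim u (2 * ω) = 0) : False := by
  -- Any nonzero initial value would serve.
  obtain ⟨y, hy, hc⟩ := exists_hasSource_zero hJ h0 0 (h := 0) locallyIntegrable_zero ![1, 0]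
  obtain ⟨u, h, hu, hh, hu0, hu1⟩ := H y hy
  have hlag := hy.lagrange hJ hJs hqs hu (show (0 : ℝ) ≤ 2 * ω by linarith)
  rw [hu0, hu1, Matrix.mulVec_zero, dotProduct_zero, dotProduct_zero, sub_zero] at hlag
  have hys := hy.star hJ
  have hli := hys.isBalancedBV.locallyIntegrable_quad (q := q) (w := w)
  have hI := integrableOn_Ico hli 0 (2 * ω)
  have e : ∫ t in Ico 0 (2 * ω), (y t ⬝ᵥ h t - (0 : ℝ → Fin 2 → ℂ) t ⬝ᵥ u t) ∂baseMeasure q w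
      = ∫ t in Ico 0 (2 * ω), star (star y t) ⬝ᵥ wMat q w t *ᵥ star y t ∂baseMeasure q w := by
    refine integral_congr_ae ((ae_restrict_iff' measurableSet_Ico).2 ?_)
    filter_upwards [hh] with t ht hm
    rw [ht hm, Pi.zero_apply, zero_dotProduct, sub_zero, Pi.star_apply, star_star]
  rw [e] at hlag
  have hI' : IntegrableOn (fun t => wQuad q w t (star y t)) (Ico 0 (2 * ω)) (baseMeasure q w) :=
    hI.re
  have hre : ∫ t in Ico 0 (2 * ω), wQuad q w t (star y t) ∂baseMeasure q w = 0 := by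
    have := integral_re hI
    simp only [RCLike.re_to_complex] at this
    simp only [wQuad]
    rw [this, ← hlag, Complex.zero_re]
  rw [setIntegral_eq_zero_iff_of_nonneg_ae
    (ae_restrict_of_ae (by filter_upwards [wQuad_nonneg q w] with x hx using hx _)) hI'] at hre
  have hy0 : y = 0 := by
    refine eq_zero_of_wMat_mulVec_eq_zero hJ hω hq hw h0 hL hy (a := 0) ?_
    rw [zero_add]
    filter_upwards [(ae_restrict_iff' measurableSet_Ico).1 hre,
      wMat_mulVec_eq_zero_iff (q := q) (w := w)] with x h1 h2 hm
    have := (h2 _).2 (h1 hm)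
    rw [Pi.star_apply, ← star_mulVec_of_real (star_wMat q w x)] at this
    exact star_eq_zero.1 this
  rw [hy0, leftLim_zero] at hc
  have := congrFun hc 0
  simp at this

/-- Degeneracy pairs the cut-off of `ȳ` with a `u` of norm zero. On the two periods before `0` and
the two after `2ω` this `u` is homogeneous and killed by `w`, so it vanishes at `0` and at `2ω`. -/
lemma L0_ne_bot_of_Tmax (hJ : IsUnit J) (hJs : Jᵀ = -J) (hqs : q.IsSymm)
    (hω : 0 < ω) (hq : ∀ i j, (q i j).IsPeriod ω) (hw : ∀ i j, (w.entry i j).IsPeriod ω)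
    (h0 : (0 : ℂ) ∉ exceptionalSet J q w)
    (hT : Tmax J q w = {(0 : L2 w)} ×ˢ (univ : Set (L2 w))) : L0 J q w ≠ ⊥ := by
  intro hL
  refine false_of_forall_exists_compactly_supported hJ hJs hqs hω hq hw h0 hL fun y hy => ?_
  have hys := hy.star hJ
  set f : ℝ → Fin 2 → ℂ := (Ico 0 (2 * ω)).indicator (star y) with hf
  have hfm : Measurable f := hys.measurable.indicator measurableSet_Ico
  have hfl : f ∈ scriptL2 w := by
    refine ⟨hfm.aestronglyMeasurable, ?_⟩
    rw [normSq_eq q w f hfm.aestronglyMeasurable]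
    have hI := (integrableOn_Ico (hys.isBalancedBV.locallyIntegrable_quad (q := q) (w := w))
      0 (2 * ω)).re
    refine lt_of_le_of_lt ?_ hI.lintegral_lt_top
    rw [← lintegral_indicator measurableSet_Ico]
    refine lintegral_mono fun x => ?_
    by_cases hx : x ∈ Ico 0 (2 * ω)
    · rw [indicator_of_mem hx, hf, indicator_of_mem hx]
      rfl
    · rw [indicator_of_notMem hx, hf, indicator_of_notMem hx]
      simp [wQuad]
  set F : scriptL2 w := ⟨f, hfl⟩
  have hmem : ((0 : L2 w), (Submodule.Quotient.mk F : L2 w)) ∈ Tmax J q w := by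
    rw [hT]
    exact ⟨rfl, mem_univ _⟩
  obtain ⟨u, g, hu, hs, he⟩ := hmem
  obtain ⟨e1, e2⟩ := Prod.ext_iff.1 he
  have hu0 : w.normSq (u : ℝ → Fin 2 → ℂ) = 0 := (Submodule.Quotient.mk_eq_zero (nullL2 w)).1 e1.symm
  have hWu := (normSq_eq_zero_iff (q := q) u.2.1).1 hu0
  have hfg : ∀ᵐ x ∂baseMeasure q w, wMat q w x *ᵥ (g : ℝ → Fin 2 → ℂ) x = wMat q w x *ᵥ f x := by
    have h1 : w.normSq ((g - F : scriptL2 w) : ℝ → Fin 2 → ℂ) = 0 :=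
      (Submodule.Quotient.eq (nullL2 w)).1 e2.symm
    have h2 := (normSq_eq_zero_iff (q := q) (g - F).2.1).1 h1
    filter_upwards [h2] with x hx
    rw [Submodule.coe_sub, Pi.sub_apply, Matrix.mulVec_sub, sub_eq_zero] at hx
    exact hx
  have hsrc := ((hasSource_iff hJ g.2).1 ⟨hu, hs⟩).congr hfg
  refine ⟨u, _, hsrc, ?_, ?_, ?_⟩
  · refine Eventually.of_forall fun x hx => ?_
    simp only [hf, indicator_of_mem hx, Pi.star_apply]
  · have := (leftLim_eq_zero_of_wMat_mulVec_eq_zero hJ hω hq hw h0 hL hsrc (a := -(2 * ω)) ?_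
      (by filter_upwards [hWu] with x hx _ using hx)).2
    · rwa [neg_add_cancel] at this
    · rw [neg_add_cancel]
      refine Eventually.of_forall fun x hx => ?_
      simp only [hf]
      rw [indicator_of_notMem (fun h => absurd h.1 (not_le.2 hx.2)), Matrix.mulVec_zero]
  · refine (leftLim_eq_zero_of_wMat_mulVec_eq_zero hJ hω hq hw h0 hL hsrc (a := 2 * ω) ?_
      (by filter_upwards [hWu] with x hx _ using hx)).1
    refine Eventually.of_forall fun x hx => ?_
    simp only [hf]
    rw [indicator_of_notMem (fun h => absurd h.2 (not_lt.2 hx.1)), Matrix.mulVec_zero]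

end Periods

/-! ### Compact symmetric operators without nonzero eigenvalues. -/

section Compactness

open scoped InnerProductSpace

/-- An operator on a separable Hilbert space that maps bounded weakly convergent sequences to
convergent ones is compact. -/
lemma isCompactOperator_of_weak {H : Type*} [NormedAddCommGroup H] [InnerProductSpace ℂ H]
    [CompleteSpace H] [TopologicalSpace.SeparableSpace H] (K : H →L[ℂ] H)
    (hK : ∀ (g : ℕ → H) (g₀ : H), (∀ n, ‖g n‖ ≤ 1) → ‖g₀‖ ≤ 1 →
      (∀ y, Tendsto (fun n => ⟪g n, y⟫_ℂ) atTop (𝓝 ⟪g₀, y⟫_ℂ)) →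
      Tendsto (fun n => K (g n)) atTop (𝓝 (K g₀))) : IsCompactOperator K := by
  refine (isCompactOperator_iff_image_closedBall_subset_compact (K : H →ₗ[ℂ] H) one_pos).2
    ⟨K '' Metric.closedBall 0 1, IsSeqCompact.isCompact ?_, subset_rfl⟩
  intro z hz
  choose g hg hgz using hz
  have hg' : ∀ n, ‖g n‖ ≤ 1 := fun n => by simpa using hg n
  have hmem : ∀ n, StrongDual.toWeakDual (InnerProductSpace.toDual ℂ H (g n)) ∈
      WeakDual.toStrongDual ⁻¹' Metric.closedBall (0 : StrongDual ℂ H) 1 := by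
    intro n
    simpa using hg' n
  -- By separability the closed dual ball is weak-* sequentially compact, which yields a weakly
  -- convergent subsequence.
  obtain ⟨φ, hφ, m, hm, hlim⟩ := WeakDual.isSeqCompact_closedBall ℂ H 0 1 hmem
  set g₀ := (InnerProductSpace.toDual ℂ H).symm (WeakDual.toStrongDual φ) with hg₀
  have hn : ‖g₀‖ ≤ 1 := by simpa [hg₀] using hφ
  refine ⟨K g₀, ⟨g₀, by simpa using hn, rfl⟩, m, hm, ?_⟩
  have := hK (g ∘ m) g₀ (fun n => hg' _) hn fun y => by
    have h := (WeakDual.eval_continuous y).tendsto φ |>.comp hlim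
    have e : ⟪g₀, y⟫_ℂ = φ y := by
      rw [hg₀, InnerProductSpace.toDual_symm_apply]
      rfl
    rw [e]
    exact h
  refine this.congr fun n => ?_
  exact hgz (m n)

/-- A Hilbert space of square integrable functions needs the Euclidean norm, whereas `Fin 2 → ℂ`
carries the supremum norm. -/
abbrev Plane : Type := EuclideanSpace ℂ (Fin 2)

variable {μ : Measure ℝ} {F : Lp Plane 2 μ →ₗ[ℂ] (ℝ → Plane)} {s : ℝ → ℝ}

lemma memLp_of_bound (hs : MemLp s 2 μ) (hF : ∀ g x, ‖F g x‖ ≤ s x * ‖g‖)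
    (hm : ∀ g, AEStronglyMeasurable (F g) μ) (g : Lp Plane 2 μ) : MemLp (F g) 2 μ := by
  refine hs.of_le_mul (c := ‖g‖) (hm g) (Eventually.of_forall fun x => ?_)
  rw [mul_comm]
  exact (hF g x).trans (mul_le_mul_of_nonneg_right (le_abs_self _) (norm_nonneg _))

/-- The operator on `L²` given by a family of functionals with square integrable norms. -/
def carlemanOperator (hs : MemLp s 2 μ) (hF : ∀ g x, ‖F g x‖ ≤ s x * ‖g‖)
    (hm : ∀ g, AEStronglyMeasurable (F g) μ) : Lp Plane 2 μ →L[ℂ] Lp Plane 2 μ :=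
  LinearMap.mkContinuous
    { toFun := fun g => (memLp_of_bound hs hF hm g).toLp (F g)
      map_add' := fun g h => by
        rw [← MemLp.toLp_add]
        congr 1
        exact map_add F g h
      map_smul' := fun c g => by
        rw [RingHom.id_apply, ← MemLp.toLp_const_smul]
        congr 1
        exact map_smul F c g } ‖hs.toLp s‖ fun g => by
    rw [mul_comm]
    refine Lp.norm_le_mul_norm_of_ae_le_mul ?_
    filter_upwards [(memLp_of_bound hs hF hm g).coeFn_toLp, hs.coeFn_toLp] with x h1 h2
    change ‖(memLp_of_bound hs hF hm g).toLp (F g) x‖ ≤ _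
    rw [h1, h2, mul_comm]
    exact (hF g x).trans (mul_le_mul_of_nonneg_right (le_abs_self _) (norm_nonneg _))

lemma carlemanOperator_ae (hs : MemLp s 2 μ) (hF : ∀ g x, ‖F g x‖ ≤ s x * ‖g‖)
    (hm : ∀ g, AEStronglyMeasurable (F g) μ) (g : Lp Plane 2 μ) :
    carlemanOperator hs hF hm g =ᵐ[μ] F g :=
  (memLp_of_bound hs hF hm g).coeFn_toLp

lemma norm_sq_eq_integral (f : Lp Plane 2 μ) : ‖f‖ ^ 2 = ∫ x, ‖f x‖ ^ 2 ∂μ := by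
  have h : ((‖f‖ ^ 2 : ℝ) : ℂ) = ((∫ x, ‖f x‖ ^ 2 ∂μ : ℝ) : ℂ) := by
    push_cast
    refine (inner_self_eq_norm_sq_to_K (𝕜 := ℂ) f).symm.trans ?_
    rw [L2.inner_def, ← integral_complex_ofReal]
    refine integral_congr_ae (Eventually.of_forall fun x => ?_)
    refine (inner_self_eq_norm_sq_to_K (𝕜 := ℂ) (f x)).trans ?_
    push_cast
    rfl
  exact_mod_cast h

/-- For fixed `x`, each component of `g ↦ F g x` is a bounded functional, hence an inner product
with a fixed element. -/
lemma tendsto_norm_sq_of_weak (hF : ∀ g x, ‖F g x‖ ≤ s x * ‖g‖) {d : ℕ → Lp Plane 2 μ}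
    (hd : ∀ y, Tendsto (fun n => ⟪d n, y⟫_ℂ) atTop (𝓝 0)) (x : ℝ) :
    Tendsto (fun n => ‖F (d n) x‖ ^ 2) atTop (𝓝 0) := by
  set ℓ : Lp Plane 2 μ →L[ℂ] Plane := LinearMap.mkContinuous ((LinearMap.proj x).comp F) (s x)
    fun g => hF g x
  have hi : ∀ i : Fin 2, Tendsto (fun n => ‖F (d n) x i‖ ^ 2) atTop (𝓝 0) := by
    intro i
    set y := (InnerProductSpace.toDual ℂ (Lp Plane 2 μ)).symm ((EuclideanSpace.proj i).comp ℓ)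
    have e : ∀ n, F (d n) x i = ⟪y, d n⟫_ℂ := by
      intro n
      rw [InnerProductSpace.toDual_symm_apply]
      rfl
    have h := (hd y).norm.pow 2
    rw [norm_zero, zero_pow two_ne_zero] at h
    refine h.congr fun n => ?_
    rw [e, norm_inner_symm]
  have h := (hi 0).add (hi 1)
  rw [add_zero] at h
  refine h.congr fun n => ?_
  rw [EuclideanSpace.norm_sq_eq, Fin.sum_univ_two]

/-- Weak convergence gives pointwise convergence of the images. The square integrable bound `s` then
yields norm convergence by domination. -/
lemma isCompactOperator_carlemanOperator [SFinite μ] (hs : MemLp s 2 μ)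
    (hF : ∀ g x, ‖F g x‖ ≤ s x * ‖g‖) (hm : ∀ g, AEStronglyMeasurable (F g) μ) :
    IsCompactOperator (carlemanOperator hs hF hm) := by
  have : Fact ((2 : ℝ≥0∞) ≠ ∞) := ⟨ENNReal.ofNat_ne_top⟩
  refine isCompactOperator_of_weak _ fun g g₀ hg hg₀ hlim => ?_
  set K := carlemanOperator hs hF hm
  have hd : ∀ y, Tendsto (fun n => ⟪g n - g₀, y⟫_ℂ) atTop (𝓝 0) := by
    intro y
    have := (hlim y).sub_const ⟪g₀, y⟫_ℂ
    rw [sub_self] at this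
    refine this.congr fun n => ?_
    rw [inner_sub_left]
  have hn : ∀ n, ‖g n - g₀‖ ≤ 2 := fun n => (norm_sub_le _ _).trans (by linarith [hg n])
  have h2 : Tendsto (fun n => ‖K (g n - g₀)‖ ^ 2) atTop (𝓝 0) := by
    have e : ∀ n, ‖K (g n - g₀)‖ ^ 2 = ∫ x, ‖F (g n - g₀) x‖ ^ 2 ∂μ := by
      intro n
      rw [norm_sq_eq_integral]
      refine integral_congr_ae ?_
      filter_upwards [carlemanOperator_ae hs hF hm (g n - g₀)] with x hx
      rw [hx]
    simp only [e]
    -- The constant `4` is the square of the bound `2` for the differences of elements of the unit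
    -- ball.
    have := tendsto_integral_of_dominated_convergence (μ := μ) (f := fun _ => (0 : ℝ))
      (F := fun n x => ‖F (g n - g₀) x‖ ^ 2) (fun x => 4 * (s x) ^ 2)
      (fun n => ((hm _).norm.pow 2)) (hs.integrable_sq.const_mul 4)
      (fun n => Eventually.of_forall fun x => ?_)
      (Eventually.of_forall fun x => tendsto_norm_sq_of_weak hF hd x)
    · simpa using this
    · rw [Real.norm_of_nonneg (by positivity)]
      have h1 := hF (g n - g₀) x
      have h3 : ‖F (g n - g₀) x‖ ≤ |s x| * 2 :=
        h1.trans (mul_le_mul (le_abs_self _) (hn n) (norm_nonneg _) (abs_nonneg _))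
      calc ‖F (g n - g₀) x‖ ^ 2 ≤ (|s x| * 2) ^ 2 := by gcongr
        _ = 4 * s x ^ 2 := by rw [mul_pow, sq_abs]; ring
  rw [tendsto_iff_norm_sub_tendsto_zero]
  have h3 := h2.sqrt
  rw [Real.sqrt_zero] at h3
  refine h3.congr fun n => ?_
  rw [Real.sqrt_sq (norm_nonneg _), map_sub]

/-- The spectral theorem: a compact symmetric operator without nonzero eigenvalues is zero. Symmetry
makes eigenvalues real, so only real `κ` have to be excluded. -/
lemma carlemanOperator_eq_zero [SFinite μ] (hs : MemLp s 2 μ)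
    (hF : ∀ g x, ‖F g x‖ ≤ s x * ‖g‖) (hm : ∀ g, AEStronglyMeasurable (F g) μ)
    (hsym : ∀ g h : Lp Plane 2 μ, ∫ x, ⟪F g x, h x⟫_ℂ ∂μ = ∫ x, ⟪g x, F h x⟫_ℂ ∂μ)
    (heig : ∀ (κ : ℝ) (g : Lp Plane 2 μ), κ ≠ 0 → F g =ᵐ[μ] (κ : ℂ) • ⇑g → g = 0)
    (g : Lp Plane 2 μ) : F g =ᵐ[μ] 0 := by
  set K := carlemanOperator hs hF hm with hK
  have hsymm : K.IsSymmetric := by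
    intro g h
    change ⟪K g, h⟫_ℂ = ⟪g, K h⟫_ℂ
    rw [L2.inner_def, L2.inner_def]
    refine Eq.trans (integral_congr_ae ?_) ((hsym g h).trans (integral_congr_ae ?_))
    · filter_upwards [carlemanOperator_ae hs hF hm g] with x hx
      rw [hx]
    · filter_upwards [carlemanOperator_ae hs hF hm h] with x hx
      rw [hx]
  have h0 : K = 0 := by
    refine (ContinuousLinearMap.eq_zero_of_forall_hasEigenvalue_eq_zero
      (isCompactOperator_carlemanOperator hs hF hm) hsymm).1 fun κ hκ => ?_
    by_contra hne
    have hreal := hsymm.conj_eigenvalue_eq_self hκ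
    obtain ⟨r, rfl⟩ := Complex.conj_eq_iff_real.1 hreal
    obtain ⟨g, hg⟩ := hκ.exists_hasEigenvector
    refine hg.2 (heig r g (fun h => hne (by rw [h, Complex.ofReal_zero])) ?_)
    have h1 : K g = (r : ℂ) • g := hg.apply_eq_smul
    have h2 := carlemanOperator_ae hs hF hm g
    rw [← hK, h1] at h2
    exact h2.symm.trans (Lp.coeFn_smul _ _)
  have h2 := carlemanOperator_ae hs hF hm g
  rw [← hK, h0] at h2
  exact h2.symm.trans (Lp.coeFn_zero _ _ _)

end Compactness

/-! ### The square root of the weight. -/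

section Root

variable (q : Matrix (Fin 2) (Fin 2) OrderZero) (w : Weight)

/-- The square root of the determinant of the density of `w`. -/
def wSqrtDet (x : ℝ) : ℝ :=
  √((w.entry 0 0).density (baseMeasure q w) x * (w.entry 1 1).density (baseMeasure q w) x
    - (w.entry 0 1).density (baseMeasure q w) x ^ 2)

/-- The positive square root of the density of `w`. -/
def wRoot (x : ℝ) : Matrix (Fin 2) (Fin 2) ℂ :=
  (((√(wTrace q w x + 2 * wSqrtDet q w x))⁻¹ : ℝ) : ℂ) • (wMat q w x + (wSqrtDet q w x : ℂ) • 1)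

variable {q w}

lemma star_wRoot (x : ℝ) (i j : Fin 2) : star (wRoot q w x i j) = wRoot q w x i j := by
  fin_cases i <;> fin_cases j <;> simp [wRoot, wMat]

lemma wRoot_transpose (x : ℝ) : (wRoot q w x)ᵀ = wRoot q w x := by
  rw [wRoot, Matrix.transpose_smul, Matrix.transpose_add, Matrix.transpose_smul,
    Matrix.transpose_one, wMat_transpose]

lemma measurable_wRoot (i j : Fin 2) : Measurable fun x => wRoot q w x i j := by
  have hd : ∀ i j, Measurable ((w.entry i j).density (baseMeasure q w)) := fun i j =>
    OrderZero.measurable_density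
  have h1 : Measurable (wSqrtDet q w) :=
    (((hd 0 0).mul (hd 1 1)).sub ((hd 0 1).pow_const 2)).sqrt
  have h2 : Measurable (wTrace q w) := (hd 0 0).add (hd 1 1)
  simp only [wRoot, Matrix.smul_apply, Matrix.add_apply, smul_eq_mul]
  exact (Complex.measurable_ofReal.comp ((h2.add (h1.const_mul 2)).sqrt.inv)).mul
    ((measurable_wMat q w i j).add ((Complex.measurable_ofReal.comp h1).mul_const _))

/-- With `δ² = det W`, Cayley–Hamilton gives `(W + δ)² = (tr W + 2δ) W`. If the factor `tr W + 2δ`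
is zero, then `W = 0` and the convention `0⁻¹ = 0` gives the right value. -/
lemma wRoot_mul_wRoot : ∀ᵐ x ∂baseMeasure q w, wRoot q w x * wRoot q w x = wMat q w x := by
  filter_upwards [wMat_form_nonneg (q := q) (w := w)] with x h
  obtain ⟨ha, hd, hdet⟩ := nonneg_of_form_nonneg h
  have hs : (w.entry 1 0).density (baseMeasure q w) x = (w.entry 0 1).density (baseMeasure q w) x := by
    rw [entry_symm w]
  have hδ0 : 0 ≤ wSqrtDet q w x := Real.sqrt_nonneg _
  have hδ : wSqrtDet q w x ^ 2 = (w.entry 0 0).density (baseMeasure q w) x *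
      (w.entry 1 1).density (baseMeasure q w) x - (w.entry 0 1).density (baseMeasure q w) x ^ 2 :=
    Real.sq_sqrt (sub_nonneg.2 hdet)
  have hT : wTrace q w x = (w.entry 0 0).density (baseMeasure q w) x
      + (w.entry 1 1).density (baseMeasure q w) x := rfl
  have hsum : 0 ≤ wTrace q w x + 2 * wSqrtDet q w x := by rw [hT]; linarith
  have hsq := Real.sq_sqrt hsum
  have e : ∀ i j, wMat q w x i j = ((w.entry i j).density (baseMeasure q w) x : ℂ) :=
    fun i j => rfl
  rw [wRoot]
  set δ := wSqrtDet q w x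
  set r := √(wTrace q w x + 2 * δ)
  set a := (w.entry 0 0).density (baseMeasure q w) x
  set b := (w.entry 0 1).density (baseMeasure q w) x
  set d := (w.entry 1 1).density (baseMeasure q w) x
  rcases eq_or_ne r 0 with h0 | h0
  · rw [h0, zero_pow two_ne_zero, hT] at hsq
    have ha0 : a = 0 := by linarith
    have hd0 : d = 0 := by linarith
    have hb0 : b = 0 := by
      rw [ha0, zero_mul] at hdet
      exact pow_eq_zero_iff two_ne_zero |>.1 (le_antisymm hdet (sq_nonneg _))
    have hW : wMat q w x = 0 := by
      ext i j
      rw [e]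
      fin_cases i <;> fin_cases j <;> simp [hs, a, b, d] at * <;> assumption
    simp [h0, hW]
  · have hr : (r⁻¹ : ℝ) * r⁻¹ * (a + d + 2 * δ) = 1 := by
      rw [← hT, ← hsq]
      field_simp
    have hrC : ((r⁻¹ : ℝ) : ℂ) * (r⁻¹ : ℝ) * (a + d + 2 * δ) = 1 := by exact_mod_cast hr
    have hδC : (δ : ℂ) ^ 2 = a * d - b ^ 2 := by exact_mod_cast hδ
    rw [Complex.ofReal_inv] at hrC
    refine Matrix.ext ?_
    simp only [Fin.forall_fin_two, Matrix.mul_apply, Fin.sum_univ_two, Matrix.smul_apply,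
      Matrix.add_apply, smul_eq_mul, e, hs, Matrix.one_apply, if_true, zero_ne_one, one_ne_zero,
      if_false, Complex.ofReal_inv, mul_one, mul_zero, add_zero,
      show (w.entry 0 0).density (baseMeasure q w) x = a from rfl,
      show (w.entry 0 1).density (baseMeasure q w) x = b from rfl,
      show (w.entry 1 1).density (baseMeasure q w) x = d from rfl]
    refine ⟨⟨?_, ?_⟩, ?_, ?_⟩
    · linear_combination (a : ℂ) * hrC + (r : ℂ)⁻¹ * (r : ℂ)⁻¹ * hδC
    · linear_combination (b : ℂ) * hrC
    · linear_combination (b : ℂ) * hrC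
    · linear_combination (d : ℂ) * hrC + (r : ℂ)⁻¹ * (r : ℂ)⁻¹ * hδC

/-- The squares of the entries of `√W` add up to `tr W`, and Cauchy–Schwarz for four summands gives
the factor `4`. -/
lemma entrySum_wRoot_sq_le : ∀ᵐ x ∂baseMeasure q w,
    entrySum (wRoot q w x) ^ 2 ≤ 4 * wTrace q w x := by
  filter_upwards [wRoot_mul_wRoot (q := q) (w := w)] with x hx
  have hsq : ∀ i j, wRoot q w x i j * wRoot q w x j i = ((‖wRoot q w x i j‖ ^ 2 : ℝ) : ℂ) := by
    intro i j
    have h1 : wRoot q w x j i = wRoot q w x i j := congrFun (congrFun (wRoot_transpose x) i) j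
    rw [h1]
    nth_rw 2 [← star_wRoot]
    rw [Complex.star_def, Complex.mul_conj, Complex.normSq_eq_norm_sq]
  have htr : ((wTrace q w x : ℝ) : ℂ) = ((‖wRoot q w x 0 0‖ ^ 2 + ‖wRoot q w x 0 1‖ ^ 2
      + ‖wRoot q w x 1 0‖ ^ 2 + ‖wRoot q w x 1 1‖ ^ 2 : ℝ) : ℂ) := by
    have h0 := congrFun (congrFun hx 0) 0
    have h1 := congrFun (congrFun hx 1) 1
    rw [Matrix.mul_apply, Fin.sum_univ_two, hsq, hsq] at h0 h1
    rw [wTrace, Complex.ofReal_add]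
    change wMat q w x 0 0 + wMat q w x 1 1 = _
    rw [← h0, ← h1]
    push_cast
    ring
  rw [Complex.ofReal_inj.1 htr]
  simp only [entrySum, Fin.sum_univ_two]
  nlinarith [sq_nonneg (‖wRoot q w x 0 0‖ - ‖wRoot q w x 0 1‖),
    sq_nonneg (‖wRoot q w x 0 0‖ - ‖wRoot q w x 1 0‖),
    sq_nonneg (‖wRoot q w x 0 0‖ - ‖wRoot q w x 1 1‖),
    sq_nonneg (‖wRoot q w x 0 1‖ - ‖wRoot q w x 1 0‖),
    sq_nonneg (‖wRoot q w x 0 1‖ - ‖wRoot q w x 1 1‖),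
    sq_nonneg (‖wRoot q w x 1 0‖ - ‖wRoot q w x 1 1‖)]

lemma memLp_entrySum_wRoot {s : Set ℝ} (hs : Bornology.IsBounded s) :
    MemLp (fun x => entrySum (wRoot q w x)) 2 ((baseMeasure q w).restrict s) := by
  have hm : Measurable fun x => entrySum (wRoot q w x) := measurable_entrySum measurable_wRoot
  rw [memLp_two_iff_integrable_sq hm.aestronglyMeasurable]
  refine Integrable.mono' ((integrableOn_wTrace (q := q) (w := w) hs).const_mul 4)
    (hm.pow_const 2).aestronglyMeasurable (ae_restrict_of_ae ?_)
  filter_upwards [entrySum_wRoot_sq_le (q := q) (w := w)] with x hx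
  rwa [Real.norm_of_nonneg (sq_nonneg _)]

end Root

/-! ### Quasi-periodic boundary value problems on two periods. -/

section BoundaryValues

variable {J : Matrix (Fin 2) (Fin 2) ℝ} {q : Matrix (Fin 2) (Fin 2) OrderZero} {w : Weight}
  {ω : ℝ} {lam z : ℂ}

/-- By uniqueness the boundary condition extends to `y(x + 2ω) = z y(x)` for all `x`. A nonzero `y`
would then make `z` a two-period multiplier, which `hz` excludes. -/
lemma eq_zero_of_boundary (hJ : IsUnit J) (hJs : Jᵀ = -J) (hqs : q.IsSymm) (hω : 0 < ω)
    (hq : ∀ i j, (q i j).IsPeriod ω) (hw : ∀ i j, (w.entry i j).IsPeriod ω)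
    (hlam : lam ∉ exceptionalSet J q w) (hz : (z + 1) ^ 2 ≠ discriminant J q w ω lam ^ 2 * z)
    {y : ℝ → Fin 2 → ℂ} (hy : y ∈ solutions J q w lam)
    (hb : leftLim y (2 * ω) = z • leftLim y 0) : y = 0 := by
  by_contra h0
  apply hz
  refine discriminant_of_multiplier_two hJ hJs hqs hω hq hw hlam hy h0 fun x => ?_
  have h1 := translate_mem_solutions hJ hq hw (translate_mem_solutions hJ hq hw hy)
  have h2 := (solutions J q w lam).sub_mem h1 ((solutions J q w lam).smul_mem z hy)
  have hs := (mem_solutions_iff_hasSource hJ).1 hy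
  have hs1 := (mem_solutions_iff_hasSource hJ).1 h1
  have h3 := ((mem_solutions_iff_hasSource hJ).1 h2).eq_zero hJ hlam (a := 0) (by
    rw [leftLim_sub hs1 (hs.smul z), leftLim_smul hs, sub_eq_zero, ← hb]
    change leftLim (fun t => translate ω y (t + ω)) 0 = _
    rw [leftLim_shift ω ((mem_solutions_iff_hasSource hJ).1 (translate_mem_solutions hJ hq hw hy))]
    change leftLim (fun t => y (t + ω)) _ = _
    rw [leftLim_shift ω hs]
    congr 1
    ring) (Eventually.of_forall fun _ => rfl)
  have h4 := congrFun h3 x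
  rw [Pi.sub_apply, Pi.zero_apply, sub_eq_zero, translate_apply, translate_apply,
    Pi.smul_apply] at h4
  rw [← h4]
  congr 1
  ring

lemma mem_solutions_zero_iff (hJ : IsUnit J) {u : ℝ → Fin 2 → ℂ} :
    u ∈ solutions J q w 0 ↔ HasSource J q w u 0 := by
  rw [mem_solutions_iff_hasSource hJ]
  simp only [zero_smul]
  rfl

lemma norm_leftLim_le {u h : ℝ → Fin 2 → ℂ} (hu : HasSource J q w u h) {a b C : ℝ} (hab : a < b)
    (hC : ∀ x ∈ Ico a b, ‖u x‖ ≤ C) : ‖leftLim u b‖ ≤ C := by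
  refine le_of_tendsto (hu.tendsto_leftLim b).norm ?_
  filter_upwards [Ico_mem_nhdsLT hab] with x hx using hC x hx

/-- Inhomogeneous quasi-periodic boundary value problems. -/
lemma exists_hasSource_boundary (hJ : IsUnit J) (hω : 0 < ω) (h0 : (0 : ℂ) ∉ exceptionalSet J q w)
    (hz : ∀ y ∈ solutions J q w 0, leftLim y (2 * ω) = z • leftLim y 0 → y = 0) :
    ∃ C, 0 ≤ C ∧ ∀ h : ℝ → Fin 2 → ℂ, LocallyIntegrable h (baseMeasure q w) →
      ∃ u, HasSource J q w u h ∧ leftLim u (2 * ω) = z • leftLim u 0 ∧ ∀ x ∈ Ico 0 (2 * ω),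
        ‖u x‖ ≤ C * ∫ t in Metric.closedBall 0 (2 * ω), ‖h t‖ ∂baseMeasure q w := by
  obtain ⟨C, hC, H⟩ := exists_hasSource (q := q) (w := w) hJ h0 0 (2 * ω)
  simp only [zero_smul, zero_add] at H
  have hsub : Ico 0 (2 * ω) ⊆ Metric.closedBall 0 (2 * ω) := fun x hx => by
    rw [Real.closedBall_eq_Icc]
    exact ⟨by linarith [hx.1], by linarith [hx.2]⟩
  -- `L` sends the initial value of a homogeneous solution to its defect in the boundary condition.
  -- It is injective by `hz`, hence invertible, so a homogeneous solution can be added to remove the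
  -- defect of the solution starting from zero.
  set L : (Fin 2 → ℂ) →ₗ[ℂ] (Fin 2 → ℂ) :=
    (leftLimMap (q := q) (w := w) hJ 0 (2 * ω) - z • leftLimMap hJ 0 0) ∘ₗ
      (leftLimEquiv hJ h0 0).symm.toLinearMap with hL
  have hLe : ∀ y : solutions J q w 0, L (leftLim (y : ℝ → Fin 2 → ℂ) 0)
      = leftLim (y : ℝ → Fin 2 → ℂ) (2 * ω) - z • leftLim (y : ℝ → Fin 2 → ℂ) 0 := by
    intro y
    rw [← leftLimEquiv_apply hJ h0 0 y, hL, LinearMap.comp_apply, LinearEquiv.coe_coe,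
      LinearEquiv.symm_apply_apply]
    rfl
  have hinj : Function.Injective L := by
    rw [← LinearMap.ker_eq_bot, LinearMap.ker_eq_bot']
    intro c hc
    obtain ⟨y, rfl⟩ := (leftLimEquiv (q := q) (w := w) hJ h0 0).surjective c
    rw [leftLimEquiv_apply, hLe, sub_eq_zero] at hc
    have : y = 0 := Subtype.ext (hz y y.2 hc)
    rw [this, map_zero]
  set N : (Fin 2 → ℂ) →L[ℂ] (Fin 2 → ℂ) :=
    (LinearEquiv.ofInjectiveEndo L hinj).symm.toLinearMap.toContinuousLinearMap with hN
  have hLN : ∀ c, L (N c) = c := fun c => (LinearEquiv.ofInjectiveEndo L hinj).apply_symm_apply c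
  refine ⟨C + C * (‖N‖ * C), by positivity, fun h hh => ?_⟩
  set I := ∫ t in Metric.closedBall 0 (2 * ω), ‖h t‖ ∂baseMeasure q w with hI
  have hI0 : 0 ≤ I := integral_nonneg fun _ => norm_nonneg _
  obtain ⟨u, hu, hu0, hub⟩ := H h hh 0
  rw [norm_zero, zero_add] at hub
  obtain ⟨y, hy, hy0, hyb⟩ := H 0 locallyIntegrable_zero (-(N (leftLim u (2 * ω))))
  simp only [Pi.zero_apply, norm_zero, integral_zero, add_zero, norm_neg] at hyb
  have hsum := hu.add hy
  rw [show (h + fun x => (0 : ℝ → Fin 2 → ℂ) x) = h from add_zero h] at hsum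
  have hlim : ‖leftLim u (2 * ω)‖ ≤ C * I :=
    norm_leftLim_le hu (by linarith) fun x hx => hub x (hsub hx)
  refine ⟨u + y, hsum, ?_, fun x hx => ?_⟩
  · have h1 := hLe ⟨y, (mem_solutions_zero_iff hJ).2 hy⟩
    change L (leftLim y 0) = leftLim y (2 * ω) - z • leftLim y 0 at h1
    rw [hy0, map_neg, hLN, ← hy0] at h1
    rw [leftLim_add hu hy, leftLim_add hu hy, hu0, zero_add]
    linear_combination -h1
  · calc ‖(u + y) x‖ ≤ ‖u x‖ + ‖y x‖ := norm_add_le _ _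
      _ ≤ C * I + C * (‖N‖ * (C * I)) := by
        refine add_le_add (hub x (hsub hx)) ((hyb x (hsub hx)).trans ?_)
        gcongr
        exact (N.le_opNorm _).trans (by gcongr)
      _ = _ := by ring

end BoundaryValues

/-! ### The solution operator for sources built with the root of the weight. -/

section Resolvent

open scoped InnerProductSpace

variable {J : Matrix (Fin 2) (Fin 2) ℝ} {q : Matrix (Fin 2) (Fin 2) OrderZero} {w : Weight}
  {ω : ℝ} {z : ℂ}

lemma integral_mul_norm_le {μ : Measure ℝ} {s : ℝ → ℝ} (hs : MemLp s 2 μ) (g : Lp Plane 2 μ) :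
    Integrable (fun x => s x * ‖g x‖) μ ∧ ∫ x, s x * ‖g x‖ ∂μ ≤ ‖hs.toLp s‖ * ‖g‖ := by
  have hg := (Lp.memLp g).norm
  refine ⟨hs.integrable_mul hg, ?_⟩
  have h1 : ‖hg.toLp‖ = ‖g‖ := by
    rw [Lp.norm_toLp, eLpNorm_norm, ← Lp.norm_def]
  have h2 := real_inner_le_norm (hs.toLp s) (hg.toLp)
  rw [h1, L2.inner_def] at h2
  refine le_of_eq_of_le (integral_congr_ae ?_) h2
  filter_upwards [hs.coeFn_toLp, hg.coeFn_toLp] with x e1 e2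
  rw [e1, e2]
  simp [mul_comm]

variable (q w ω) in
/-- The source `√W g` on two periods. -/
def rootSource (g : ℝ → Plane) : ℝ → Fin 2 → ℂ :=
  (Ico 0 (2 * ω)).indicator fun x => wRoot q w x *ᵥ (g x).ofLp

lemma measurable_ofLp {g : ℝ → Plane} (hg : Measurable g) : Measurable fun x => (g x).ofLp :=
  (PiLp.continuous_ofLp 2 _).measurable.comp hg

lemma norm_ofLp_le (v : Plane) : ‖v.ofLp‖ ≤ ‖v‖ :=
  (pi_norm_le_iff_of_nonneg (norm_nonneg _)).2 fun i => PiLp.norm_apply_le v i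

lemma norm_toLp_le (v : Fin 2 → ℂ) : ‖(WithLp.toLp 2 v : Plane)‖ ≤ 2 * ‖v‖ := by
  have h : ‖(WithLp.toLp 2 v : Plane)‖ ^ 2 ≤ (2 * ‖v‖) ^ 2 := by
    rw [EuclideanSpace.norm_sq_eq, Fin.sum_univ_two]
    have h0 := norm_le_pi_norm v 0
    have h1 := norm_le_pi_norm v 1
    change ‖v 0‖ ^ 2 + ‖v 1‖ ^ 2 ≤ _
    nlinarith [norm_nonneg (v 0), norm_nonneg (v 1)]
  exact (sq_le_sq₀ (norm_nonneg _) (by positivity)).1 h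

/-- The entries of `√W` are square integrable on two periods, so Cauchy–Schwarz bounds the integral
of the source by the norm of `g`. -/
lemma rootSource_bound (g : Lp Plane 2 ((baseMeasure q w).restrict (Ico 0 (2 * ω)))) :
    Integrable (rootSource q w ω g) (baseMeasure q w) ∧
      ∫ t in Metric.closedBall 0 (2 * ω), ‖rootSource q w ω g t‖ ∂baseMeasure q w
        ≤ ‖(memLp_entrySum_wRoot (q := q) (w := w) (Metric.isBounded_Ico 0 (2 * ω))).toLp _‖ * ‖g‖ := by
  obtain ⟨h1, h2⟩ := integral_mul_norm_le
    (memLp_entrySum_wRoot (q := q) (w := w) (Metric.isBounded_Ico 0 (2 * ω))) g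
  have hb : ∀ x, ‖wRoot q w x *ᵥ (g x).ofLp‖ ≤ entrySum (wRoot q w x) * ‖g x‖ := fun x =>
    (norm_mulVec_le_entrySum _ _).trans
      (mul_le_mul_of_nonneg_left (norm_ofLp_le _) (entrySum_nonneg _))
  have hm : Measurable fun x => wRoot q w x *ᵥ (g x).ofLp :=
    measurable_mulVec measurable_wRoot (measurable_ofLp (Lp.stronglyMeasurable g).measurable)
  have hi : IntegrableOn (fun x => wRoot q w x *ᵥ (g x).ofLp) (Ico 0 (2 * ω)) (baseMeasure q w) :=
    Integrable.mono' h1 hm.aestronglyMeasurable (Eventually.of_forall hb)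
  have hI : Integrable (rootSource q w ω g) (baseMeasure q w) :=
    (integrable_indicator_iff measurableSet_Ico).2 hi
  refine ⟨hI, ?_⟩
  calc ∫ t in Metric.closedBall 0 (2 * ω), ‖rootSource q w ω g t‖ ∂baseMeasure q w
      ≤ ∫ t, ‖rootSource q w ω g t‖ ∂baseMeasure q w :=
        setIntegral_le_integral hI.norm (Eventually.of_forall fun _ => norm_nonneg _)
    _ = ∫ t in Ico 0 (2 * ω), ‖wRoot q w t *ᵥ (g t).ofLp‖ ∂baseMeasure q w := by
        rw [← integral_indicator measurableSet_Ico]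
        refine integral_congr_ae (Eventually.of_forall fun t => ?_)
        simp only [rootSource, norm_indicator_eq_indicator_norm]
    _ ≤ ∫ t in Ico 0 (2 * ω), entrySum (wRoot q w t) * ‖g t‖ ∂baseMeasure q w :=
        integral_mono hi.norm h1 hb
    _ ≤ _ := h2

lemma IsBalancedBV.locallyIntegrable_dotProduct {y h : ℝ → Fin 2 → ℂ} (hy : IsBalancedBV y)
    (hh : LocallyIntegrable h (baseMeasure q w)) :
    LocallyIntegrable (fun x => y x ⬝ᵥ h x) (baseMeasure q w) := by
  simp only [dotProduct, mul_comm (y _ _)]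
  refine LocallyIntegrable.finset_sum fun i _ => ?_
  refine LocallyIntegrable.mul_bounded (locallyIntegrable_apply hh i)
    ((measurable_pi_apply i).comp hy.measurable) fun K hK => ?_
  obtain ⟨C, hC⟩ := hy.exists_bound hK
  exact ⟨C, fun x hx => hC x hx i⟩

lemma wRoot_mulVec_dotProduct (x : ℝ) (a b : Fin 2 → ℂ) :
    (wRoot q w x *ᵥ a) ⬝ᵥ b = a ⬝ᵥ wRoot q w x *ᵥ b := by
  rw [Matrix.dotProduct_mulVec, ← Matrix.mulVec_transpose, wRoot_transpose]

lemma rootSource_add (g h : ℝ → Plane) :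
    rootSource q w ω (g + h) = rootSource q w ω g + rootSource q w ω h := by
  rw [rootSource, rootSource, rootSource, ← indicator_add']
  congr 1
  ext1 x
  rw [Pi.add_apply, Pi.add_apply, WithLp.ofLp_add, Matrix.mulVec_add]

lemma rootSource_smul (c : ℂ) (g : ℝ → Plane) :
    rootSource q w ω (c • g) = c • rootSource q w ω g := by
  ext1 x
  rw [Pi.smul_apply, rootSource, rootSource]
  by_cases hm : x ∈ Ico 0 (2 * ω)
  · rw [indicator_of_mem hm, indicator_of_mem hm, Pi.smul_apply, WithLp.ofLp_smul,
      Matrix.mulVec_smul]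
  · rw [indicator_of_notMem hm, indicator_of_notMem hm, smul_zero]

lemma rootSource_congr {g h : ℝ → Plane}
    (e : g =ᵐ[(baseMeasure q w).restrict (Ico 0 (2 * ω))] h) :
    rootSource q w ω g =ᵐ[baseMeasure q w] rootSource q w ω h := by
  filter_upwards [(ae_restrict_iff' measurableSet_Ico).1 e] with x hx
  simp only [rootSource]
  by_cases hm : x ∈ Ico 0 (2 * ω)
  · rw [indicator_of_mem hm, indicator_of_mem hm, hx hm]
  · rw [indicator_of_notMem hm, indicator_of_notMem hm]

/-- The solution operator of the quasi-periodic boundary value problem. -/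
lemma exists_boundary_operator (hJ : IsUnit J) (hω : 0 < ω) (h0 : (0 : ℂ) ∉ exceptionalSet J q w)
    (hz : ∀ y ∈ solutions J q w 0, leftLim y (2 * ω) = z • leftLim y 0 → y = 0) :
    ∃ R : Lp Plane 2 ((baseMeasure q w).restrict (Ico 0 (2 * ω))) →ₗ[ℂ] (ℝ → Fin 2 → ℂ), ∃ C : ℝ,
      0 ≤ C ∧ ∀ g, HasSource J q w (R g) (rootSource q w ω g) ∧
        leftLim (R g) (2 * ω) = z • leftLim (R g) 0 ∧ ∀ x ∈ Ico 0 (2 * ω), ‖R g x‖ ≤ C * ‖g‖ := by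
  obtain ⟨C, hC, H⟩ := exists_hasSource_boundary hJ hω h0 hz
  choose R hR hRz hRb using fun g : Lp Plane 2 ((baseMeasure q w).restrict (Ico 0 (2 * ω))) =>
    H _ (rootSource_bound g).1.locallyIntegrable
  -- Uniqueness makes the solutions, which were chosen separately for each `g`, depend linearly on
  -- `g`.
  have uniq : ∀ {u v h : ℝ → Fin 2 → ℂ}, HasSource J q w u h → HasSource J q w v h →
      leftLim u (2 * ω) = z • leftLim u 0 → leftLim v (2 * ω) = z • leftLim v 0 → u = v := by
    intro u v h hu hv hu1 hv1
    have hd := hu.sub hv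
    rw [sub_self] at hd
    have := hz (u - v) ((mem_solutions_zero_iff hJ).2 hd) (by
      rw [leftLim_sub hu hv, leftLim_sub hu hv, hu1, hv1, smul_sub])
    exact sub_eq_zero.1 this
  refine ⟨{ toFun := R, map_add' := fun g h => ?_, map_smul' := fun c g => ?_ }, C * _,
    mul_nonneg hC (norm_nonneg _), fun g => ⟨hR g, hRz g, fun x hx => (hRb g x hx).trans
      ((mul_le_mul_of_nonneg_left (rootSource_bound g).2 hC).trans_eq (mul_assoc _ _ _).symm)⟩⟩
  · refine uniq ((hR (g + h)).congr (k := rootSource q w ω g + rootSource q w ω h) ?_)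
      ((hR g).add (hR h)) (hRz _) ?_
    · rw [← rootSource_add]
      exact rootSource_congr (Lp.coeFn_add g h)
    · rw [leftLim_add (hR g) (hR h), leftLim_add (hR g) (hR h), hRz, hRz, smul_add]
  · refine uniq ((hR (c • g)).congr (k := c • rootSource q w ω g) ?_)
      ((hR g).smul c) (hRz _) ?_
    · rw [← rootSource_smul]
      exact rootSource_congr (Lp.coeFn_smul c g)
    · rw [RingHom.id_apply, leftLim_smul (hR g), leftLim_smul (hR g), hRz, smul_comm]

end Resolvent

/-! ### A constant discriminant forces an invisible solution. -/

section ConstantDiscriminant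

open scoped InnerProductSpace

variable {J : Matrix (Fin 2) (Fin 2) ℝ} {q : Matrix (Fin 2) (Fin 2) OrderZero} {w : Weight}
  {ω : ℝ} {z d : ℂ}

variable (q w ω) in
/-- Multiplication by `√W` on two periods, after `R`. -/
def rootComp {E : Type*} [AddCommGroup E] [Module ℂ E] (R : E →ₗ[ℂ] (ℝ → Fin 2 → ℂ)) :
    E →ₗ[ℂ] (ℝ → Plane) where
  toFun g := (Ico 0 (2 * ω)).indicator fun x => WithLp.toLp 2 (wRoot q w x *ᵥ R g x)
  map_add' g h := by
    ext1 x
    by_cases hm : x ∈ Ico 0 (2 * ω)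
    · simp only [Pi.add_apply, indicator_of_mem hm, map_add, Matrix.mulVec_add, WithLp.toLp_add]
    · simp only [Pi.add_apply, indicator_of_notMem hm, add_zero]
  map_smul' c g := by
    ext1 x
    by_cases hm : x ∈ Ico 0 (2 * ω)
    · simp only [Pi.smul_apply, indicator_of_mem hm, map_smul, Matrix.mulVec_smul,
        WithLp.toLp_smul, RingHom.id_apply]
    · simp only [Pi.smul_apply, indicator_of_notMem hm, smul_zero]

lemma rootComp_of_mem {E : Type*} [AddCommGroup E] [Module ℂ E] (R : E →ₗ[ℂ] (ℝ → Fin 2 → ℂ))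
    (g : E) {x : ℝ} (hx : x ∈ Ico 0 (2 * ω)) :
    rootComp q w ω R g x = WithLp.toLp 2 (wRoot q w x *ᵥ R g x) :=
  indicator_of_mem (f := fun x => (WithLp.toLp 2 (wRoot q w x *ᵥ R g x) : Plane)) hx

lemma norm_rootComp_le {E : Type*} [NormedAddCommGroup E] [Module ℂ E]
    (R : E →ₗ[ℂ] (ℝ → Fin 2 → ℂ)) {C : ℝ}
    (hR : ∀ g, ∀ x ∈ Ico 0 (2 * ω), ‖R g x‖ ≤ C * ‖g‖) (hC : 0 ≤ C) (g : E) (x : ℝ) :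
    ‖rootComp q w ω R g x‖ ≤ 2 * C * entrySum (wRoot q w x) * ‖g‖ := by
  have h0 := entrySum_nonneg (wRoot q w x)
  by_cases hm : x ∈ Ico 0 (2 * ω)
  · rw [rootComp_of_mem R g hm]
    calc _ ≤ 2 * ‖wRoot q w x *ᵥ R g x‖ := norm_toLp_le _
      _ ≤ 2 * (entrySum (wRoot q w x) * (C * ‖g‖)) := by
        gcongr
        exact (norm_mulVec_le_entrySum _ _).trans (mul_le_mul_of_nonneg_left (hR g x hm) h0)
      _ = _ := by ring
  · have : rootComp q w ω R g x = 0 :=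
      indicator_of_notMem (f := fun x => (WithLp.toLp 2 (wRoot q w x *ᵥ R g x) : Plane)) hm
    rw [this, norm_zero]
    positivity

lemma aestronglyMeasurable_rootComp {E : Type*} [AddCommGroup E] [Module ℂ E]
    (R : E →ₗ[ℂ] (ℝ → Fin 2 → ℂ)) {μ : Measure ℝ} (hR : ∀ g, Measurable (R g)) (g : E) :
    AEStronglyMeasurable (rootComp q w ω R g) μ := by
  refine Measurable.aestronglyMeasurable (Measurable.indicator ?_ measurableSet_Ico)
  exact (PiLp.continuous_toLp 2 _).measurable.comp (measurable_mulVec measurable_wRoot (hR g))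

/-- A unimodular `z` makes the boundary condition self-adjoint: the boundary form at `2ω` is `z̄ z`
times that at `0`. -/
lemma boundary_term_eq_zero (hzz : star z * z = 1) {u v h : ℝ → Fin 2 → ℂ}
    (hu : HasSource J q w u h) (hub : leftLim u (2 * ω) = z • leftLim u 0)
    (hvb : leftLim v (2 * ω) = z • leftLim v 0) :
    leftLim (star u) (2 * ω) ⬝ᵥ complexify J *ᵥ leftLim v (2 * ω)
      - leftLim (star u) 0 ⬝ᵥ complexify J *ᵥ leftLim v 0 = 0 := by
  rw [leftLim_star hu, leftLim_star hu, hub, hvb, star_smul, Matrix.mulVec_smul, smul_dotProduct,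
    dotProduct_smul, smul_smul, hzz, one_smul, sub_self]

/-- Lagrange's identity for the conjugate of `u` and for `v`, whose boundary terms cancel. It
expresses the symmetry of the solution operator. -/
lemma integral_star_dotProduct_comm (hJ : IsUnit J) (hJs : Jᵀ = -J) (hqs : q.IsSymm) (hω : 0 < ω)
    (hzz : star z * z = 1) {u v h k : ℝ → Fin 2 → ℂ}
    (hu : HasSource J q w u h) (hv : HasSource J q w v k)
    (hh : LocallyIntegrable h (baseMeasure q w)) (hk : LocallyIntegrable k (baseMeasure q w))
    (hub : leftLim u (2 * ω) = z • leftLim u 0) (hvb : leftLim v (2 * ω) = z • leftLim v 0) :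
    ∫ t in Ico 0 (2 * ω), star (u t) ⬝ᵥ k t ∂baseMeasure q w
      = ∫ t in Ico 0 (2 * ω), star (h t) ⬝ᵥ v t ∂baseMeasure q w := by
  have hl := (hu.star hJ).lagrange hJ hJs hqs hv (show (0 : ℝ) ≤ 2 * ω by linarith)
  rw [boundary_term_eq_zero hzz hu hub hvb] at hl
  have hsh : LocallyIntegrable (star h) (baseMeasure q w) :=
    locallyIntegrable_pi fun i =>
      LocallyIntegrable.clm (Complex.conjCLE : ℂ →L[ℝ] ℂ) (locallyIntegrable_apply hh i)
  have i1 := integrableOn_Ico ((hu.star hJ).isBalancedBV.locallyIntegrable_dotProduct hk) 0 (2 * ω)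
  have i2 := integrableOn_Ico (hv.isBalancedBV.locallyIntegrable_dotProduct hsh) 0 (2 * ω)
  simp only [dotProduct_comm (v _)] at i2
  rw [integral_sub i1 i2] at hl
  exact sub_eq_zero.1 hl.symm

/-- For a constant discriminant the boundary value problem with a non-exceptional multiplier has
only solutions that are annihilated by `w`. -/
lemma exists_annihilated_solution (hJ : IsUnit J) (hJs : Jᵀ = -J) (hqs : q.IsSymm) (hω : 0 < ω)
    (hq : ∀ i j, (q i j).IsPeriod ω) (hw : ∀ i j, (w.entry i j).IsPeriod ω)
    (hreal : ∀ lam : ℝ, (lam : ℂ) ∉ exceptionalSet J q w)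
    (hd : ∀ lam ∉ exceptionalSet J q w, discriminant J q w ω lam = d)
    (hzz : star z * z = 1) (hz : (z + 1) ^ 2 ≠ d ^ 2 * z) {y : ℝ → Fin 2 → ℂ}
    (hy : HasSource J q w y 0) :
    ∃ u h, HasSource J q w u h ∧
      (∀ᵐ x ∂baseMeasure q w, x ∈ Ico 0 (2 * ω) → h x = wMat q w x *ᵥ star (y x)) ∧
      leftLim u (2 * ω) = z • leftLim u 0 ∧
      ∀ᵐ x ∂baseMeasure q w, x ∈ Ico 0 (2 * ω) → wMat q w x *ᵥ u x = 0 := by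
  have h0 : (0 : ℂ) ∉ exceptionalSet J q w := by simpa using hreal 0
  have hinj : ∀ lam ∉ exceptionalSet J q w, ∀ y ∈ solutions J q w lam,
      leftLim y (2 * ω) = z • leftLim y 0 → y = 0 := fun lam hlam y hy hb =>
    eq_zero_of_boundary hJ hJs hqs hω hq hw hlam (by rwa [hd lam hlam]) hy hb
  have hex := exists_boundary_operator hJ hω h0 (hinj 0 h0)
  set μ := (baseMeasure q w).restrict (Ico 0 (2 * ω)) with hμ
  obtain ⟨R, C, hC, hR⟩ := hex
  have hs := (memLp_entrySum_wRoot (q := q) (w := w) (Metric.isBounded_Ico 0 (2 * ω))).const_mul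
    (2 * C)
  have hF := norm_rootComp_le (q := q) (w := w) (ω := ω) R (fun g => (hR g).2.2) hC
  have hm := aestronglyMeasurable_rootComp (q := q) (w := w) (ω := ω) (μ := μ) R
    fun g => (hR g).1.measurable
  have hI : ∀ {p : ℝ → Prop}, (∀ᵐ x ∂μ, p x) ↔ ∀ᵐ x ∂baseMeasure q w, x ∈ Ico 0 (2 * ω) → p x :=
    ae_restrict_iff' measurableSet_Ico
  have hsym : ∀ g h : Lp Plane 2 μ, ∫ x, ⟪rootComp q w ω R g x, h x⟫_ℂ ∂μ
      = ∫ x, ⟪g x, rootComp q w ω R h x⟫_ℂ ∂μ := by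
    intro g h
    have key := integral_star_dotProduct_comm hJ hJs hqs hω hzz (hR g).1 (hR h).1
      (rootSource_bound g).1.locallyIntegrable (rootSource_bound h).1.locallyIntegrable
      (hR g).2.1 (hR h).2.1
    refine Eq.trans (setIntegral_congr_fun measurableSet_Ico fun x hx => ?_)
      (key.trans (setIntegral_congr_fun measurableSet_Ico fun x hx => ?_))
    · simp only [rootComp_of_mem R g hx, EuclideanSpace.inner_eq_star_dotProduct, rootSource,
        indicator_of_mem hx]
      rw [star_mulVec_of_real (star_wRoot x), dotProduct_comm, wRoot_mulVec_dotProduct]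
    · simp only [rootComp_of_mem R h hx, EuclideanSpace.inner_eq_star_dotProduct, rootSource,
        indicator_of_mem hx]
      rw [star_mulVec_of_real (star_wRoot x), wRoot_mulVec_dotProduct, dotProduct_comm]
  -- If `√W R g = κ g`, the source `√W g` of `R g` equals `κ⁻¹ W R g`, so on two periods `R g`
  -- solves the equation with parameter `κ⁻¹`. Its continuation `v` to the line satisfies the
  -- boundary condition and must vanish, because the discriminant at `κ⁻¹` is again `d`.
  have heig : ∀ (κ : ℝ) (g : Lp Plane 2 μ), κ ≠ 0 →
      rootComp q w ω R g =ᵐ[μ] (κ : ℂ) • ⇑g → g = 0 := by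
    intro κ g hκ he
    have hκ' : (κ : ℂ) ≠ 0 := Complex.ofReal_ne_zero.2 hκ
    have hlam := hreal κ⁻¹
    set lam : ℂ := ((κ⁻¹ : ℝ) : ℂ) with hlamdef
    obtain ⟨C', -, H⟩ := exists_hasSource (q := q) (w := w) hJ hlam 0 0
    obtain ⟨v, hv, hv0, -⟩ := H 0 locallyIntegrable_zero (leftLim (R g) 0)
    simp only [Pi.zero_apply, add_zero] at hv
    have hd' := (hR g).1.sub hv
    have hloc : ∀ᵐ x ∂baseMeasure q w, x ∈ Ico 0 (2 * ω) →
        rootSource q w ω g x = lam • wMat q w x *ᵥ R g x := by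
      filter_upwards [hI.1 he, wRoot_mul_wRoot (q := q) (w := w)] with x h1 h2 hx
      have h3 := h1 hx
      rw [rootComp_of_mem R g hx, Pi.smul_apply] at h3
      have h4 : wRoot q w x *ᵥ R g x = (κ : ℂ) • (g x).ofLp := congrArg WithLp.ofLp h3
      rw [rootSource, indicator_of_mem hx, ← h2, ← Matrix.mulVec_mulVec, h4, Matrix.mulVec_smul,
        smul_smul, hlamdef, Complex.ofReal_inv, inv_mul_cancel₀ hκ', one_smul]
    have hfw := hd'.eq_zero_forward hJ hlam (show (0 : ℝ) ≤ 2 * ω by linarith)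
      (by rw [leftLim_sub (hR g).1 hv, hv0, sub_self]) (by
        filter_upwards [hloc] with x h1 hx
        rw [Pi.sub_apply, h1 hx, Pi.sub_apply, Matrix.mulVec_sub, smul_sub])
    have hv00 : v = 0 := by
      refine hinj lam hlam v ((mem_solutions_iff_hasSource hJ).2 hv) ?_
      have := hfw.1
      rw [leftLim_sub (hR g).1 hv, sub_eq_zero, (hR g).2.1] at this
      rw [← this, hv0]
    refine (Lp.eq_zero_iff_ae_eq_zero).2 (hI.2 ?_)
    filter_upwards [hI.1 he] with x h1 hx
    have h3 := h1 hx
    have h4 := hfw.2 x hx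
    rw [Pi.sub_apply, hv00, Pi.zero_apply, sub_zero] at h4
    rw [rootComp_of_mem R g hx, Pi.smul_apply, h4, Matrix.mulVec_zero, WithLp.toLp_zero] at h3
    exact (smul_eq_zero.1 h3.symm).resolve_left hκ'
  have hall := carlemanOperator_eq_zero hs hF hm hsym heig
  have hys := hy.star hJ
  -- The choice `g = √W ȳ` makes the source `√W g` equal to `W ȳ` on two periods.
  have hg : MemLp (fun x => (WithLp.toLp 2 (wRoot q w x *ᵥ star y x) : Plane)) 2 μ := by
    obtain ⟨B', hB'⟩ := hys.isBalancedBV.exists_bound (isCompact_Icc (a := (0 : ℝ)) (b := 2 * ω))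
    refine MemLp.of_le_mul (c := 2 * max B' 0)
      (memLp_entrySum_wRoot (q := q) (w := w) (Metric.isBounded_Ico 0 (2 * ω)))
      ((PiLp.continuous_toLp 2 _).measurable.comp
        (measurable_mulVec measurable_wRoot hys.measurable)).aestronglyMeasurable
      ((ae_restrict_iff' measurableSet_Ico).2 (Eventually.of_forall fun x hx => ?_))
    have h1 : ‖star y x‖ ≤ max B' 0 := (pi_norm_le_iff_of_nonneg (le_max_right _ _)).2 fun i =>
      (hB' x (Ico_subset_Icc_self hx) i).trans (le_max_left _ _)
    have h2 := entrySum_nonneg (wRoot q w x)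
    calc _ ≤ 2 * ‖wRoot q w x *ᵥ star y x‖ := norm_toLp_le _
      _ ≤ 2 * (entrySum (wRoot q w x) * max B' 0) := by
        gcongr
        exact (norm_mulVec_le_entrySum _ _).trans (mul_le_mul_of_nonneg_left h1 h2)
      _ = _ := by rw [Real.norm_of_nonneg h2]; ring
  refine ⟨R hg.toLp, _, (hR _).1, ?_, (hR _).2.1, ?_⟩
  · filter_upwards [hI.1 hg.coeFn_toLp, wRoot_mul_wRoot (q := q) (w := w)] with x h1 h2 hx
    rw [rootSource, indicator_of_mem hx, h1 hx, ← h2, ← Matrix.mulVec_mulVec]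
    rfl
  · filter_upwards [hI.1 (hall hg.toLp), wRoot_mul_wRoot (q := q) (w := w)] with x h1 h2 hx
    have h3 := h1 hx
    rw [rootComp_of_mem R _ hx] at h3
    have h4 : wRoot q w x *ᵥ R hg.toLp x = 0 := congrArg WithLp.ofLp h3
    rw [← h2, ← Matrix.mulVec_mulVec, h4, Matrix.mulVec_zero]

/-- The numbers `-1`, `1` and `i` are excluded only for `d² = 0`, `d² = 4` and `d² = 2`
respectively, so at least two of them are always available. -/
lemma exists_two_multipliers (d : ℂ) : ∃ z₁ z₂ : ℂ, z₁ ≠ z₂ ∧ star z₁ * z₁ = 1 ∧ star z₂ * z₂ = 1 ∧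
    (z₁ + 1) ^ 2 ≠ d ^ 2 * z₁ ∧ (z₂ + 1) ^ 2 ≠ d ^ 2 * z₂ := by
  have hI : (Complex.I + 1) ^ 2 = 2 * Complex.I := by
    linear_combination Complex.I_sq
  have h1I : (1 : ℂ) ≠ Complex.I := fun h => by simpa using congrArg Complex.re h
  have h2I : (-1 : ℂ) ≠ Complex.I := fun h => by simpa using congrArg Complex.re h
  by_cases h0 : d ^ 2 = 0
  · exact ⟨1, Complex.I, h1I, by simp, by simp, by rw [h0]; norm_num, by
      rw [h0, hI, zero_mul]
      exact mul_ne_zero two_ne_zero Complex.I_ne_zero⟩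
  · have hm : ((-1 : ℂ) + 1) ^ 2 ≠ d ^ 2 * -1 := by
      rw [neg_add_cancel, zero_pow two_ne_zero, mul_neg, mul_one]
      exact (neg_ne_zero.2 h0).symm
    by_cases h4 : d ^ 2 = 4
    · refine ⟨-1, Complex.I, h2I, by simp, by simp, hm, ?_⟩
      rw [h4, hI]
      intro h
      have := mul_right_cancel₀ Complex.I_ne_zero h
      norm_num at this
    · refine ⟨-1, 1, by norm_num, by simp, by simp, hm, ?_⟩
      intro h
      exact h4 (by linear_combination -h)

/-- Two multipliers give solutions `u` and `v` with the same source on two periods, both killed by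
`w` there. Their difference is homogeneous, so their left-hand limits agree at `0` and at `2ω`.
Hence `z₁ u(0) = z₂ u(0)`, which forces `u` to vanish at both ends. -/
lemma L0_ne_bot_of_discriminant_const (hJ : IsUnit J) (hJs : Jᵀ = -J) (hqs : q.IsSymm)
    (hω : 0 < ω) (hq : ∀ i j, (q i j).IsPeriod ω) (hw : ∀ i j, (w.entry i j).IsPeriod ω)
    (hreal : ∀ lam : ℝ, (lam : ℂ) ∉ exceptionalSet J q w)
    (hd : ∀ lam ∉ exceptionalSet J q w, discriminant J q w ω lam = d) : L0 J q w ≠ ⊥ := by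
  intro hL
  have h0 : (0 : ℂ) ∉ exceptionalSet J q w := by simpa using hreal 0
  refine false_of_forall_exists_compactly_supported hJ hJs hqs hω hq hw h0 hL fun y hy => ?_
  obtain ⟨z₁, z₂, hne, hz₁, hz₂, hd₁, hd₂⟩ := exists_two_multipliers d
  obtain ⟨u, h, hu, hh, hub, huW⟩ :=
    exists_annihilated_solution hJ hJs hqs hω hq hw hreal hd hz₁ hd₁ hy
  obtain ⟨v, k, hv, hk, hvb, hvW⟩ :=
    exists_annihilated_solution hJ hJs hqs hω hq hw hreal hd hz₂ hd₂ hy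
  obtain ⟨e0, e1⟩ := leftLim_eq_zero_of_wMat_mulVec_eq_zero hJ hω hq hw h0 hL (hu.sub hv) (a := 0)
    (by
      rw [zero_add]
      filter_upwards [hh, hk] with x h1 h2 hx
      rw [Pi.sub_apply, h1 hx, h2 hx, sub_self])
    (by
      rw [zero_add]
      filter_upwards [huW, hvW] with x h1 h2 hx
      rw [Pi.sub_apply, Matrix.mulVec_sub, h1 hx, h2 hx, sub_self])
  rw [leftLim_sub hu hv, sub_eq_zero] at e0
  rw [zero_add, leftLim_sub hu hv, sub_eq_zero, hub, hvb, ← e0, ← sub_eq_zero, ← sub_smul] at e1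
  have hz := (smul_eq_zero.1 e1).resolve_left (sub_ne_zero.2 hne)
  exact ⟨u, h, hu, hh, hz, by rw [hub, hz, smul_zero]⟩

end ConstantDiscriminant

end Floquet

end

theorem mainTheorem7
    (J : Matrix (Fin 2) (Fin 2) ℝ) (hJskew : Jᵀ = -J) (hJinv : IsUnit J)
    (q : Matrix (Fin 2) (Fin 2) OrderZero) (hq : q.IsSymm)
    (w : Weight)
    (ω : ℝ) (hω : 0 < ω)
    (hqper : ∀ i j, (q i j).IsPeriod ω)
    (hwper : ∀ i j, (w.entry i j).IsPeriod ω)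
    (hB : ∀ lam x : ℝ, IsUnit (B J q w 1 x lam) ∧ IsUnit (B J q w (-1) x lam)) :
    ((∃ c : ℂ, ∀ lam ∉ exceptionalSet J q w, discriminant J q w ω lam = c) ↔
      Tmax J q w = {(0 : L2 w)} ×ˢ (Set.univ : Set (L2 w))) ∧
    (Module.finrank ℂ (L0 J q w) = 1 →
      ∀ lam ∉ exceptionalSet J q w, ∀ t ∈ Set.Ioo (-2 : ℝ) 2, discriminant J q w ω lam ≠ t) := by
  have hreal : ∀ lam : ℝ, (lam : ℂ) ∉ exceptionalSet J q w := by
    rintro lam ⟨x, h | h⟩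
    · exact h (hB lam x).1
    · exact h (hB lam x).2
  have h0 : (0 : ℂ) ∉ exceptionalSet J q w := by simpa using hreal 0
  refine ⟨⟨?_, fun hT => ?_⟩, fun hdim lam hlam t ht => ?_⟩
  · rintro ⟨d, hd⟩
    exact Floquet.Tmax_eq_of_L0 hJinv hJskew hq hω hqper hwper (fun lam x => (hB lam x).1) h0
      (Floquet.L0_ne_bot_of_discriminant_const hJinv hJskew hq hω hqper hwper hreal hd)
  · exact Floquet.discriminant_const_of_L0 hJinv hJskew hq hω hqper hwper h0
      (Floquet.L0_ne_bot_of_Tmax hJinv hJskew hq hω hqper hwper h0 hT)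
  · exact Floquet.discriminant_ne_of_finrank_L0 hJinv hJskew hq hω hqper hwper h0 hdim hlam ht
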